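/- Let $G$ be a finite simple graph and let $\mathcal F: \emptyset=G_0\leftrightarrow G_1\leftrightarrow\cdots\leftrightarrow G_m$ be a zigzag filtration of $G$: each $G_i$ is a subgraph of $G$ and, for each $i<m$, one of $G_i$, $G_{i+1}$ arises from the other by adding a single simplex (a vertex or an edge). Let $\mathsf H_0(\mathcal F): \mathsf H_0(G_0)\leftrightarrow\cdots\leftrightarrow \mathsf H_0(G_m)$ be the induced zigzag module, with $\mathbb Z_2$ coefficients and the linear maps induced by the inclusions. Its barcode $\mathsf{Pers}(\mathsf H_0(\mathcal F))$ is the multiset of intervals $[b_\alpha,d_\alpha]\subseteq[0,m]$ of a decomposition $\mathsf H_0(\mathcal F)=\bigoplus_\alpha \mathcal I^{[b_\alpha,d_\alpha]}$ into interval submodules (one-dimensional over $[b_\alpha,d_\alpha]$ with isomorphisms in between, and zero elsewhere). The barcode graph of $\mathcal F$ has one level-$i$ node for each connected component of $G_i$ ($0\le i\le m$); a level-$i$ node and a level-$(i+1)$ node are joined by an edge iff the inclusion between $G_i$ and $G_{i+1}$ maps one of the two components into the other. Algorithm. Start from the empty barcode forest $T_0$ and the empty multiset of intervals. Forest nodes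 carry levels and the root of a tree is its lowest node; a node is splitting if it connects to two different nodes on the next level. For $i=0,\dots,m-1$, form $T_{i+1}$ by copying into $T_i$ the level-$(i+1)$ nodes of the barcode graph and their connections to the level-$i$ nodes (which are the leaves of $T_i$), and then: \begin{itemize} \item (Departure) if a level-$i$ node $u$ connects to no level-$(i+1)$ node: if $u$ has a splitting ancestor, let $v$ be the highest one and $j$ its level, output $[j+1,i]$, and delete the path from $v$ to $u$, keeping $v$; otherwise let $j$ be the level of the root $v$ of $u$, output $[j,i]$, and delete the path from $v$ to $u$, including $v$. \item (Merge) if two different level-$i$ nodes $u_1,u_2$ connect to the same level-$(i+1)$ node: if they lie in different trees of $T_i$, let $j$ be the larger of the levels of their two roots and output $[j,i]$; otherwise let $j$ be the level of their highest common ancestor in $T_i$ and output $[j+1,i]$. In both cases glue, level by level, the two paths from $u_1$ and $u_2$ to their level-$j$ ancestors. \item In all other cases (entrance, split, no change) do nothing more. \end{itemize} At the end, output $[j,m]$ for each level-$j$ root of $T_m$, and $[j+1,m]$ for each level-$j$ splitting node of $T_m$. Theorem. The multiset of intervals output by this algorithm is the 0-th zigzag barcode $\mathsf{Pers}(\mathsf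 H_0(\mathcal F))$; that is, $\mathsf H_0(\mathcal F)$ has a decomposition into interval submodules whose multiset of intervals is the output, and the multiset of intervals of every such decomposition equals the output. -/

import Mathlib

/-! ## Zigzag modules over the two-element field and their barcodes -/

/-- A zigzag module `V₀ ↔ V₁ ↔ ⋯ ↔ Vₘ` over `ℤ/2`: the `i`-th linear map is either forward
(`Sum.inl`, from `Vᵢ` to `Vᵢ₊₁`) or backward (`Sum.inr`, from `Vᵢ₊₁` to `Vᵢ`). -/
structure ZigzagModule (m : ℕ) where
  space : Fin (m + 1) → Type*
  [addCommGroup : ∀ i, AddCommGroup (space i)]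
  [module : ∀ i, Module (ZMod 2) (space i)]
  map : ∀ i : Fin m,
    (space i.castSucc →ₗ[ZMod 2] space i.succ) ⊕ (space i.succ →ₗ[ZMod 2] space i.castSucc)

attribute [instance] ZigzagModule.addCommGroup ZigzagModule.module

namespace ZigzagModule

variable {m : ℕ}

/-- A submodule of a zigzag module: a subspace of every space, such that every map restricts to
these subspaces. -/
structure Sub (M : ZigzagModule m) where
  carrier : ∀ i, Submodule (ZMod 2) (M.space i)
  forward : ∀ i f, M.map i = Sum.inl f → ∀ x ∈ carrier i.castSucc, f x ∈ carrier i.succ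
  backward : ∀ i f, M.map i = Sum.inr f → ∀ x ∈ carrier i.succ, f x ∈ carrier i.castSucc

/-- `S` is an interval submodule over `[b, d] ⊆ [0, m]`: one-dimensional exactly over `[b, d]`,
trivial elsewhere, and the restricted maps between indices of `[b, d]` are isomorphisms. -/
structure Sub.IsInterval {M : ZigzagModule m} (S : M.Sub) (b d : ℕ) : Prop where
  le : b ≤ d
  le_length : d ≤ m
  finrank_eq_one : ∀ i : Fin (m + 1), b ≤ i.val → i.val ≤ d →
    Module.finrank (ZMod 2) (S.carrier i) = 1
  eq_bot : ∀ i : Fin (m + 1), ¬ (b ≤ i.val ∧ i.val ≤ d) → S.carrier i = ⊥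
  forward_bijOn : ∀ i : Fin m, b ≤ i.val → i.val + 1 ≤ d → ∀ f, M.map i = Sum.inl f →
    Set.BijOn f (S.carrier i.castSucc : Set (M.space i.castSucc))
      (S.carrier i.succ : Set (M.space i.succ))
  backward_bijOn : ∀ i : Fin m, b ≤ i.val → i.val + 1 ≤ d → ∀ f, M.map i = Sum.inr f →
    Set.BijOn f (S.carrier i.succ : Set (M.space i.succ))
      (S.carrier i.castSucc : Set (M.space i.castSucc))

/-- `B` is the multiset of intervals `[b, d]` (written as pairs `(b, d)`) of an interval
decomposition of `M`, that is, of a decomposition of `M` as an internal direct sum of interval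
submodules. -/
def IsBarcode (M : ZigzagModule m) (B : Multiset (ℕ × ℕ)) : Prop :=
  ∃ (n : ℕ) (I : Fin n → ℕ × ℕ) (S : Fin n → M.Sub),
    (∀ a, (S a).IsInterval (I a).1 (I a).2) ∧
    (∀ i, DirectSum.IsInternal (fun a => (S a).carrier i)) ∧
    B = (Finset.univ : Finset (Fin n)).val.map I

end ZigzagModule

/-! ## Homology of graphs in degree zero -/

namespace GraphHomology

variable {W W' : Type*}

/-- The boundary of an edge `{u, v}`: the chain `u + v`. -/
noncomputable def edgeBoundary (e : Sym2 W) : W →₀ ZMod 2 :=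
  Sym2.lift ⟨fun u v => Finsupp.single u 1 + Finsupp.single v 1, fun _ _ => add_comm _ _⟩ e

/-- The boundary operator from 1-chains to 0-chains of a graph, with `ℤ/2` coefficients. -/
noncomputable def boundary (K : SimpleGraph W) : (K.edgeSet →₀ ZMod 2) →ₗ[ZMod 2] (W →₀ ZMod 2) :=
  Finsupp.linearCombination (ZMod 2) (fun e => edgeBoundary e.1)

/-- The 0-th homology of a graph with `ℤ/2` coefficients: 0-chains (all of which are cycles) modulo
boundaries of 1-chains. -/
abbrev H0 (K : SimpleGraph W) : Type _ := (W →₀ ZMod 2) ⧸ LinearMap.range (boundary K)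

theorem edgeBoundary_map (f : W → W') (e : Sym2 W) :
    Finsupp.lmapDomain (ZMod 2) (ZMod 2) f (edgeBoundary e) = edgeBoundary (e.map f) := by
  induction e using Sym2.ind with
  | _ u v => simp [edgeBoundary, Finsupp.mapDomain_add, Finsupp.mapDomain_single]

theorem range_boundary_le (K : SimpleGraph W) (K' : SimpleGraph W') (f : K →g K') :
    LinearMap.range (boundary K) ≤
      (LinearMap.range (boundary K')).comap (Finsupp.lmapDomain (ZMod 2) (ZMod 2) f) := by
  rintro _ ⟨c, rfl⟩
  have hc : boundary K c = ∑ e ∈ c.support, c e • edgeBoundary e.1 :=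
    Finsupp.linearCombination_apply _ _
  rw [Submodule.mem_comap, hc, map_sum]
  refine Submodule.sum_mem _ fun e _ => ?_
  rw [map_smul, edgeBoundary_map]
  refine Submodule.smul_mem _ _ ⟨Finsupp.single (f.mapEdgeSet e) 1, ?_⟩
  rw [boundary, Finsupp.linearCombination_single, one_smul]
  rfl

/-- The linear map in 0-th homology induced by a map of graphs. -/
noncomputable def H0map {K : SimpleGraph W} {K' : SimpleGraph W'} (f : K →g K') :
    H0 K →ₗ[ZMod 2] H0 K' :=
  Submodule.mapQ _ _ (Finsupp.lmapDomain (ZMod 2) (ZMod 2) f) (range_boundary_le K K' f)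

end GraphHomology

/-! ## The pairing algorithm on a graph with levels -/

/-- A barcode forest. A node is a pair `(k, s)`, where `k` is its level and `s` is the set of those
level-`k` nodes of the barcode graph that have been glued together to form it. An edge is a pair
`(parent, child)`; the parent is the endpoint on the lower level. -/
structure BarcodeForest (β : Type*) where
  nodes : Finset (ℕ × Finset β)
  edges : Finset ((ℕ × Finset β) × (ℕ × Finset β))

namespace BarcodeForest

variable {β : Type*}

/-- `x` is `y` itself or an ancestor of `y`. -/
def Anc (T : BarcodeForest β) (x y : ℕ × Finset β) : Prop :=
  Relation.ReflTransGen (fun p c => (p, c) ∈ T.edges) x y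

def IsRoot (T : BarcodeForest β) (x : ℕ × Finset β) : Prop :=
  x ∈ T.nodes ∧ ∀ p, (p, x) ∉ T.edges

/-- `x` connects to two different nodes on the next level. -/
def IsSplitting (T : BarcodeForest β) (x : ℕ × Finset β) : Prop :=
  x ∈ T.nodes ∧ ∃ c₁ c₂, c₁ ≠ c₂ ∧ (x, c₁) ∈ T.edges ∧ (x, c₂) ∈ T.edges

def SameTree (T : BarcodeForest β) (x y : ℕ × Finset β) : Prop :=
  ∃ r, T.IsRoot r ∧ T.Anc r x ∧ T.Anc r y

open Classical in
/-- The highest level of a node of `T` with the property `P` (and `0` if there is none). -/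
noncomputable def topLevel (T : BarcodeForest β) (P : ℕ × Finset β → Prop) : ℕ :=
  (T.nodes.filter P).sup Prod.fst

/-- The level of the root of the tree containing `x`. -/
noncomputable def rootLevel (T : BarcodeForest β) (x : ℕ × Finset β) : ℕ :=
  T.topLevel (fun r => T.IsRoot r ∧ T.Anc r x)

open Classical in
/-- Copying the level-`(i+1)` nodes of the barcode graph `Γ`, and their connections to the level-`i`
nodes, into `T`. -/
noncomputable def copyLevel [Fintype β] (Γ : SimpleGraph β) (level : β → ℕ) (i : ℕ)
    (T : BarcodeForest β) : BarcodeForest β where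
  nodes := T.nodes ∪ ((Finset.univ : Finset β).filter (fun c => level c = i + 1)).image
    (fun c => (i + 1, {c}))
  edges := T.edges ∪ ((Finset.univ : Finset (β × β)).filter
    (fun p => level p.1 = i ∧ level p.2 = i + 1 ∧ Γ.Adj p.1 p.2)).image
    (fun p => ((i, {p.1}), (i + 1, {p.2})))

open Classical in
/-- Deleting the nodes with property `P`, together with all edges at such nodes. -/
noncomputable def delete (T : BarcodeForest β) (P : ℕ × Finset β → Prop) : BarcodeForest β where
  nodes := T.nodes.filter (fun x => ¬ P x)
  edges := T.edges.filter (fun e => ¬ P e.1 ∧ ¬ P e.2)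

open Classical in
/-- The node into which `x` is turned when the two paths from `u₁` and `u₂` to their level-`j`
ancestors are glued level by level. -/
noncomputable def glueNode (T : BarcodeForest β) (u₁ u₂ : ℕ × Finset β) (j : ℕ)
    (x : ℕ × Finset β) : ℕ × Finset β :=
  if j ≤ x.1 ∧ (T.Anc x u₁ ∨ T.Anc x u₂) then
    (x.1, (T.nodes.filter (fun y => y.1 = x.1 ∧ (T.Anc y u₁ ∨ T.Anc y u₂))).biUnion Prod.snd)
  else x

open Classical in
/-- Gluing the two paths from `u₁` and `u₂` to their level-`j` ancestors. -/
noncomputable def glue (T : BarcodeForest β) (u₁ u₂ : ℕ × Finset β) (j : ℕ) : BarcodeForest β where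
  nodes := T.nodes.image (T.glueNode u₁ u₂ j)
  edges := T.edges.image (fun e => (T.glueNode u₁ u₂ j e.1, T.glueNode u₁ u₂ j e.2))

/-- `u` is a level-`i` node that does not connect to any level-`(i+1)` node. -/
def IsDeparting (T : BarcodeForest β) (i : ℕ) (u : ℕ × Finset β) : Prop :=
  u ∈ T.nodes ∧ u.1 = i ∧ ∀ c, (u, c) ∉ T.edges

/-- `u.1` and `u.2` are two different level-`i` nodes connecting to the same level-`(i+1)` node. -/
def IsMerging (T : BarcodeForest β) (i : ℕ) (u : (ℕ × Finset β) × (ℕ × Finset β)) : Prop :=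
  u.1 ∈ T.nodes ∧ u.2 ∈ T.nodes ∧ u.1 ≠ u.2 ∧ u.1.1 = i ∧ u.2.1 = i ∧
    ∃ c, (u.1, c) ∈ T.edges ∧ (u.2, c) ∈ T.edges

open Classical in
/-- Treatment of the departure of the level-`i` node `u`: the new forest and the interval. If `u`
has a splitting ancestor, the nodes strictly above the highest one on the path to `u` are deleted;
otherwise the whole path from the root to `u` is deleted. -/
noncomputable def departure (T : BarcodeForest β) (i : ℕ) (u : ℕ × Finset β) :
    BarcodeForest β × (ℕ × ℕ) :=
  if ∃ v, T.IsSplitting v ∧ T.Anc v u then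
    let j := T.topLevel (fun v => T.IsSplitting v ∧ T.Anc v u)
    (T.delete (fun x => T.Anc x u ∧ j < x.1), (j + 1, i))
  else
    (T.delete (fun x => T.Anc x u), (T.rootLevel u, i))

open Classical in
/-- Treatment of the merge of the level-`i` nodes `u₁` and `u₂`: the new forest and the interval.
Here `T` is the forest before, and `T'` the forest after copying the level-`(i+1)` nodes. -/
noncomputable def merge (T T' : BarcodeForest β) (i : ℕ) (u₁ u₂ : ℕ × Finset β) :
    BarcodeForest β × (ℕ × ℕ) :=
  if T.SameTree u₁ u₂ then
    let j := T.topLevel (fun v => T.Anc v u₁ ∧ T.Anc v u₂)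
    (T'.glue u₁ u₂ j, (j + 1, i))
  else
    let j := max (T.rootLevel u₁) (T.rootLevel u₂)
    (T'.glue u₁ u₂ j, (j, i))

open Classical in
/-- The `i`-th iteration: the forest `Tᵢ₊₁` obtained from `T = Tᵢ`, and the intervals produced. The
entrance, split and no-change events need no change after copying. -/
noncomputable def step [Fintype β] (Γ : SimpleGraph β) (level : β → ℕ) (i : ℕ)
    (T : BarcodeForest β) : BarcodeForest β × Multiset (ℕ × ℕ) :=
  let T' := T.copyLevel Γ level i
  if h : ∃ u, T'.IsDeparting i u then
    let r := T'.departure i h.choose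
    (r.1, {r.2})
  else if h : ∃ u, T'.IsMerging i u then
    let r := merge T T' i h.choose.1 h.choose.2
    (r.1, {r.2})
  else (T', 0)

/-- The forest `Tᵢ` and the multiset of all intervals produced in the iterations before `i`. -/
noncomputable def run [Fintype β] (Γ : SimpleGraph β) (level : β → ℕ) :
    ℕ → BarcodeForest β × Multiset (ℕ × ℕ)
  | 0 => (⟨∅, ∅⟩, 0)
  | i + 1 =>
    let s := run Γ level i
    let r := step Γ level i s.1
    (r.1, s.2 + r.2)

open Classical in
/-- The intervals added at the end, for the roots and the splitting nodes of the last forest. -/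
noncomputable def finalIntervals (T : BarcodeForest β) (m : ℕ) : Multiset (ℕ × ℕ) :=
  (T.nodes.filter T.IsRoot).val.map (fun x => (x.1, m)) +
    (T.nodes.filter T.IsSplitting).val.map (fun x => (x.1 + 1, m))

/-- The multiset of intervals returned by the pairing algorithm. -/
noncomputable def pairing [Fintype β] (Γ : SimpleGraph β) (level : β → ℕ) (m : ℕ) :
    Multiset (ℕ × ℕ) :=
  (run Γ level m).2 + (run Γ level m).1.finalIntervals m

end BarcodeForest

/-! ## Zigzag filtrations of graphs -/

/-- `K'` arises from `K` by adding a single simplex (a vertex or an edge). -/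
def AddsSimplex {V : Type*} {G : SimpleGraph V} (K K' : G.Subgraph) : Prop :=
  (∃ v, v ∉ K.verts ∧ K'.verts = insert v K.verts ∧ K'.edgeSet = K.edgeSet) ∨
  (∃ e, e ∉ K.edgeSet ∧ K'.verts = K.verts ∧ K'.edgeSet = insert e K.edgeSet)

theorem AddsSimplex.le {V : Type*} {G : SimpleGraph V} {K K' : G.Subgraph}
    (h : AddsSimplex K K') : K ≤ K' := by
  have key : K.verts ⊆ K'.verts → K.edgeSet ⊆ K'.edgeSet → K ≤ K' := fun hv he =>
    ⟨hv, fun u w huw => SimpleGraph.Subgraph.mem_edgeSet.1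
      (he (SimpleGraph.Subgraph.mem_edgeSet.2 huw))⟩
  rcases h with ⟨v, -, h1, h2⟩ | ⟨e, -, h1, h2⟩
  · exact key (h1 ▸ Set.subset_insert _ _) h2.ge
  · exact key h1.ge (h2 ▸ Set.subset_insert _ _)

/-- A zigzag filtration `G₀ ↔ G₁ ↔ ⋯ ↔ Gₘ` of the graph `G`: consecutive subgraphs differ by the
addition or the deletion of a single simplex. -/
structure ZigzagFiltration {V : Type*} (G : SimpleGraph V) (m : ℕ) where
  graph : Fin (m + 1) → G.Subgraph
  step : ∀ i : Fin m, AddsSimplex (graph i.castSucc) (graph i.succ) ∨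
    AddsSimplex (graph i.succ) (graph i.castSucc)

namespace ZigzagFiltration

variable {V : Type*} {G : SimpleGraph V} {m : ℕ}

theorem ge_of_not_le (F : ZigzagFiltration G m) (i : Fin m)
    (h : ¬ F.graph i.castSucc ≤ F.graph i.succ) : F.graph i.succ ≤ F.graph i.castSucc :=
  (F.step i).elim (fun h' => absurd h'.le h) (fun h' => h'.le)

open Classical in
/-- The 0-th zigzag module of a filtration, with the maps induced by the inclusions. -/
noncomputable def zigzagH0 (F : ZigzagFiltration G m) : ZigzagModule m where
  space i := GraphHomology.H0 (F.graph i).coe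
  map i :=
    if h : F.graph i.castSucc ≤ F.graph i.succ then
      Sum.inl (GraphHomology.H0map (SimpleGraph.Subgraph.inclusion h))
    else
      Sum.inr (GraphHomology.H0map (SimpleGraph.Subgraph.inclusion (F.ge_of_not_le i h)))

/-- The nodes of the barcode graph: a level `i` and a connected component of `Gᵢ`. -/
abbrev BarcodeNode (F : ZigzagFiltration G m) : Type _ :=
  Σ i : Fin (m + 1), (F.graph i).coe.ConnectedComponent

/-- The component `c` of `Gᵢ` and the component `c'` of `Gᵢ₊₁` are mapped one to the other by the
inclusion between `Gᵢ` and `Gᵢ₊₁`. -/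
def Linked (F : ZigzagFiltration G m) (i : Fin m)
    (c : (F.graph i.castSucc).coe.ConnectedComponent)
    (c' : (F.graph i.succ).coe.ConnectedComponent) : Prop :=
  (∃ h : F.graph i.castSucc ≤ F.graph i.succ, c.map (SimpleGraph.Subgraph.inclusion h) = c') ∨
  (∃ h : F.graph i.succ ≤ F.graph i.castSucc, c'.map (SimpleGraph.Subgraph.inclusion h) = c)

/-- The barcode graph of a filtration. -/
def barcodeGraph (F : ZigzagFiltration G m) : SimpleGraph F.BarcodeNode where
  Adj x y := ∃ (i : Fin m) (c : (F.graph i.castSucc).coe.ConnectedComponent)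
    (c' : (F.graph i.succ).coe.ConnectedComponent), F.Linked i c c' ∧
      ((x = ⟨i.castSucc, c⟩ ∧ y = ⟨i.succ, c'⟩) ∨ (y = ⟨i.castSucc, c⟩ ∧ x = ⟨i.succ, c'⟩))
  symm := ⟨fun _ _ ⟨i, c, c', h, h'⟩ => ⟨i, c, c', h, h'.symm⟩⟩
  loopless := ⟨by
    rintro x ⟨i, c, c', -, h⟩
    have h2 : x.1 = i.castSucc ∧ x.1 = i.succ := by
      rcases h with ⟨h1, h2⟩ | ⟨h1, h2⟩
      · exact ⟨congrArg Sigma.fst h1, congrArg Sigma.fst h2⟩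
      · exact ⟨congrArg Sigma.fst h1, congrArg Sigma.fst h2⟩
    have h3 := congrArg Fin.val (h2.1.symm.trans h2.2)
    simp at h3⟩

noncomputable instance fintypeBarcodeNode [Finite V] (F : ZigzagFiltration G m) : Fintype F.BarcodeNode :=
  haveI : ∀ i, Finite (F.graph i).coe.ConnectedComponent := fun i =>
    Finite.of_surjective (F.graph i).coe.connectedComponentMk Quot.mk_surjective
  Fintype.ofFinite _

/-- The multiset of intervals that the algorithm for 0-th zigzag persistence returns: the result of
the pairing algorithm on the barcode graph. -/
noncomputable def zeroZigzagAlgorithm [Finite V] (F : ZigzagFiltration G m) : Multiset (ℕ × ℕ) :=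
  BarcodeForest.pairing F.barcodeGraph (fun x => x.1.val) m

end ZigzagFiltration

/-!
The proof compares the algorithm with an arbitrary interval decomposition of the zigzag module
`M`. It consists of an existence theorem for decompositions, which is general linear algebra, and
of an invariant that determines the intervals of every decomposition from the forest.

*Decompositions.* A decomposition is handled through generators (`ZigzagModule.BarFamily`,
`ZigzagModule.isBarcode_iff`). Let `[b, d]` and `[b', d']` be intervals that both reach the index
`i`. The generator of the first may be added to that of the second, over the indices up to `i`,
whenever the birth `b` does not come after `b'` in the order where births at backward maps come
first, the latest one in front, and births at forward maps follow, the latest one at the end. This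
order is encoded by an integer, `ZigzagModule.birthKey`. If the next map kills a vector `z`, the
interval that comes last among those occurring in `z` is changed into one generated by `z`, which
ends; if the next map is backward and not surjective, the interval that comes first among those
outside of the range is added to the others outside, and it ends. So decompositions of initial
segments extend (`ZigzagModule.exists_barFamily`).

*The filtration by births.* For a decomposition, let `filt i t` be the span at the index `i` of the
generators with `birthKey` at most `t`. It is pushed forward along forward maps and pulled back
along backward maps, except for the extreme steps `t`, where it is zero or the whole space. The
interval that ends at a map is the one whose `birthKey` is the first `t` at which `filt i t`
contains the kernel, respectively is not contained in the range
(`BarFamily.exists_unique_death_forward`, `BarFamily.exists_unique_death_backward`).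

*The invariant.* The 0-th homology of a graph has its components as a basis
(`GraphHomology.componentBasis`), and adding a simplex induces an elementary map of components
(`AddsSimplex.isElementary`). The leaves of the forest `Tᵢ` are the components of `Gᵢ`. For
`t = -(k + 1)` let two leaves be equivalent if they have a common ancestor on level `k` or higher;
for `0 ≤ t` let them be equivalent if they are in the same tree, or if both of their trees have
roots on levels up to `t`, in which case they are also equivalent to a base point
(`BarcodeForest.forestKey`). The invariant is that `filt i t` is spanned by the sums of equivalent
components, the base point counting as zero (`keySpan`). Copying a level, deleting the branch of a
departing leaf, and gluing two branches change these relations just as the pull back and the push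
forward change the filtration; this is why the two branches of a merge have to be glued level by
level. The level that the algorithm looks up is the first step `t` at which the merging leaves
become equivalent, or at which the departing leaf becomes equivalent to something else, so the
interval that it outputs is the one that ends (`BarFamily.run_spec`).

*The end.* The intervals that reach the index `m` correspond to the steps `t` at which
`filt m t` grows, births being distinct. Those with `0 ≤ t` are the levels of roots, and those with
`t = -(k + 1)` are the levels `k` of splitting nodes (`BarFamily.finalIntervals_eq`).
-/

/-! ### Subspaces over the field with two elements -/

namespace ZigzagModule

theorem zmod_two_cases (c : ZMod 2) : c = 0 ∨ c = 1 := by revert c; decide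

theorem eq_of_mem_span_singleton_zmod_two {E : Type*} [AddCommGroup E] [Module (ZMod 2) E] {y z : E}
    (h : y ∈ Submodule.span (ZMod 2) {z}) (hy : y ≠ 0) : y = z := by
  obtain ⟨c, rfl⟩ := Submodule.mem_span_singleton.1 h
  rcases zmod_two_cases c with rfl | rfl
  · exact absurd (zero_smul _ _) hy
  · rw [one_smul]

/-- If a subspace has codimension at most one in another one, then over the field with two
elements the sum of two vectors outside of it lies in it. -/
theorem add_mem_of_le_sup_span {E : Type*} [AddCommGroup E] [Module (ZMod 2) E]
    {U W : Submodule (ZMod 2) E} {v : E} (hv : U ≤ W ⊔ Submodule.span (ZMod 2) {v}) {y y' : E}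
    (hyU : y ∈ U) (hyU' : y' ∈ U) (hy : y ∉ W) (hy' : y' ∉ W) : y + y' ∈ W := by
  have key : ∀ y ∈ U, y ∉ W → y - v ∈ W := by
    intro y hyU hy
    obtain ⟨r, hr, s, hs, hrs⟩ := Submodule.mem_sup.1 (hv hyU)
    obtain ⟨c, rfl⟩ := Submodule.mem_span_singleton.1 hs
    rcases zmod_two_cases c with rfl | rfl
    · rw [zero_smul, add_zero] at hrs
      exact absurd (hrs ▸ hr) hy
    · rw [← hrs, one_smul, add_sub_cancel_right]
      exact hr
  have h1 := Submodule.add_mem _ (key y hyU hy) (key y' hyU' hy')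
  have h3 : y + y' = (y - v + (y' - v)) + (v + v) := by abel
  rw [h3, ZModModule.add_self, add_zero]
  exact h1

end ZigzagModule

/-! ### Interval decompositions as families of vectors -/

namespace ZigzagModule

variable {m : ℕ}

/-- An interval decomposition of the restriction of `M` to the indices `0, …, p`, given by
generators: `x a i` generates the `a`-th interval submodule, with interval `[b a, d a]`, at the
index `i`, and it is zero outside of the interval. -/
structure BarFamily (M : ZigzagModule m) (p : ℕ) {ι : Type*} (b d : ι → ℕ)
    (x : ι → ∀ i, M.space i) : Prop where
  le : ∀ a, b a ≤ d a
  le_length : ∀ a, d a ≤ p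
  eq_zero : ∀ a i, ¬ (b a ≤ i.val ∧ i.val ≤ d a) → x a i = 0
  forward : ∀ (i : Fin m) f, i.val < p → M.map i = Sum.inl f → ∀ a, b a ≤ i.val →
    f (x a i.castSucc) = x a i.succ
  backward : ∀ (i : Fin m) g, i.val < p → M.map i = Sum.inr g → ∀ a, i.val + 1 ≤ d a →
    g (x a i.succ) = x a i.castSucc
  linearIndependent : ∀ i : Fin (m + 1), i.val ≤ p →
    LinearIndependent (ZMod 2) (fun a : {a // b a ≤ i.val ∧ i.val ≤ d a} => x a i)
  span : ∀ i : Fin (m + 1), i.val ≤ p →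
    ⊤ ≤ Submodule.span (ZMod 2) (Set.range fun a => x a i)

/-- The total order in which interval submodules may be added to one another, encoded by integers:
a birth at `b` is early in it if the map between `b - 1` and `b` is backward, and then the earlier
the larger `b` is; otherwise it comes after all of those, and the later the larger `b` is. -/
noncomputable def birthKey (M : ZigzagModule m) (b : ℕ) : ℤ :=
  open Classical in
  if ∃ (i : Fin m) (g : _), i.val + 1 = b ∧ M.map i = Sum.inr g then -(b : ℤ) else b

theorem natAbs_birthKey (M : ZigzagModule m) (b : ℕ) : (M.birthKey b).natAbs = b := by
  unfold birthKey; split_ifs <;> simp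

theorem birthKey_forward (M : ZigzagModule m) (i : Fin m) {f} (hf : M.map i = Sum.inl f) :
    M.birthKey (i.val + 1) = (i.val + 1 : ℕ) := by
  unfold birthKey
  rw [if_neg]
  rintro ⟨j, g, hj, hg⟩
  obtain rfl : j = i := Fin.ext (by omega)
  rw [hf] at hg; cases hg

theorem birthKey_backward (M : ZigzagModule m) (i : Fin m) {g} (hg : M.map i = Sum.inr g) :
    M.birthKey (i.val + 1) = -(i.val + 1 : ℕ) := by
  unfold birthKey
  rw [if_pos ⟨i, g, rfl, hg⟩]

namespace BarFamily

variable {M : ZigzagModule m} {p : ℕ} {ι : Type*} {b d : ι → ℕ} {x : ι → ∀ i, M.space i}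

theorem ne_zero (h : M.BarFamily p b d x) {a : ι} {i : Fin (m + 1)} (h1 : b a ≤ i.val)
    (h2 : i.val ≤ d a) : x a i ≠ 0 :=
  (h.linearIndependent i (h2.trans (h.le_length a))).ne_zero
    (⟨a, h1, h2⟩ : {a // b a ≤ i.val ∧ i.val ≤ d a})

theorem exists_sum [Fintype ι] (h : M.BarFamily p b d x) {i : Fin (m + 1)} (hi : i.val ≤ p)
    (y : M.space i) : ∃ c : ι → ZMod 2, ∑ a, c a • x a i = y :=
  (Submodule.mem_span_range_iff_exists_fun _).1 (h.span i hi Submodule.mem_top)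

theorem coeff_eq_zero [Fintype ι] (h : M.BarFamily p b d x) {i : Fin (m + 1)} (hi : i.val ≤ p)
    {c : ι → ZMod 2} (hc : ∑ a, c a • x a i = 0) {a : ι} (h1 : b a ≤ i.val) (h2 : i.val ≤ d a) :
    c a = 0 := by
  classical
  have hl := Fintype.linearIndependent_iff.1 (h.linearIndependent i hi) (fun a => c a) ?_
    ⟨a, h1, h2⟩
  · exact hl
  · rw [← hc]
    rw [← Finset.sum_filter_add_sum_filter_not Finset.univ
      (fun a => b a ≤ i.val ∧ i.val ≤ d a) (fun a => c a • x a i)]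
    rw [Finset.sum_eq_zero (s := Finset.univ.filter fun a => ¬ (b a ≤ i.val ∧ i.val ≤ d a)),
      add_zero]
    · symm
      apply Finset.sum_subtype
      simp
    · intro a ha
      rw [h.eq_zero a i (Finset.mem_filter.1 ha).2, smul_zero]

theorem span_alive (h : M.BarFamily p b d x) {i : Fin (m + 1)} (hi : i.val ≤ p) :
    ⊤ ≤ Submodule.span (ZMod 2)
      (Set.range fun a : {a // b a ≤ i.val ∧ i.val ≤ d a} => x a i) := by
  refine (h.span i hi).trans (Submodule.span_le.2 ?_)
  rintro _ ⟨a, rfl⟩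
  by_cases ha : b a ≤ i.val ∧ i.val ≤ d a
  · exact Submodule.subset_span ⟨⟨a, ha⟩, rfl⟩
  · simp only [h.eq_zero a i ha]
    exact Submodule.zero_mem _

open Classical in
theorem card_alive [Fintype ι] (h : M.BarFamily p b d x) {i : Fin (m + 1)} (hi : i.val ≤ p) :
    (Finset.univ.filter fun a => b a ≤ i.val ∧ i.val ≤ d a).card
      = Module.finrank (ZMod 2) (M.space i) := by
  rw [Module.finrank_eq_card_basis (Module.Basis.mk (h.linearIndependent i hi) (h.span_alive hi)),
    Fintype.card_subtype]

open Classical in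
/-- Linear independence may be checked by counting. -/
theorem of_card [Fintype ι] (le : ∀ a, b a ≤ d a) (le_length : ∀ a, d a ≤ p)
    (eq_zero : ∀ a i, ¬ (b a ≤ i.val ∧ i.val ≤ d a) → x a i = 0)
    (forward : ∀ (i : Fin m) f, i.val < p → M.map i = Sum.inl f → ∀ a, b a ≤ i.val →
      f (x a i.castSucc) = x a i.succ)
    (backward : ∀ (i : Fin m) g, i.val < p → M.map i = Sum.inr g → ∀ a, i.val + 1 ≤ d a →
      g (x a i.succ) = x a i.castSucc)
    (span : ∀ i : Fin (m + 1), i.val ≤ p →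
      ⊤ ≤ Submodule.span (ZMod 2) (Set.range fun a => x a i))
    (card : ∀ i : Fin (m + 1), i.val ≤ p →
      (Finset.univ.filter fun a => b a ≤ i.val ∧ i.val ≤ d a).card
        = Module.finrank (ZMod 2) (M.space i)) : M.BarFamily p b d x where
  le := le
  le_length := le_length
  eq_zero := eq_zero
  forward := forward
  backward := backward
  span := span
  linearIndependent := by
    intro i hi
    apply linearIndependent_of_top_le_span_of_card_eq_finrank
    · refine (span i hi).trans (Submodule.span_le.2 ?_)
      rintro _ ⟨a, rfl⟩
      by_cases ha : b a ≤ i.val ∧ i.val ≤ d a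
      · exact Submodule.subset_span ⟨⟨a, ha⟩, rfl⟩
      · simp only [eq_zero a i ha]
        exact Submodule.zero_mem _
    · rw [Fintype.card_subtype, card i hi]

/-- A change of generators: to the intervals that reach `p` one may add others that reach `p` and
do not come after them in the order given by `birthKey`. -/
theorem transvect [Fintype ι] (h : M.BarFamily p b d x) (N : ι → ι → ZMod 2)
    (hN : ∀ β α, N β α ≠ 0 → d β = p ∧ d α = p ∧ M.birthKey (b α) ≤ M.birthKey (b β))
    (hN2 : ∀ β α γ, N β α ≠ 0 → N α γ = 0) :
    M.BarFamily p b d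
      (fun β k => if b β ≤ k.val then x β k + ∑ α, N β α • x α k else 0) := by
  classical
  have hb : ∀ {β α}, N β α ≠ 0 → M.birthKey (b α) ≤ M.birthKey (b β) := fun hn => (hN _ _ hn).2.2
  refine of_card h.le h.le_length ?_ ?_ ?_ ?_ (fun i hi => h.card_alive hi)
  · intro β k hk
    split_ifs with h1
    · rw [h.eq_zero β k hk, zero_add]
      refine Finset.sum_eq_zero fun α _ => ?_
      by_cases hn : N β α = 0
      · rw [hn, zero_smul]
      · have := hN _ _ hn
        rw [h.eq_zero α k (by omega), smul_zero]
    · rfl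
  · intro i f hi hf β hβ
    have hβ' : b β ≤ i.val + 1 := by omega
    simp only [Fin.val_castSucc, Fin.val_succ, hβ, hβ', if_true, map_add, map_sum, map_smul]
    rw [h.forward i f hi hf β hβ]
    congr 1
    refine Finset.sum_congr rfl fun α _ => ?_
    by_cases hn : N β α = 0
    · rw [hn, zero_smul, zero_smul]
    · by_cases hα : b α ≤ i.val
      · rw [h.forward i f hi hf α hα]
      · by_cases hα' : b α = i.val + 1
        · exfalso
          have h1 := hb hn
          rw [hα', M.birthKey_forward i hf] at h1
          have h2 := M.natAbs_birthKey (b β)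
          omega
        · rw [h.eq_zero α i.castSucc (by simp; omega), h.eq_zero α i.succ (by simp; omega),
            map_zero]
  · intro i g hi hg β hβ
    by_cases hb1 : b β ≤ i.val
    · have hb2 : b β ≤ i.val + 1 := by omega
      simp only [Fin.val_castSucc, Fin.val_succ, hb1, hb2, if_true, map_add, map_sum, map_smul]
      rw [h.backward i g hi hg β hβ]
      congr 1
      refine Finset.sum_congr rfl fun α _ => ?_
      by_cases hn : N β α = 0
      · rw [hn, zero_smul, zero_smul]
      · rw [h.backward i g hi hg α (by have := hN _ _ hn; omega)]
    · simp only [Fin.val_castSucc, Fin.val_succ, hb1, if_false]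
      split_ifs with hb2
      · rw [map_add, h.backward i g hi hg β hβ, h.eq_zero β i.castSucc (by simp; omega), zero_add,
          map_sum]
        refine Finset.sum_eq_zero fun α _ => ?_
        rw [map_smul]
        by_cases hn : N β α = 0
        · rw [hn, zero_smul]
        · rw [h.backward i g hi hg α (by have := hN _ _ hn; omega), h.eq_zero α i.castSucc,
            smul_zero]
          have h1 := hb hn
          have h3 : b β = i.val + 1 := by omega
          rw [h3, M.birthKey_backward i hg] at h1
          have h2 := M.natAbs_birthKey (b α)
          simp only [Fin.val_castSucc]
          omega
      · exact map_zero g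
  · intro i hi
    refine (h.span i hi).trans (Submodule.span_le.2 ?_)
    rintro _ ⟨β, rfl⟩
    change x β i ∈ _
    by_cases hβ : b β ≤ i.val
    · -- `x β` is the new generator plus a combination of generators that are unchanged
      have key : ∀ α, N β α • x α i ∈ Submodule.span (ZMod 2) (Set.range fun β =>
          if b β ≤ i.val then x β i + ∑ α, N β α • x α i else 0) := by
        intro α
        by_cases hn : N β α = 0
        · rw [hn, zero_smul]; exact Submodule.zero_mem _
        · refine Submodule.smul_mem _ _ (Submodule.subset_span ⟨α, ?_⟩)
          dsimp only
          split_ifs with hα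
          · rw [Finset.sum_eq_zero fun γ _ => by rw [hN2 β α γ hn, zero_smul], add_zero]
          · rw [h.eq_zero α i (by omega)]
      have h1 : x β i = (x β i + ∑ α, N β α • x α i) - ∑ α, N β α • x α i := by abel
      rw [h1]
      refine Submodule.sub_mem _ (Submodule.subset_span ⟨β, ?_⟩)
        (Submodule.sum_mem _ fun α _ => key α)
      simp [hβ]
    · rw [h.eq_zero β i (by omega)]
      exact Submodule.zero_mem _

open Classical in
/-- Extension of a decomposition by one index: the intervals in `surv` go on, with generators `y`,
and `q` new ones begin, with generators `v`. -/
theorem extend [Fintype ι] (h : M.BarFamily p b d x) (i : Fin m) (hi : i.val = p) {q : ℕ}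
    (surv : ι → Prop) (y : ι → M.space i.succ) (v : Fin q → M.space i.succ)
    (hsurv : ∀ a, surv a → d a = p) (hy : ∀ a, ¬ surv a → y a = 0)
    (hf : ∀ f, M.map i = Sum.inl f → ∀ a, d a = p → f (x a i.castSucc) = y a)
    (hg : ∀ g, M.map i = Sum.inr g →
      (∀ a, surv a → g (y a) = x a i.castSucc) ∧ ∀ t, g (v t) = 0)
    (hspan : ⊤ ≤ Submodule.span (ZMod 2) (Set.range y ∪ Set.range v))
    (hcard : (Finset.univ.filter surv).card + q = Module.finrank (ZMod 2) (M.space i.succ)) :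
    M.BarFamily (p + 1) (Sum.elim b fun _ : Fin q => p + 1)
      (Sum.elim (fun a => if surv a then p + 1 else d a) fun _ => p + 1)
      (Sum.elim (fun a => Function.update (x a) i.succ (y a))
        fun t => Function.update 0 i.succ (v t)) := by
  have hne : ∀ k : Fin (m + 1), k.val ≤ p → k ≠ i.succ := by
    rintro k hk rfl
    simp at hk; omega
  refine of_card ?_ ?_ ?_ ?_ ?_ ?_ ?_
  · rintro (a | t)
    · have := h.le a
      have := h.le_length a
      simp only [Sum.elim_inl]
      split_ifs <;> omega
    · simp
  · rintro (a | t)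
    · have := h.le_length a
      simp only [Sum.elim_inl]
      split_ifs <;> omega
    · simp
  · rintro (a | t) k hk
    · simp only [Sum.elim_inl] at hk ⊢
      have hba := h.le a
      have hda := h.le_length a
      by_cases hki : k = i.succ
      · subst hki
        rw [Function.update_self]
        apply hy
        intro hs
        rw [if_pos hs] at hk
        simp only [Fin.val_succ] at hk
        omega
      · rw [Function.update_of_ne hki]
        apply h.eq_zero
        have : k.val ≠ p + 1 := fun hk' => hki (Fin.ext (by simp; omega))
        split_ifs at hk with hs <;> omega
    · simp only [Sum.elim_inr] at hk ⊢
      have hki : k ≠ i.succ := by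
        rintro rfl
        simp at hk; omega
      rw [Function.update_of_ne hki]
      rfl
  · rintro j f hj hf' (a | t) hba
    · simp only [Sum.elim_inl] at hba ⊢
      rcases Nat.lt_succ_iff_lt_or_eq.1 hj with hj | hj
      · rw [Function.update_of_ne (hne _ (by simp; omega)),
          Function.update_of_ne (hne _ (by simp; omega))]
        exact h.forward j f hj hf' a hba
      · obtain rfl : j = i := Fin.ext (by omega)
        rw [Function.update_of_ne (hne _ (by simp; omega)), Function.update_self]
        by_cases hd : d a = p
        · exact hf f hf' a hd
        · have := h.le_length a
          rw [h.eq_zero a _ (by simp; omega), map_zero, hy a fun hs => hd (hsurv a hs)]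
    · simp only [Sum.elim_inr] at hba
      omega
  · rintro j g hj hg' (a | t) hda
    · simp only [Sum.elim_inl] at hda ⊢
      rcases Nat.lt_succ_iff_lt_or_eq.1 hj with hj | hj
      · rw [Function.update_of_ne (hne _ (by simp; omega)),
          Function.update_of_ne (hne _ (by simp; omega))]
        refine h.backward j g hj hg' a ?_
        split_ifs at hda with hs
        · have := hsurv a hs
          omega
        · exact hda
      · obtain rfl : j = i := Fin.ext (by omega)
        rw [Function.update_self, Function.update_of_ne (hne _ (by simp; omega))]
        have hs : surv a := by
          by_contra hs
          rw [if_neg hs] at hda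
          have := h.le_length a
          omega
        exact (hg g hg').1 a hs
    · simp only [Sum.elim_inr]
      rcases Nat.lt_succ_iff_lt_or_eq.1 hj with hj | hj
      · rw [Function.update_of_ne (hne _ (by simp; omega)),
          Function.update_of_ne (hne _ (by simp; omega))]
        exact map_zero g
      · obtain rfl : j = i := Fin.ext (by omega)
        rw [Function.update_self, Function.update_of_ne (hne _ (by simp; omega))]
        exact (hg g hg').2 t
  · intro k hk
    by_cases hki : k = i.succ
    · subst hki
      refine hspan.trans (Submodule.span_mono ?_)
      rintro _ (⟨a, rfl⟩ | ⟨t, rfl⟩)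
      · exact ⟨Sum.inl a, by simp⟩
      · exact ⟨Sum.inr t, by simp⟩
    · have hk' : k.val ≠ p + 1 := fun hk' => hki (Fin.ext (by simp; omega))
      refine (h.span k (by omega)).trans (Submodule.span_mono ?_)
      rintro _ ⟨a, rfl⟩
      exact ⟨Sum.inl a, by simp [Function.update_of_ne hki]⟩
  · intro k hk
    rw [Finset.card_filter, Fintype.sum_sum_type]
    by_cases hki : k = i.succ
    · subst hki
      rw [← hcard, Finset.card_filter]
      congr 1
      · refine Finset.sum_congr rfl fun a _ => ?_
        have := h.le a
        have := h.le_length a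
        simp only [Sum.elim_inl, Fin.val_succ]
        by_cases hs : surv a
        · simp only [hs, if_true]
          rw [if_pos (by omega)]
        · simp only [hs, if_false]
          rw [if_neg (by omega)]
      · simp [hi]
    · have hk' : k.val ≠ p + 1 := fun hk' => hki (Fin.ext (by simp; omega))
      rw [← h.card_alive (i := k) (by omega), Finset.card_filter]
      rw [Finset.sum_eq_zero (s := (Finset.univ : Finset (Fin q))), add_zero]
      · refine Finset.sum_congr rfl fun a _ => ?_
        simp only [Sum.elim_inl]
        congr 1
        rw [eq_iff_iff]
        by_cases hs : surv a
        · have := hsurv a hs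
          simp only [hs, if_true]
          omega
        · simp only [hs, if_false]
      · intro t _
        exact if_neg (by simp only [Sum.elim_inr]; omega)

end BarFamily
end ZigzagModule

/-! ### Existence of interval decompositions -/

namespace ZigzagModule
variable {m : ℕ}
namespace BarFamily

variable {M : ZigzagModule m} {p : ℕ} {ι : Type} {b d : ι → ℕ} {x : ι → ∀ i, M.space i}

/-- Extension along a forward map whose kernel is spanned by generators. -/
theorem exists_extend_forward [Fintype ι] [∀ i, Module.Finite (ZMod 2) (M.space i)]
    (h : M.BarFamily p b d x) (i : Fin m) (hi : i.val = p)
    {f} (hf : M.map i = Sum.inl f) (K : ι → Prop)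
    (hK : ∀ a, K a → d a = p ∧ f (x a i.castSucc) = 0)
    (hker : LinearMap.ker f ≤
      Submodule.span (ZMod 2) (Set.range fun a : {a // K a} => x a i.castSucc)) :
    ∃ (ι' : Type) (_ : Fintype ι') (b' d' : ι' → ℕ) (x' : ι' → ∀ i, M.space i),
      M.BarFamily (p + 1) b' d' x' := by
  classical
  obtain ⟨Q, hQ⟩ := Submodule.exists_isCompl (LinearMap.range f)
  have hb : ∀ a, d a = p → b a ≤ i.castSucc.val ∧ i.castSucc.val ≤ d a := fun a ha => by
    have := h.le a
    simp only [Fin.val_castSucc]; omega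
  refine ⟨_, inferInstance, _, _, _, h.extend i hi (fun a => d a = p ∧ ¬ K a)
    (fun a => f (x a i.castSucc)) (fun t => (Module.finBasis (ZMod 2) Q t : M.space i.succ))
    (fun a ha => ha.1) ?_ ?_ ?_ ?_ ?_⟩
  · intro a ha
    by_cases hd : d a = p
    · by_cases hk : K a
      · exact (hK a hk).2
      · exact absurd ⟨hd, hk⟩ ha
    · have := h.le_length a
      rw [h.eq_zero a _ (by simp; omega), map_zero]
  · intro f' hf' a _
    rw [hf] at hf'
    cases hf'; rfl
  · intro g hg
    rw [hf] at hg
    cases hg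
  · rw [Submodule.span_union]
    have h1 : Submodule.span (ZMod 2) (Set.range fun a => f (x a i.castSucc)) =
        LinearMap.range f := by
      rw [LinearMap.range_eq_map, ← top_le_iff.1 (h.span i.castSucc (by simp; omega)),
        Submodule.map_span, ← Set.range_comp]
      rfl
    have h2 : Submodule.span (ZMod 2)
        (Set.range fun t => (Module.finBasis (ZMod 2) Q t : M.space i.succ)) = Q := by
      have := congrArg (Submodule.map Q.subtype) (Module.finBasis (ZMod 2) Q).span_eq
      rw [Submodule.map_span, ← Set.range_comp, Submodule.map_top, Submodule.range_subtype] at this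
      exact this
    rw [h1, h2, hQ.sup_eq_top]
  · have h1 := LinearMap.finrank_range_add_finrank_ker f
    have h2 := Submodule.finrank_add_eq_of_isCompl hQ
    have h3 : Module.finrank (ZMod 2) (LinearMap.ker f) = (Finset.univ.filter K).card := by
      have hle : LinearMap.ker f =
          Submodule.span (ZMod 2) (Set.range fun a : {a // K a} => x a i.castSucc) := by
        refine le_antisymm hker (Submodule.span_le.2 ?_)
        rintro _ ⟨a, rfl⟩
        exact (hK a a.2).2
      rw [hle, finrank_span_eq_card, Fintype.card_subtype]
      exact (h.linearIndependent i.castSucc (by simp; omega)).comp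
        (fun a : {a // K a} => ⟨a.1, hb a (hK a a.2).1⟩)
        (fun a a' haa => Subtype.ext (by simpa using haa))
    have h4 := h.card_alive (i := i.castSucc) (by simp; omega)
    have h5 : (Finset.univ.filter fun a => b a ≤ i.castSucc.val ∧ i.castSucc.val ≤ d a).card =
        (Finset.univ.filter fun a => d a = p ∧ ¬ K a).card + (Finset.univ.filter K).card := by
      rw [← Finset.card_union_of_disjoint, ← Finset.filter_or]
      · congr 1
        ext a
        simp only [Finset.mem_filter, Finset.mem_univ, true_and]
        constructor
        · intro ha
          have := h.le_length a
          simp only [Fin.val_castSucc] at ha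
          by_cases hk : K a
          · exact Or.inr hk
          · exact Or.inl ⟨by omega, hk⟩
        · rintro (ha | ha)
          · exact hb a ha.1
          · exact hb a (hK a ha).1
      · exact Finset.disjoint_filter.2 fun a _ ha => ha.2
    have h6 : (Finset.univ.filter fun a => d a = p ∧ ¬ K a).card + Module.finrank (ZMod 2) Q
        = Module.finrank (ZMod 2) (M.space i.succ) := by omega
    convert h6

/-- Extension along a backward map whose range is spanned by generators. -/
theorem exists_extend_backward [Fintype ι] [∀ i, Module.Finite (ZMod 2) (M.space i)]
    (h : M.BarFamily p b d x) (i : Fin m) (hi : i.val = p)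
    {g} (hg : M.map i = Sum.inr g) (K : ι → Prop) (hK : ∀ a, K a → d a = p)
    (hrange : LinearMap.range g
      = Submodule.span (ZMod 2) (Set.range fun a : {a // K a} => x a i.castSucc)) :
    ∃ (ι' : Type) (_ : Fintype ι') (b' d' : ι' → ℕ) (x' : ι' → ∀ i, M.space i),
      M.BarFamily (p + 1) b' d' x' := by
  classical
  have hpre : ∀ a, K a → ∃ y, g y = x a i.castSucc := by
    intro a ha
    have : x a i.castSucc ∈ LinearMap.range g := by
      rw [hrange]; exact Submodule.subset_span ⟨⟨a, ha⟩, rfl⟩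
    exact this
  choose y hy using hpre
  have hb : ∀ a, d a = p → b a ≤ i.castSucc.val ∧ i.castSucc.val ≤ d a := fun a ha => by
    have := h.le a
    simp only [Fin.val_castSucc]; omega
  refine ⟨_, inferInstance, _, _, _, h.extend i hi K
    (fun a => if ha : K a then y a ha else 0)
    (fun t => (Module.finBasis (ZMod 2) (LinearMap.ker g) t : M.space i.succ)) hK ?_ ?_ ?_ ?_ ?_⟩
  · intro a ha
    exact dif_neg ha
  · intro f hf
    rw [hg] at hf
    cases hf
  · intro g' hg'
    rw [hg] at hg'
    cases hg'
    refine ⟨fun a ha => ?_, fun t => (Module.finBasis (ZMod 2) (LinearMap.ker g) t).2⟩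
    rw [dif_pos ha, hy]
  · rw [Submodule.span_union]
    have h2 : Submodule.span (ZMod 2) (Set.range fun t =>
        (Module.finBasis (ZMod 2) (LinearMap.ker g) t : M.space i.succ)) = LinearMap.ker g := by
      have := congrArg (Submodule.map (LinearMap.ker g).subtype)
        (Module.finBasis (ZMod 2) (LinearMap.ker g)).span_eq
      rw [Submodule.map_span, ← Set.range_comp, Submodule.map_top, Submodule.range_subtype] at this
      exact this
    rw [h2, ← Submodule.comap_map_eq, Submodule.map_span]
    intro z _
    have hz : g z ∈ LinearMap.range g := ⟨z, rfl⟩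
    rw [hrange] at hz
    rw [Submodule.mem_comap]
    refine Submodule.span_mono ?_ hz
    rintro _ ⟨a, rfl⟩
    exact ⟨_, ⟨a.1, rfl⟩, by simp only [dif_pos a.2, hy]⟩
  · have h1 := LinearMap.finrank_range_add_finrank_ker g
    rw [← h1, hrange, finrank_span_eq_card, Fintype.card_subtype]
    exact (h.linearIndependent i.castSucc (by simp; omega)).comp
        (fun a : {a // K a} => ⟨a.1, hb a (hK a a.2)⟩)
        (fun a a' haa => Subtype.ext (by simpa using haa))

/-- The element `z` of the kernel becomes the generator of the interval that comes last in the order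
among those that occur in `z`. -/
theorem exists_step_forward [Fintype ι] [∀ i, Module.Finite (ZMod 2) (M.space i)]
    (h : M.BarFamily p b d x) (i : Fin m) (hi : i.val = p)
    {f} (hf : M.map i = Sum.inl f) {z} (hz : LinearMap.ker f ≤ Submodule.span (ZMod 2) {z}) :
    ∃ (ι' : Type) (_ : Fintype ι') (b' d' : ι' → ℕ) (x' : ι' → ∀ i, M.space i),
      M.BarFamily (p + 1) b' d' x' := by
  classical
  by_cases hbot : LinearMap.ker f = ⊥
  · exact h.exists_extend_forward i hi hf (fun _ => False) (by simp) (by simp [hbot])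
  obtain ⟨w, hw, hw0⟩ := (Submodule.ne_bot_iff _).1 hbot
  have hwz : w = z := eq_of_mem_span_singleton_zmod_two (hz hw) hw0
  subst hwz
  obtain ⟨c, hc⟩ := h.exists_sum (i := i.castSucc) (by simp; omega) w
  have hpos : ∀ a, c a • x a i.castSucc ≠ 0 → d a = p := by
    intro a ha
    by_contra hd
    have := h.le_length a
    rw [h.eq_zero a _ (by simp; omega), smul_zero] at ha
    exact ha rfl
  -- the interval that comes last in the order among those occurring in the kernel
  obtain ⟨β, hβ, hmax⟩ := Finset.exists_max_image
    (Finset.univ.filter fun a => c a • x a i.castSucc ≠ 0) (fun a => M.birthKey (b a)) (by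
      by_contra hne
      rw [Finset.not_nonempty_iff_eq_empty, Finset.filter_eq_empty_iff] at hne
      apply hw0
      rw [← hc]
      exact Finset.sum_eq_zero fun a ha => not_not.1 (hne ha))
  have hβ := (Finset.mem_filter.1 hβ).2
  have hmax : ∀ a, c a • x a i.castSucc ≠ 0 → M.birthKey (b a) ≤ M.birthKey (b β) :=
    fun a ha => hmax a (by simpa using ha)
  have hcβ : c β = 1 := by
    refine (zmod_two_cases (c β)).resolve_left fun h0 => hβ ?_
    rw [h0, zero_smul]
  have hbβ := h.le β
  have hdβ := hpos β hβ
  set N : ι → ι → ZMod 2 := fun γ α =>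
    if γ = β ∧ α ≠ β ∧ c α • x α i.castSucc ≠ 0 then c α else 0 with hN
  have h' := h.transvect N (fun γ α hn => by
      simp only [hN, ne_eq, ite_eq_right_iff, not_forall] at hn
      obtain ⟨⟨rfl, -, h3⟩, -⟩ := hn
      exact ⟨hdβ, hpos α h3, hmax α h3⟩)
    (fun γ α δ hn => by
      simp only [hN, ne_eq, ite_eq_right_iff, not_forall] at hn
      simp only [hN]
      rw [if_neg fun h => hn.1.2.1 h.1])
  obtain ⟨x', hx'⟩ : ∃ x' : ι → ∀ i, M.space i, x' = fun γ k =>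
    if b γ ≤ k.val then x γ k + ∑ α, N γ α • x α k else 0 := ⟨_, rfl⟩
  rw [← hx'] at h'
  have hval : x' β i.castSucc = w := by
    simp only [hx']
    rw [if_pos (by simp; omega), ← hc,
      ← Finset.add_sum_erase _ (fun a => c a • x a i.castSucc) (Finset.mem_univ β), hcβ, one_smul]
    congr 1
    rw [← Finset.add_sum_erase _ _ (Finset.mem_univ β)]
    rw [show N β β = 0 by simp [hN], zero_smul, zero_add]
    refine Finset.sum_congr rfl fun α hα => ?_
    have hα := Finset.ne_of_mem_erase hα
    simp only [hN, true_and]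
    by_cases h3 : c α • x α i.castSucc = 0
    · rw [if_neg (by simp [h3]), h3, zero_smul]
    · rw [if_pos ⟨hα, h3⟩]
  refine h'.exists_extend_forward i hi hf (fun a => a = β) ?_ ?_
  · rintro a rfl
    refine ⟨hdβ, ?_⟩
    rw [hval]
    exact hw
  · refine hz.trans (Submodule.span_mono ?_)
    rintro _ rfl
    exact ⟨⟨β, rfl⟩, hval⟩

/-- The interval that comes first in the order among those outside of the range is added to the
others outside, which brings them into the range. -/
theorem exists_step_backward [Fintype ι] [∀ i, Module.Finite (ZMod 2) (M.space i)]
    (h : M.BarFamily p b d x) (i : Fin m) (hi : i.val = p)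
    {g} (hg : M.map i = Sum.inr g) {v} (hv : ⊤ ≤ LinearMap.range g ⊔ Submodule.span (ZMod 2) {v}) :
    ∃ (ι' : Type) (_ : Fintype ι') (b' d' : ι' → ℕ) (x' : ι' → ∀ i, M.space i),
      M.BarFamily (p + 1) b' d' x' := by
  classical
  have hspan := h.span i.castSucc (by simp; omega)
  have hact : ∀ a, x a i.castSucc ≠ 0 → d a = p := by
    intro a ha
    by_contra hd
    have := h.le_length a
    exact ha (h.eq_zero a _ (by simp; omega))
  by_cases hvr : LinearMap.range g = ⊤
  · refine h.exists_extend_backward i hi hg (fun a => d a = p) (fun _ => id) ?_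
    rw [hvr]
    refine le_antisymm (hspan.trans (Submodule.span_le.2 ?_)) le_top
    rintro _ ⟨a, rfl⟩
    by_cases ha : x a i.castSucc = 0
    · simp only [ha]; exact Submodule.zero_mem _
    · exact Submodule.subset_span ⟨⟨a, hact a ha⟩, rfl⟩
  have hadd : ∀ y y', y ∉ LinearMap.range g → y' ∉ LinearMap.range g →
      y + y' ∈ LinearMap.range g := fun y y' =>
    add_mem_of_le_sup_span hv Submodule.mem_top Submodule.mem_top
  -- the interval that comes first in the order among those not contained in the range
  obtain ⟨α, hα, hmin⟩ := Finset.exists_min_image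
    (Finset.univ.filter fun a => x a i.castSucc ∉ LinearMap.range g) (fun a => M.birthKey (b a)) (by
      by_contra hne
      rw [Finset.not_nonempty_iff_eq_empty, Finset.filter_eq_empty_iff] at hne
      apply hvr
      rw [eq_top_iff]
      refine hspan.trans (Submodule.span_le.2 ?_)
      rintro _ ⟨a, rfl⟩
      exact not_not.1 (hne (Finset.mem_univ a)))
  have hα := (Finset.mem_filter.1 hα).2
  have hmin : ∀ a, x a i.castSucc ∉ LinearMap.range g → M.birthKey (b α) ≤ M.birthKey (b a) :=
    fun a ha => hmin a (by simpa using ha)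
  have hact' : ∀ a, x a i.castSucc ∉ LinearMap.range g → d a = p :=
    fun a ha => hact a fun h0 => ha (h0 ▸ Submodule.zero_mem _)
  have hdα := hact' α hα
  set N : ι → ι → ZMod 2 := fun β γ =>
    if γ = α ∧ β ≠ α ∧ x β i.castSucc ∉ LinearMap.range g then 1 else 0 with hN
  have h' := h.transvect N (fun β γ hn => by
      simp only [hN, ne_eq, ite_eq_right_iff, not_forall] at hn
      obtain ⟨⟨rfl, -, h3⟩, -⟩ := hn
      exact ⟨hact' β h3, hdα, hmin β h3⟩)
    (fun β γ δ hn => by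
      simp only [hN, ne_eq, ite_eq_right_iff, not_forall] at hn
      simp only [hN]
      rw [if_neg fun h => h.2.1 hn.1.1])
  have hsum : ∀ β, ∑ γ, N β γ • x γ i.castSucc =
      if β ≠ α ∧ x β i.castSucc ∉ LinearMap.range g then x α i.castSucc else 0 := by
    intro β
    rw [Finset.sum_eq_single α]
    · simp only [hN, true_and]
      split_ifs <;> simp
    · intro γ _ hγ
      simp [hN, hγ]
    · simp
  obtain ⟨x', hx'⟩ : ∃ x' : ι → ∀ i, M.space i, x' = fun γ k =>
    if b γ ≤ k.val then x γ k + ∑ α, N γ α • x α k else 0 := ⟨_, rfl⟩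
  rw [← hx'] at h'
  have hmem : ∀ β, β ≠ α → x' β i.castSucc ∈ LinearMap.range g := by
    intro β hβ
    simp only [hx']
    rw [hsum]
    split_ifs with h1 h2
    · exact hadd _ _ h2.2 hα
    · rw [add_zero]
      by_contra h3
      exact h2 ⟨hβ, h3⟩
    · exact Submodule.zero_mem _
  have hbα := h.le α
  have hval : x' α i.castSucc = x α i.castSucc := by
    simp only [hx']
    rw [hsum, if_pos (by simp; omega), if_neg (by simp), add_zero]
  refine h'.exists_extend_backward i hi hg (fun a => d a = p ∧ a ≠ α) (fun a ha => ha.1) ?_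
  apply le_antisymm
  · intro y hy
    obtain ⟨c, rfl⟩ := h'.exists_sum (i := i.castSucc) (by simp; omega) y
    have hcα : c α = 0 := by
      rw [← Finset.add_sum_erase _ _ (Finset.mem_univ α), hval] at hy
      rw [Submodule.add_mem_iff_left _ (Submodule.sum_mem _ fun β hβ =>
        Submodule.smul_mem _ _ (hmem β (Finset.ne_of_mem_erase hβ)))] at hy
      by_contra hc
      exact hα ((Submodule.smul_mem_iff _ hc).1 hy)
    refine Submodule.sum_mem _ fun β _ => ?_
    by_cases hβ : β = α
    · rw [hβ, hcα, zero_smul]; exact Submodule.zero_mem _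
    by_cases hd : d β = p
    · exact Submodule.smul_mem _ _ (Submodule.subset_span ⟨⟨β, hd, hβ⟩, rfl⟩)
    · have := h.le_length β
      rw [h'.eq_zero β i.castSucc (by simp; omega), smul_zero]
      exact Submodule.zero_mem _
  · refine Submodule.span_le.2 ?_
    rintro _ ⟨β, rfl⟩
    exact hmem β β.2.2

end BarFamily

/-- A zigzag module starting at zero in which every forward map has a kernel, and every backward
map has a cokernel, of dimension at most one has an interval decomposition. -/
theorem exists_barFamily (M : ZigzagModule m) [∀ i, Module.Finite (ZMod 2) (M.space i)]
    [h0 : Subsingleton (M.space 0)]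
    (hf : ∀ i f, M.map i = Sum.inl f → ∃ z, LinearMap.ker f ≤ Submodule.span (ZMod 2) {z})
    (hg : ∀ i g, M.map i = Sum.inr g →
      ∃ v, ⊤ ≤ LinearMap.range g ⊔ Submodule.span (ZMod 2) {v}) :
    ∃ (ι : Type) (_ : Fintype ι) (b d : ι → ℕ) (x : ι → ∀ i, M.space i), M.BarFamily m b d x := by
  suffices H : ∀ p ≤ m, ∃ (ι : Type) (_ : Fintype ι) (b d : ι → ℕ) (x : ι → ∀ i, M.space i),
      M.BarFamily p b d x from H m le_rfl
  intro p
  induction p with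
  | zero =>
    intro _
    refine ⟨Empty, inferInstance, Empty.elim, Empty.elim, fun a => a.elim, ?_⟩
    refine ⟨fun a => a.elim, fun a => a.elim, fun a => a.elim, fun _ _ h => absurd h (by omega),
      fun _ _ h => absurd h (by omega), fun i _ => linearIndependent_empty_type, ?_⟩
    intro i hi
    obtain rfl : i = 0 := Fin.ext (by simpa using hi)
    intro y _
    rw [Subsingleton.elim y 0]
    exact Submodule.zero_mem _
  | succ p ih =>
    intro hp
    obtain ⟨ι, _, b, d, x, h⟩ := ih (by omega)
    rcases hm : M.map ⟨p, hp⟩ with f | g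
    · obtain ⟨z, hz⟩ := hf _ _ hm
      exact h.exists_step_forward ⟨p, hp⟩ rfl hm hz
    · obtain ⟨v, hv⟩ := hg _ _ hm
      exact h.exists_step_backward ⟨p, hp⟩ rfl hm hv

end ZigzagModule

/-! ### Barcodes and families of generators -/

namespace ZigzagModule
variable {m : ℕ}

namespace BarFamily

variable {M : ZigzagModule m} {p : ℕ} {ι : Type*} {b d : ι → ℕ} {x : ι → ∀ i, M.space i}

theorem reindex {ι' : Type*} (h : M.BarFamily p b d x) (e : ι' ≃ ι) :
    M.BarFamily p (fun a => b (e a)) (fun a => d (e a)) (fun a => x (e a)) where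
  le a := h.le _
  le_length a := h.le_length _
  eq_zero a := h.eq_zero _
  forward i f hi hf a := h.forward i f hi hf _
  backward i f hi hf a := h.backward i f hi hf _
  linearIndependent i hi := (h.linearIndependent i hi).comp
    (fun a : {a // b (e a) ≤ i.val ∧ i.val ≤ d (e a)} => ⟨e a.1, a.2⟩)
    (fun a a' haa => Subtype.ext (e.injective (congrArg Subtype.val haa)))
  span i hi := (h.span i hi).trans (Submodule.span_mono (by
    rintro _ ⟨a, rfl⟩
    exact ⟨e.symm a, by simp⟩))

/-- The interval submodules generated by a family of vectors. -/
def sub (h : M.BarFamily m b d x) (a : ι) : M.Sub where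
  carrier i := Submodule.span (ZMod 2) {x a i}
  forward i f hf y hy := by
    obtain ⟨c, rfl⟩ := Submodule.mem_span_singleton.1 hy
    rw [map_smul]
    by_cases hb : b a ≤ i.val
    · rw [h.forward i f i.2 hf a hb]
      exact Submodule.smul_mem _ _ (Submodule.mem_span_singleton_self _)
    · rw [h.eq_zero a i.castSucc (by simp; omega), map_zero, smul_zero]
      exact Submodule.zero_mem _
  backward i f hf y hy := by
    obtain ⟨c, rfl⟩ := Submodule.mem_span_singleton.1 hy
    rw [map_smul]
    by_cases hb : i.val + 1 ≤ d a
    · rw [h.backward i f i.2 hf a hb]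
      exact Submodule.smul_mem _ _ (Submodule.mem_span_singleton_self _)
    · rw [h.eq_zero a i.succ (by simp; omega), map_zero, smul_zero]
      exact Submodule.zero_mem _

theorem bijOn_span_singleton {E E' : Type*} [AddCommGroup E] [Module (ZMod 2) E] [AddCommGroup E']
    [Module (ZMod 2) E'] (f : E →ₗ[ZMod 2] E') {y : E} (hy : f y ≠ 0) :
    Set.BijOn f (Submodule.span (ZMod 2) {y} : Set E) (Submodule.span (ZMod 2) {f y} : Set E') := by
  refine ⟨?_, ?_, ?_⟩
  · rintro _ hz
    obtain ⟨c, rfl⟩ := Submodule.mem_span_singleton.1 hz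
    exact Submodule.mem_span_singleton.2 ⟨c, (map_smul _ _ _).symm⟩
  · rintro _ hz _ hz' heq
    obtain ⟨c, rfl⟩ := Submodule.mem_span_singleton.1 hz
    obtain ⟨c', rfl⟩ := Submodule.mem_span_singleton.1 hz'
    rw [map_smul, map_smul] at heq
    rw [smul_left_injective _ hy heq]
  · rintro _ hz
    obtain ⟨c, rfl⟩ := Submodule.mem_span_singleton.1 hz
    exact ⟨c • y, Submodule.mem_span_singleton.2 ⟨c, rfl⟩, map_smul _ _ _⟩

theorem isInterval_sub (h : M.BarFamily m b d x) (a : ι) : (h.sub a).IsInterval (b a) (d a) where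
  le := h.le a
  le_length := h.le_length a
  finrank_eq_one i h1 h2 := finrank_span_singleton (h.ne_zero h1 h2)
  eq_bot i hi := by
    change Submodule.span (ZMod 2) {x a i} = ⊥
    rw [h.eq_zero a i hi, Submodule.span_zero_singleton]
  forward_bijOn i h1 h2 f hf := by
    have h3 := h.forward i f i.2 hf a h1
    have h4 := h.ne_zero (a := a) (i := i.succ) (by simp; omega) (by simpa using h2)
    change Set.BijOn f (Submodule.span (ZMod 2) {x a i.castSucc} : Set _)
      (Submodule.span (ZMod 2) {x a i.succ} : Set _)
    rw [← h3] at h4 ⊢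
    exact bijOn_span_singleton f h4
  backward_bijOn i h1 h2 f hf := by
    have h3 := h.backward i f i.2 hf a h2
    have h4 := h.ne_zero (a := a) (i := i.castSucc) (by simpa using h1) (by simp; omega)
    change Set.BijOn f (Submodule.span (ZMod 2) {x a i.succ} : Set _)
      (Submodule.span (ZMod 2) {x a i.castSucc} : Set _)
    rw [← h3] at h4 ⊢
    exact bijOn_span_singleton f h4

theorem isInternal_sub [DecidableEq ι] (h : M.BarFamily m b d x) (i : Fin (m + 1)) :
    DirectSum.IsInternal fun a => (h.sub a).carrier i := by
  have hi : i.val ≤ m := by omega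
  rw [DirectSum.isInternal_submodule_iff_iSupIndep_and_iSup_eq_top]
  constructor
  · change iSupIndep fun a => Submodule.span (ZMod 2) {x a i}
    rw [← iSupIndep_ne_bot]
    have halive : ∀ a : {a // Submodule.span (ZMod 2) {x a i} ≠ ⊥}, b a ≤ i.val ∧ i.val ≤ d a := by
      intro a
      by_contra hn
      refine a.2 ?_
      rw [h.eq_zero a i hn, Submodule.span_zero_singleton]
    have h1 := (h.linearIndependent i hi).iSupIndep_span_singleton
    exact h1.comp (f := fun a : {a // Submodule.span (ZMod 2) {x a i} ≠ ⊥} =>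
      (⟨a.1, halive a⟩ : {a // b a ≤ i.val ∧ i.val ≤ d a}))
      (fun a a' haa => Subtype.ext (by simpa using haa))
  · rw [← top_le_iff]
    refine (h.span i hi).trans_eq ?_
    exact Submodule.span_range_eq_iSup

end BarFamily

/-- Over `ℤ/2` a one-dimensional space has only one generator, so that the generators of the spaces
of an interval submodule are compatible with the maps. -/
theorem isBarcode_iff {M : ZigzagModule m} {B : Multiset (ℕ × ℕ)} :
    M.IsBarcode B ↔ ∃ (n : ℕ) (b d : Fin n → ℕ) (x : Fin n → ∀ i, M.space i),
      M.BarFamily m b d x ∧ B = (Finset.univ : Finset (Fin n)).val.map fun a => (b a, d a) := by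
  constructor
  · rintro ⟨n, I, S, hS, hint, rfl⟩
    have hx : ∀ a i, ∃ y : M.space i, (S a).carrier i = Submodule.span (ZMod 2) {y} ∧
        ((I a).1 ≤ i.val ∧ i.val ≤ (I a).2 → y ≠ 0) := by
      intro a i
      by_cases hi : (I a).1 ≤ i.val ∧ i.val ≤ (I a).2
      · obtain ⟨v, hv, hv'⟩ := finrank_eq_one_iff'.1 ((hS a).finrank_eq_one i hi.1 hi.2)
        refine ⟨v, le_antisymm (fun w hw => ?_) ?_, fun _ h0 => hv (Subtype.ext h0)⟩
        · obtain ⟨c, hc⟩ := hv' ⟨w, hw⟩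
          exact Submodule.mem_span_singleton.2 ⟨c, congrArg Subtype.val hc⟩
        · rw [Submodule.span_singleton_le_iff_mem]; exact v.2
      · exact ⟨0, by rw [(hS a).eq_bot i hi, Submodule.span_zero_singleton], fun h => absurd h hi⟩
    choose x hx hx0 using hx
    have hmem : ∀ a i, x a i ∈ (S a).carrier i := fun a i => by
      rw [hx]; exact Submodule.mem_span_singleton_self _
    have hz : ∀ a i, ¬ ((I a).1 ≤ i.val ∧ i.val ≤ (I a).2) → x a i = 0 := fun a i hi => by
      have := hmem a i
      rwa [(hS a).eq_bot i hi, Submodule.mem_bot] at this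
    refine ⟨n, fun a => (I a).1, fun a => (I a).2, x, ⟨fun a => (hS a).le,
      fun a => (hS a).le_length, hz, ?_, ?_, ?_, ?_⟩, rfl⟩
    · intro i f _ hf a hb
      by_cases h1 : i.val ≤ (I a).2
      · by_cases h2 : i.val + 1 ≤ (I a).2
        · have h3 := (hS a).forward_bijOn i hb h2 f hf
          refine eq_of_mem_span_singleton_zmod_two (hx a i.succ ▸ h3.mapsTo (hmem a i.castSucc)) ?_
          intro h0
          refine hx0 a i.castSucc ⟨hb, h1⟩ (h3.injOn (hmem _ _) (Submodule.zero_mem _) ?_)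
          rw [h0, map_zero]
        · have h3 := (S a).forward i f hf _ (hmem a i.castSucc)
          rw [(hS a).eq_bot i.succ (by simp; omega), Submodule.mem_bot] at h3
          rw [h3, hz a i.succ (by simp; omega)]
      · rw [hz a i.castSucc (by simp; omega), hz a i.succ (by simp; omega), map_zero]
    · intro i f _ hf a hb
      by_cases h1 : (I a).1 ≤ i.val + 1
      · by_cases h2 : (I a).1 ≤ i.val
        · have h3 := (hS a).backward_bijOn i h2 hb f hf
          refine eq_of_mem_span_singleton_zmod_two
            (hx a i.castSucc ▸ h3.mapsTo (hmem a i.succ)) ?_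
          intro h0
          refine hx0 a i.succ ⟨h1, hb⟩ (h3.injOn (hmem _ _) (Submodule.zero_mem _) ?_)
          rw [h0, map_zero]
        · have h3 := (S a).backward i f hf _ (hmem a i.succ)
          rw [(hS a).eq_bot i.castSucc (by simp; omega), Submodule.mem_bot] at h3
          rw [h3, hz a i.castSucc (by simp; omega)]
      · rw [hz a i.castSucc (by simp; omega), hz a i.succ (by simp; omega), map_zero]
    · intro i _
      refine iSupIndep.linearIndependent
        (fun a : {a // (I a).1 ≤ i.val ∧ i.val ≤ (I a).2} => (S a).carrier i)
        ((hint i).submodule_iSupIndep.comp Subtype.val_injective) (fun a => hmem _ _)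
        (fun a => hx0 _ _ a.2)
    · intro i _
      rw [Submodule.span_range_eq_iSup, ← (hint i).submodule_iSup_eq_top]
      exact iSup_mono fun a => (hx a i).le
  · rintro ⟨n, b, d, x, h, rfl⟩
    exact ⟨n, fun a => (b a, d a), h.sub, h.isInterval_sub, h.isInternal_sub, rfl⟩

end ZigzagModule

/-! ### The filtration by births -/

namespace ZigzagModule
variable {m : ℕ}
namespace BarFamily

variable {M : ZigzagModule m} {ι : Type*} {b d : ι → ℕ} {x : ι → ∀ i, M.space i}

/-- The subspace of `M.space i` spanned by the intervals that come up to `t` in the order given by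
`birthKey`. -/
def filt (_ : M.BarFamily m b d x) (i : Fin (m + 1)) (t : ℤ) : Submodule (ZMod 2) (M.space i) :=
  Submodule.span (ZMod 2) {y | ∃ a, M.birthKey (b a) ≤ t ∧ x a i = y}

theorem mem_filt (h : M.BarFamily m b d x) {i : Fin (m + 1)} {t : ℤ} {a : ι}
    (ha : M.birthKey (b a) ≤ t) : x a i ∈ h.filt i t :=
  Submodule.subset_span ⟨a, ha, rfl⟩

theorem filt_le (h : M.BarFamily m b d x) {i : Fin (m + 1)} {t : ℤ}
    {W : Submodule (ZMod 2) (M.space i)} (hW : ∀ a, M.birthKey (b a) ≤ t → x a i ∈ W) :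
    h.filt i t ≤ W := by
  refine Submodule.span_le.2 ?_
  rintro _ ⟨a, ha, rfl⟩
  exact hW a ha

/-- The interval that is born at a forward map has a `birthKey` greater than `i`. -/
theorem filt_succ_forward (h : M.BarFamily m b d x) (i : Fin m) {f} (hf : M.map i = Sum.inl f)
    {t : ℤ} (ht : t ≤ i.val) : h.filt i.succ t = (h.filt i.castSucc t).map f := by
  apply le_antisymm
  · refine h.filt_le fun a ha => ?_
    by_cases hb : b a ≤ i.val
    · rw [← h.forward i f i.2 hf a hb]
      exact Submodule.mem_map_of_mem (h.mem_filt ha)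
    · have hb' : b a ≠ i.val + 1 := by
        intro hb'
        rw [hb', M.birthKey_forward i hf] at ha
        omega
      rw [h.eq_zero a i.succ (by simp; omega)]
      exact Submodule.zero_mem _
  · rw [Submodule.map_le_iff_le_comap]
    refine h.filt_le fun a ha => ?_
    rw [Submodule.mem_comap]
    by_cases hb : b a ≤ i.val
    · rw [h.forward i f i.2 hf a hb]
      exact h.mem_filt ha
    · rw [h.eq_zero a i.castSucc (by simp; omega), map_zero]
      exact Submodule.zero_mem _

theorem filt_eq_top (h : M.BarFamily m b d x) (i : Fin (m + 1)) {t : ℤ} (ht : i.val ≤ t) :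
    h.filt i t = ⊤ := by
  refine top_le_iff.1 ((h.span i (by omega)).trans (Submodule.span_le.2 ?_))
  rintro _ ⟨a, rfl⟩
  by_cases hal : b a ≤ i.val
  · have := M.natAbs_birthKey (b a)
    exact h.mem_filt (by omega)
  · simp only [h.eq_zero a i fun hh => hal hh.1]
    exact Submodule.zero_mem _

theorem filt_eq_bot (h : M.BarFamily m b d x) (i : Fin (m + 1)) {t : ℤ} (ht : t < -i.val) :
    h.filt i t = ⊥ := by
  rw [eq_bot_iff]
  refine h.filt_le fun a ha => ?_
  have := M.natAbs_birthKey (b a)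
  rw [Submodule.mem_bot]
  exact h.eq_zero a i (by omega)

theorem ne_of_injective_forward (h : M.BarFamily m b d x) (i : Fin m) {f}
    (hf : M.map i = Sum.inl f) (hinj : Function.Injective f) (a : ι) : d a ≠ i.val := by
  intro hd
  have hb := h.le a
  refine h.ne_zero (a := a) (i := i.castSucc) (by simp; omega) (by simp; omega) (hinj ?_)
  rw [h.forward i f i.2 hf a (by omega), h.eq_zero a i.succ (by simp; omega), map_zero]

variable [Fintype ι]

theorem exists_sum_of_mem_filt (h : M.BarFamily m b d x) {i : Fin (m + 1)} {t : ℤ} {y : M.space i}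
    (hy : y ∈ h.filt i t) :
    ∃ c : ι → ZMod 2, ∑ a, c a • x a i = y ∧ ∀ a, c a ≠ 0 → M.birthKey (b a) ≤ t := by
  classical
  induction hy using Submodule.span_induction with
  | mem y hy =>
    obtain ⟨a, ha, rfl⟩ := hy
    refine ⟨Pi.single a 1, ?_, ?_⟩
    · rw [Finset.sum_eq_single a] <;> simp +contextual
    · intro a' ha'
      by_contra hne
      rw [Pi.single_eq_of_ne (by rintro rfl; exact hne ha)] at ha'
      exact ha' rfl
  | zero => exact ⟨0, by simp, by simp⟩
  | add y z _ _ hy hz =>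
    obtain ⟨c, rfl, hc⟩ := hy
    obtain ⟨c', rfl, hc'⟩ := hz
    refine ⟨c + c', by simp [add_smul, Finset.sum_add_distrib], fun a ha => ?_⟩
    by_cases h0 : c a = 0
    · exact hc' a fun h1 => ha (by simp [h0, h1])
    · exact hc a h0
  | smul s y _ hy =>
    obtain ⟨c, rfl, hc⟩ := hy
    refine ⟨s • c, by simp [Finset.smul_sum, smul_smul], fun a ha => hc a fun h0 => ha ?_⟩
    simp [h0]

theorem sum_mem_filt_iff (h : M.BarFamily m b d x) {i : Fin (m + 1)} {t : ℤ} (c : ι → ZMod 2) :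
    ∑ a, c a • x a i ∈ h.filt i t ↔
      ∀ a, c a ≠ 0 → b a ≤ i.val → i.val ≤ d a → M.birthKey (b a) ≤ t := by
  constructor
  · intro hy a hca h1 h2
    obtain ⟨c', hc', hc''⟩ := h.exists_sum_of_mem_filt hy
    have h3 : ∑ a, (c a - c' a) • x a i = 0 := by
      simp only [sub_smul, Finset.sum_sub_distrib, hc', sub_self]
    have h4 := h.coeff_eq_zero (by omega) h3 h1 h2
    exact hc'' a fun h0 => hca (by rw [← sub_eq_zero.1 h4] at h0; exact h0)
  · intro hc
    refine Submodule.sum_mem _ fun a _ => ?_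
    by_cases ha : c a = 0
    · rw [ha, zero_smul]; exact Submodule.zero_mem _
    by_cases hal : b a ≤ i.val ∧ i.val ≤ d a
    · exact Submodule.smul_mem _ _ (h.mem_filt (hc a ha hal.1 hal.2))
    · rw [h.eq_zero a i hal, smul_zero]; exact Submodule.zero_mem _

theorem mem_filt_iff (h : M.BarFamily m b d x) {i : Fin (m + 1)} {t : ℤ} {a : ι}
    (h1 : b a ≤ i.val) (h2 : i.val ≤ d a) : x a i ∈ h.filt i t ↔ M.birthKey (b a) ≤ t := by
  classical
  refine ⟨fun hm => ?_, h.mem_filt⟩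
  have h3 : ∑ a', (Pi.single a (1 : ZMod 2) : ι → ZMod 2) a' • x a' i = x a i := by
    rw [Finset.sum_eq_single a] <;> simp +contextual
  rw [← h3, h.sum_mem_filt_iff] at hm
  exact hm a (by simp) h1 h2

/-- The interval that is born at a backward map has `birthKey` equal to `-(i + 1)`; it generates the
kernel. -/
theorem filt_succ_backward (h : M.BarFamily m b d x) (i : Fin m) {g} (hg : M.map i = Sum.inr g)
    {t : ℤ} (ht : -((i.val + 1 : ℕ) : ℤ) ≤ t) :
    h.filt i.succ t = (h.filt i.castSucc t).comap g := by
  classical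
  apply le_antisymm
  · refine h.filt_le fun a ha => ?_
    rw [Submodule.mem_comap]
    by_cases hd : i.val + 1 ≤ d a
    · rw [h.backward i g i.2 hg a hd]
      exact h.mem_filt ha
    · rw [h.eq_zero a i.succ (by simp; omega), map_zero]
      exact Submodule.zero_mem _
  · intro y hy
    obtain ⟨c, rfl⟩ := h.exists_sum (i := i.succ) (by simp) y
    rw [Submodule.mem_comap, map_sum] at hy
    have h1 : ∀ a, g (c a • x a i.succ) =
        (if i.val + 1 ≤ d a then c a else 0) • x a i.castSucc := by
      intro a
      rw [map_smul]
      split_ifs with hd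
      · rw [h.backward i g i.2 hg a hd]
      · rw [h.eq_zero a i.succ (by simp; omega), map_zero, zero_smul, smul_zero]
    simp only [h1] at hy
    rw [h.sum_mem_filt_iff] at hy
    rw [h.sum_mem_filt_iff]
    intro a hca hb hd
    simp only [Fin.val_succ] at hb hd
    by_cases hb' : b a ≤ i.val
    · exact hy a (by rwa [if_pos hd]) hb' (by simp; omega)
    · obtain hb' : b a = i.val + 1 := by omega
      rw [hb', M.birthKey_backward i hg]
      exact ht

/-! ### Births and deaths of intervals -/

theorem sum_forward (h : M.BarFamily m b d x) (i : Fin m) {f} (hf : M.map i = Sum.inl f)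
    (c : ι → ZMod 2) : f (∑ a, c a • x a i.castSucc) =
      ∑ a, (if b a ≤ i.val then c a else 0) • x a i.succ := by
  rw [map_sum]
  refine Finset.sum_congr rfl fun a _ => ?_
  rw [map_smul]
  split_ifs with hb
  · rw [h.forward i f i.2 hf a hb]
  · rw [h.eq_zero a i.castSucc (by simp; omega), map_zero, zero_smul, smul_zero]

theorem sum_backward (h : M.BarFamily m b d x) (i : Fin m) {g} (hg : M.map i = Sum.inr g)
    (c : ι → ZMod 2) : g (∑ a, c a • x a i.succ) =
      ∑ a, (if i.val + 1 ≤ d a then c a else 0) • x a i.castSucc := by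
  rw [map_sum]
  refine Finset.sum_congr rfl fun a _ => ?_
  rw [map_smul]
  split_ifs with hd
  · rw [h.backward i g i.2 hg a hd]
  · rw [h.eq_zero a i.succ (by simp; omega), map_zero, zero_smul, smul_zero]

theorem coeff_eq_zero_of_mem_range (h : M.BarFamily m b d x) (i : Fin m) {g}
    (hg : M.map i = Sum.inr g) {c : ι → ZMod 2}
    (hc : ∑ a, c a • x a i.castSucc ∈ LinearMap.range g) {a : ι} (hd : d a = i.val) : c a = 0 := by
  obtain ⟨y, hy⟩ := hc
  obtain ⟨c', rfl⟩ := h.exists_sum (i := i.succ) (by simp) y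
  rw [h.sum_backward i hg, ← sub_eq_zero, ← Finset.sum_sub_distrib] at hy
  simp only [← sub_smul] at hy
  have hb := h.le a
  have h1 := h.coeff_eq_zero (i := i.castSucc) (by simp) hy (a := a) (by simp; omega)
    (by simp; omega)
  rw [if_neg (by omega), zero_sub, neg_eq_zero] at h1
  exact h1

theorem mem_range_iff (h : M.BarFamily m b d x) (i : Fin m) {g} (hg : M.map i = Sum.inr g) (a : ι) :
    x a i.castSucc ∈ LinearMap.range g ↔ d a ≠ i.val := by
  classical
  constructor
  · intro hm hd
    have h3 : ∑ a', (Pi.single a (1 : ZMod 2) : ι → ZMod 2) a' • x a' i.castSucc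
        = x a i.castSucc := by
      rw [Finset.sum_eq_single a] <;> simp +contextual
    rw [← h3] at hm
    have := h.coeff_eq_zero_of_mem_range i hg hm hd
    simp at this
  · intro hd
    by_cases hd' : i.val + 1 ≤ d a
    · exact ⟨_, h.backward i g i.2 hg a hd'⟩
    · rw [h.eq_zero a i.castSucc (by simp; omega)]
      exact Submodule.zero_mem _

theorem ne_of_surjective_backward (h : M.BarFamily m b d x) (i : Fin m) {g}
    (hg : M.map i = Sum.inr g) (hsurj : Function.Surjective g) (a : ι) : d a ≠ i.val :=
  (h.mem_range_iff i hg a).1 (hsurj _)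

/-- Exactly one interval ends where a forward map has a one-dimensional kernel, and its birth is
determined by the position of the kernel in the filtration. -/
theorem exists_unique_death_forward (h : M.BarFamily m b d x) (i : Fin m) {f}
    (hf : M.map i = Sum.inl f) {z} (hz : f z = 0) (hz0 : z ≠ 0)
    (hker : LinearMap.ker f ≤ Submodule.span (ZMod 2) {z}) :
    ∃ a₀, (∀ a, d a = i.val ↔ a = a₀) ∧
      ∀ t, M.birthKey (b a₀) ≤ t ↔ z ∈ h.filt i.castSucc t := by
  have hdz : ∀ a, d a = i.val → x a i.castSucc = z := by
    intro a hd
    have hb := h.le a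
    refine eq_of_mem_span_singleton_zmod_two (hker ?_)
      (h.ne_zero (a := a) (i := i.castSucc) (by simp; omega) (by simp; omega))
    rw [LinearMap.mem_ker, h.forward i f i.2 hf a (by omega), h.eq_zero a i.succ (by simp; omega)]
  have hex : ∃ a, d a = i.val := by
    by_contra hne
    push Not at hne
    obtain ⟨c, rfl⟩ := h.exists_sum (i := i.castSucc) (by simp) z
    rw [h.sum_forward i hf] at hz
    refine hz0 (Finset.sum_eq_zero fun a _ => ?_)
    by_cases hal : b a ≤ i.val ∧ i.val ≤ d a
    · have h1 := h.coeff_eq_zero (i := i.succ) (by simp) hz (a := a) (by simp; omega)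
        (by have := hne a; simp; omega)
      rw [if_pos hal.1] at h1
      rw [h1, zero_smul]
    · rw [h.eq_zero a i.castSucc (by simpa using hal), smul_zero]
  obtain ⟨a₀, ha₀⟩ := hex
  have hb₀ := h.le a₀
  refine ⟨a₀, fun a => ⟨fun hd => ?_, fun ha => ha ▸ ha₀⟩, fun t => ?_⟩
  · have hb := h.le a
    have h1 : (fun a : {a // b a ≤ i.castSucc.val ∧ i.castSucc.val ≤ d a} => x a i.castSucc)
        ⟨a, by simp; omega⟩ = (fun a : {a // b a ≤ i.castSucc.val ∧ i.castSucc.val ≤ d a} =>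
          x a i.castSucc) ⟨a₀, by simp; omega⟩ := (hdz a hd).trans (hdz a₀ ha₀).symm
    exact congrArg Subtype.val ((h.linearIndependent i.castSucc (by simp)).injective h1)
  · rw [← hdz a₀ ha₀, h.mem_filt_iff (by simp; omega) (by simp; omega)]

/-- Exactly one interval ends where a backward map has a range of codimension one, and its birth is
determined by the position of the range in the filtration. -/
theorem exists_unique_death_backward (h : M.BarFamily m b d x) (i : Fin m) {g}
    (hg : M.map i = Sum.inr g) {v} (hv : v ∉ LinearMap.range g)
    (hrange : ⊤ ≤ LinearMap.range g ⊔ Submodule.span (ZMod 2) {v}) :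
    ∃ a₀, (∀ a, d a = i.val ↔ a = a₀) ∧
      ∀ t, M.birthKey (b a₀) ≤ t ↔ ¬ h.filt i.castSucc t ≤ LinearMap.range g := by
  classical
  have hmem := h.mem_range_iff i hg
  have hex : ∃ a, d a = i.val := by
    by_contra hne
    push Not at hne
    refine hv ((h.span i.castSucc (by simp)).trans (Submodule.span_le.2 ?_)
      (Submodule.mem_top (x := v)))
    rintro _ ⟨a, rfl⟩
    exact (hmem a).2 (hne a)
  obtain ⟨a₀, ha₀⟩ := hex
  have huniq : ∀ a, d a = i.val ↔ a = a₀ := by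
    refine fun a => ⟨fun hd => ?_, fun ha => ha ▸ ha₀⟩
    by_contra hne
    have h1 := add_mem_of_le_sup_span hrange Submodule.mem_top Submodule.mem_top
      (fun h' => (hmem a).1 h' hd)
      (fun h' => (hmem a₀).1 h' ha₀)
    have h2 : ∑ a', (if a' = a ∨ a' = a₀ then (1 : ZMod 2) else 0) • x a' i.castSucc
        = x a i.castSucc + x a₀ i.castSucc := by
      rw [← Finset.sum_pair (f := fun a => x a i.castSucc) hne]
      simp only [ite_smul, one_smul, zero_smul]
      rw [← Finset.sum_filter]
      congr 1
      ext; simp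
    rw [← h2] at h1
    have := h.coeff_eq_zero_of_mem_range i hg h1 hd
    simp at this
  refine ⟨a₀, huniq, fun t => ⟨fun ht hle => ?_, fun hle => ?_⟩⟩
  · exact (hmem a₀).1 (hle (h.mem_filt ht)) ha₀
  · by_contra ht
    refine hle (h.filt_le fun a ha => (hmem a).2 fun hd => ht ?_)
    rwa [(huniq a).1 hd] at ha

/-- Different intervals have different births if every map changes the dimension by at most one. -/
theorem injective_birth (h : M.BarFamily m b d x) [Subsingleton (M.space 0)]
    (hf : ∀ i f, M.map i = Sum.inl f →
      ∃ v, ⊤ ≤ LinearMap.range f ⊔ Submodule.span (ZMod 2) {v})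
    (hg : ∀ i g, M.map i = Sum.inr g → ∃ z, LinearMap.ker g ≤ Submodule.span (ZMod 2) {z}) :
    Function.Injective b := by
  classical
  intro a a' hb
  by_contra hne
  have hd := h.le a
  have hd' := h.le a'
  have hm := h.le_length a
  rcases hba : b a with _ | k
  · exact h.ne_zero (a := a) (i := 0) (by simp [hba]) (by simp) (Subsingleton.elim _ _)
  obtain ⟨i, rfl⟩ : ∃ i : Fin m, i.val = k := ⟨⟨k, by omega⟩, rfl⟩
  rcases hmap : M.map i with f | g
  · obtain ⟨v, hv⟩ := hf i f hmap
    have key : ∀ c : ι → ZMod 2, ∑ a, c a • x a i.succ ∈ LinearMap.range f →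
        ∀ a, b a = i.val + 1 → c a = 0 := by
      rintro c ⟨y, hy⟩ a ha
      obtain ⟨c', rfl⟩ := h.exists_sum (i := i.castSucc) (by simp) y
      rw [h.sum_forward i hmap, ← sub_eq_zero, ← Finset.sum_sub_distrib] at hy
      simp only [← sub_smul] at hy
      have := h.le a
      have h1 := h.coeff_eq_zero (i := i.succ) (by simp) hy (a := a) (by simp; omega)
        (by simp; omega)
      rwa [if_neg (by omega), zero_sub, neg_eq_zero] at h1
    have hout : ∀ a, b a = i.val + 1 → x a i.succ ∉ LinearMap.range f := by
      intro a ha hmem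
      have h3 : ∑ a', (Pi.single a (1 : ZMod 2) : ι → ZMod 2) a' • x a' i.succ = x a i.succ := by
        rw [Finset.sum_eq_single a] <;> simp +contextual
      rw [← h3] at hmem
      simpa using key _ hmem a ha
    have h1 := add_mem_of_le_sup_span hv Submodule.mem_top Submodule.mem_top
      (hout a hba) (hout a' (hb ▸ hba))
    have h2 : ∑ s, (if s = a ∨ s = a' then (1 : ZMod 2) else 0) • x s i.succ
        = x a i.succ + x a' i.succ := by
      rw [← Finset.sum_pair (f := fun a => x a i.succ) hne]
      simp only [ite_smul, one_smul, zero_smul]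
      rw [← Finset.sum_filter]
      congr 1
      ext; simp
    rw [← h2] at h1
    simpa using key _ h1 a hba
  · obtain ⟨z, hz⟩ := hg i g hmap
    have hout : ∀ a, b a = i.val + 1 → x a i.succ = z := by
      intro a ha
      have := h.le a
      refine eq_of_mem_span_singleton_zmod_two (hz ?_)
        (h.ne_zero (by simp; omega) (by simp; omega))
      rw [LinearMap.mem_ker, h.backward i g i.2 hmap a (by omega),
        h.eq_zero a i.castSucc (by simp; omega)]
    have h1 : (fun a : {a // b a ≤ i.succ.val ∧ i.succ.val ≤ d a} => x a i.succ)
        ⟨a, by simp; omega⟩ = (fun a : {a // b a ≤ i.succ.val ∧ i.succ.val ≤ d a} =>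
          x a i.succ) ⟨a', by simp; omega⟩ := (hout a hba).trans (hout a' (hb ▸ hba)).symm
    exact hne (congrArg Subtype.val ((h.linearIndependent i.succ (by simp)).injective h1))

end BarFamily
end ZigzagModule

/-! ### Subspaces spanned by sums of equivalent basis vectors -/

section KeySpan

variable {C C' E E' X X' : Type*} [AddCommGroup E] [Module (ZMod 2) E] [AddCommGroup E']
  [Module (ZMod 2) E']

/-- A basis extended by zero at the base point `none`. -/
noncomputable def pointed (e : Module.Basis C (ZMod 2) E) : Option C → E
  | none => 0
  | some c => e c

/-- The span of all sums of two (pointed) basis vectors with the same value of `κ`. -/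
noncomputable def keySpan (e : Module.Basis C (ZMod 2) E) (κ : Option C → X) :
    Submodule (ZMod 2) E :=
  Submodule.span (ZMod 2) {y | ∃ p q, κ p = κ q ∧ pointed e p + pointed e q = y}

theorem add_mem_keySpan (e : Module.Basis C (ZMod 2) E) {κ : Option C → X} {p q : Option C}
    (h : κ p = κ q) : pointed e p + pointed e q ∈ keySpan e κ :=
  Submodule.subset_span ⟨p, q, h, rfl⟩

theorem keySpan_le {e : Module.Basis C (ZMod 2) E} {κ : Option C → X} {W : Submodule (ZMod 2) E}
    (h : ∀ p q, κ p = κ q → pointed e p + pointed e q ∈ W) : keySpan e κ ≤ W := by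
  refine Submodule.span_le.2 ?_
  rintro _ ⟨p, q, hpq, rfl⟩
  exact h p q hpq

/-- The linear functional with prescribed values on the pointed basis vectors. -/
noncomputable def pointedDual (e : Module.Basis C (ZMod 2) E) (φ : Option C → ZMod 2) :
    E →ₗ[ZMod 2] ZMod 2 :=
  e.constr (ZMod 2) fun c => φ (some c)

theorem pointedDual_pointed (e : Module.Basis C (ZMod 2) E) {φ : Option C → ZMod 2}
    (h0 : φ none = 0) (p : Option C) : pointedDual e φ (pointed e p) = φ p := by
  cases p with
  | none => simp [pointed, h0]
  | some c => simp [pointed, pointedDual, Module.Basis.constr_basis]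

open Classical in
/-- The functional that counts the basis vectors whose value of `κ` is that of `p` or, if this is
the value of the base point, those whose value is different. It vanishes on `keySpan e κ`. -/
noncomputable def keyDual (e : Module.Basis C (ZMod 2) E) (κ : Option C → X) (p : Option C) :
    E →ₗ[ZMod 2] ZMod 2 :=
  pointedDual e fun q => (if κ q = κ p then 1 else 0) + if κ none = κ p then 1 else 0

open Classical in
theorem keyDual_pointed (e : Module.Basis C (ZMod 2) E) (κ : Option C → X) (p q : Option C) :
    keyDual e κ p (pointed e q) = (if κ q = κ p then 1 else 0) + if κ none = κ p then 1 else 0 :=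
  pointedDual_pointed e (by exact ZModModule.add_self _) q

theorem keyDual_eq_zero {e : Module.Basis C (ZMod 2) E} {κ : Option C → X} (p : Option C) {y : E}
    (hy : y ∈ keySpan e κ) : keyDual e κ p y = 0 := by
  have hle : keySpan e κ ≤ LinearMap.ker (keyDual e κ p) := by
    refine keySpan_le fun q q' hq => ?_
    rw [LinearMap.mem_ker, map_add, keyDual_pointed, keyDual_pointed, hq]
    exact ZModModule.add_self _
  exact hle hy

/-- No further sums of two (pointed) basis vectors are in the span. -/
theorem add_mem_keySpan_iff (e : Module.Basis C (ZMod 2) E) (κ : Option C → X) (p q : Option C) :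
    pointed e p + pointed e q ∈ keySpan e κ ↔ κ p = κ q := by
  classical
  refine ⟨fun h => ?_, add_mem_keySpan e⟩
  have h1 := keyDual_eq_zero p h
  rw [map_add, keyDual_pointed, keyDual_pointed, if_pos rfl] at h1
  by_contra hne
  rw [if_neg (Ne.symm hne), zero_add, add_assoc, ZModModule.add_self] at h1
  simp at h1

theorem pointed_mem_keySpan_iff (e : Module.Basis C (ZMod 2) E) (κ : Option C → X) (p : Option C) :
    pointed e p ∈ keySpan e κ ↔ κ p = κ none := by
  rw [← add_mem_keySpan_iff e]
  simp [pointed]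

theorem keySpan_eq_top (e : Module.Basis C (ZMod 2) E) {κ : Option C → X}
    (h : ∀ p q, κ p = κ q) : keySpan e κ = ⊤ := by
  rw [← top_le_iff, ← e.span_eq]
  refine Submodule.span_le.2 ?_
  rintro _ ⟨c, rfl⟩
  exact (pointed_mem_keySpan_iff e κ (some c)).2 (h _ _)

theorem keySpan_eq_bot (e : Module.Basis C (ZMod 2) E) {κ : Option C → X}
    (h : Function.Injective κ) : keySpan e κ = ⊥ := by
  rw [eq_bot_iff]
  refine keySpan_le fun p q hpq => ?_
  rw [h hpq, ZModModule.add_self]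
  exact Submodule.zero_mem _

theorem map_pointed {e : Module.Basis C (ZMod 2) E} {e' : Module.Basis C' (ZMod 2) E'}
    {φ : E →ₗ[ZMod 2] E'} {f : C → C'} (hφ : ∀ c, φ (e c) = e' (f c)) (p : Option C) :
    φ (pointed e p) = pointed e' (p.map f) := by
  cases p <;> simp [pointed, hφ]

/-- Along a map of basis vectors the span is pushed forward to the span for the equivalence
relation generated by the image. -/
theorem keySpan_eq_map {e : Module.Basis C (ZMod 2) E} {e' : Module.Basis C' (ZMod 2) E'}
    {φ : E →ₗ[ZMod 2] E'} {f : C → C'} (hφ : ∀ c, φ (e c) = e' (f c))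
    {κ : Option C → X} {κ' : Option C' → X'}
    (h1 : ∀ p q, κ p = κ q → κ' (p.map f) = κ' (q.map f))
    (h2 : ∀ p' q', κ' p' = κ' q' → Relation.EqvGen
      (fun p' q' => ∃ p q, κ p = κ q ∧ p.map f = p' ∧ q.map f = q') p' q') :
    keySpan e' κ' = (keySpan e κ).map φ := by
  apply le_antisymm
  · refine keySpan_le fun p' q' hpq => ?_
    induction h2 p' q' hpq with
    | rel p' q' h =>
      obtain ⟨p, q, hpq', rfl, rfl⟩ := h
      rw [← map_pointed hφ, ← map_pointed hφ, ← map_add]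
      exact Submodule.mem_map_of_mem (add_mem_keySpan e hpq')
    | refl p' =>
      rw [ZModModule.add_self]
      exact Submodule.zero_mem _
    | symm p' q' _ ih =>
      rw [add_comm]
      exact ih hpq.symm
    | trans p' q' r' hpq' hqr' ih1 ih2 =>
      have hgen : ∀ {p' q'}, Relation.EqvGen
          (fun p' q' => ∃ p q, κ p = κ q ∧ p.map f = p' ∧ q.map f = q') p' q' → κ' p' = κ' q' := by
        intro p' q' h
        induction h with
        | rel p' q' h =>
          obtain ⟨p, q, hpq, rfl, rfl⟩ := h
          exact h1 p q hpq
        | refl => rfl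
        | symm _ _ _ ih => exact ih.symm
        | trans _ _ _ _ _ ih ih' => exact ih.trans ih'
      have := Submodule.add_mem _ (ih1 (hgen hpq')) (ih2 (hgen hqr'))
      have h3 : pointed e' p' + pointed e' r' = (pointed e' p' + pointed e' q') +
          (pointed e' q' + pointed e' r') - (pointed e' q' + pointed e' q') := by abel
      rw [h3, ZModModule.add_self, sub_zero]
      exact this
  · rw [Submodule.map_le_iff_le_comap]
    refine keySpan_le fun p q hpq => ?_
    rw [Submodule.mem_comap, map_add, map_pointed hφ, map_pointed hφ]
    exact add_mem_keySpan e' (h1 p q hpq)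

/-- Along a map of basis vectors the span is pulled back to the span for the pulled back
equivalence relation. -/
theorem keySpan_eq_comap {e : Module.Basis C (ZMod 2) E} {e' : Module.Basis C' (ZMod 2) E'}
    {φ : E' →ₗ[ZMod 2] E} {g : C' → C} (hφ : ∀ c, φ (e' c) = e (g c))
    {κ : Option C → X} {κ' : Option C' → X'}
    (h : ∀ p q, κ' p = κ' q ↔ κ (p.map g) = κ (q.map g)) :
    keySpan e' κ' = (keySpan e κ).comap φ := by
  classical
  apply le_antisymm
  · refine keySpan_le fun p q hpq => ?_
    rw [Submodule.mem_comap, map_add, map_pointed hφ, map_pointed hφ]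
    exact add_mem_keySpan e ((h p q).1 hpq)
  · intro y hy
    by_contra hy'
    -- a functional vanishing on the left hand side factors through the equivalence classes
    obtain ⟨ψ, hψy, hψ⟩ := Submodule.exists_le_ker_of_notMem hy'
    have hcls : ∀ p q, κ' p = κ' q → ψ (pointed e' p) = ψ (pointed e' q) := by
      intro p q hpq
      have h1 : ψ (pointed e' p + pointed e' q) = 0 := hψ (add_mem_keySpan e' hpq)
      rw [map_add, ← ZModModule.sub_eq_add] at h1
      exact sub_eq_zero.1 h1
    set χ : Option C → ZMod 2 := fun q =>
      if hq : ∃ p : Option C', κ (p.map g) = κ q then ψ (pointed e' hq.choose) else 0 with hχ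
    have hχg : ∀ p : Option C', χ (p.map g) = ψ (pointed e' p) := by
      intro p
      have hq : ∃ p' : Option C', κ (p'.map g) = κ (p.map g) := ⟨p, rfl⟩
      simp only [hχ]
      rw [dif_pos hq]
      exact hcls _ _ ((h _ _).2 hq.choose_spec)
    have hχ0 : χ none = 0 := by
      have := hχg none
      simpa [pointed] using this
    have hχκ : ∀ p q, κ p = κ q → χ p = χ q := by
      intro p q hpq
      simp only [hχ, hpq]
    have hfac : ψ = (pointedDual e χ).comp φ := by
      refine e'.ext fun c => ?_
      have h1 := hχg (some c)
      rw [LinearMap.comp_apply, hφ]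
      have h2 := pointedDual_pointed e hχ0 (some (g c))
      simp only [pointed] at h1 h2
      rw [h2, ← h1]
      rfl
    apply hψy
    rw [hfac, LinearMap.comp_apply]
    have hle : keySpan e κ ≤ LinearMap.ker (pointedDual e χ) := by
      refine keySpan_le fun p q hpq => ?_
      rw [LinearMap.mem_ker, map_add, pointedDual_pointed e hχ0, pointedDual_pointed e hχ0,
        hχκ p q hpq, ZModModule.add_self]
    exact hle hy

end KeySpan

/-! ### Barcode forests described by the ancestors of their leaves -/

namespace BarcodeForest

variable {β C C' : Type*}

/-- The forest `T`, with leaves on level `i` indexed by `C`, is described by the function `anc`: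
`anc u k` is the ancestor on level `k` of the leaf `u`, or the root of its tree if `k` lies below
the level of the root, or the leaf itself if `i ≤ k`. In particular `(anc u 0).1` is the level of
the root of the tree of `u`. -/
structure IsAncestry (T : BarcodeForest β) (i : ℕ) (ι : C → β) (anc : C → ℕ → ℕ × Finset β) :
    Prop where
  level : ∀ u k, (anc u k).1 = max (anc u 0).1 (min k i)
  root_le : ∀ u, (anc u 0).1 ≤ i
  top : ∀ u k, i ≤ k → anc u k = (i, {ι u})
  coherent : ∀ {u v k l}, anc u k = anc v k → l ≤ k → anc u l = anc v l
  below : ∀ {u k}, k ≤ (anc u 0).1 → anc u k = anc u 0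
  nonempty : ∀ u k, (anc u k).2.Nonempty
  disjoint : ∀ {u v k l z}, (anc u k).1 = (anc v l).1 → z ∈ (anc u k).2 → z ∈ (anc v l).2 →
    anc u k = anc v l
  nodes : ∀ {x}, x ∈ T.nodes ↔ ∃ u k, x = anc u k
  edges : ∀ {x y}, (x, y) ∈ T.edges ↔
    ∃ u k, (anc u 0).1 ≤ k ∧ k < i ∧ x = anc u k ∧ y = anc u (k + 1)

/-- The equivalence relation on leaves and a base point that corresponds to the step `t` of the
filtration: for `t < 0`, leaves are equivalent if they have a common ancestor on level `-t - 1` or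
higher; for `0 ≤ t`, they are equivalent if they are in the same tree, and those in trees with a
root on level at most `t` are also equivalent to the base point. -/
def forestKey (anc : C → ℕ → ℕ × Finset β) (t : ℤ) : Option C → Option (ℕ × Finset β)
  | none => none
  | some u => if ((anc u 0).1 : ℤ) ≤ t then none else some (anc u (-t - 1).toNat)

theorem forestKey_none (anc : C → ℕ → ℕ × Finset β) (t : ℤ) : forestKey anc t none = none := rfl

theorem forestKey_some (anc : C → ℕ → ℕ × Finset β) (t : ℤ) (u : C) : forestKey anc t (some u) =
    if ((anc u 0).1 : ℤ) ≤ t then none else some (anc u (-t - 1).toNat) := rfl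

theorem topLevel_eq {T : BarcodeForest β} {P : ℕ × Finset β → Prop} {x : ℕ × Finset β}
    (hx : x ∈ T.nodes) (hP : P x) (hmax : ∀ y ∈ T.nodes, P y → y.1 ≤ x.1) :
    T.topLevel P = x.1 := by
  classical
  unfold topLevel
  apply le_antisymm
  · refine Finset.sup_le fun y hy => ?_
    have := Finset.mem_filter.1 hy
    exact hmax y this.1 this.2
  · exact Finset.le_sup (f := Prod.fst) (Finset.mem_filter.2 ⟨hx, hP⟩)

namespace IsAncestry

variable {T : BarcodeForest β} {i : ℕ} {ι : C → β} {anc : C → ℕ → ℕ × Finset β}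

theorem level_le (h : T.IsAncestry i ι anc) (u : C) (k : ℕ) : (anc u k).1 ≤ i := by
  have := h.level u k
  have := h.root_le u
  omega

theorem root_le_level (h : T.IsAncestry i ι anc) (u : C) (k : ℕ) : (anc u 0).1 ≤ (anc u k).1 := by
  have := h.level u k
  omega

theorem level_eq (h : T.IsAncestry i ι anc) {u : C} {k : ℕ} (h1 : (anc u 0).1 ≤ k) (h2 : k ≤ i) :
    (anc u k).1 = k := by
  have := h.level u k
  omega

theorem anc_level (h : T.IsAncestry i ι anc) (u : C) (k : ℕ) : anc u (anc u k).1 = anc u k := by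
  have h1 := h.level u k
  have h2 := h.root_le u
  by_cases hk : k ≤ (anc u 0).1
  · rw [h.below hk, h.below le_rfl]
  · by_cases hki : k ≤ i
    · rw [h.level_eq (by omega) hki]
    · rw [h.top u k (by omega), h.top u i le_rfl]

theorem eq_of_le_level (h : T.IsAncestry i ι anc) {u v : C} {k l n : ℕ} (huv : anc u k = anc v l)
    (hn : n ≤ (anc u k).1) : anc u n = anc v n := by
  refine h.coherent (k := (anc u k).1) ?_ hn
  rw [h.anc_level, huv, h.anc_level]

theorem root_eq (h : T.IsAncestry i ι anc) {u v : C} {k l : ℕ} (huv : anc u k = anc v l) :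
    anc u 0 = anc v 0 :=
  h.eq_of_le_level huv (Nat.zero_le _)

theorem exists_of_mem_nodes (h : T.IsAncestry i ι anc) {x : ℕ × Finset β} (hx : x ∈ T.nodes) :
    ∃ u, x = anc u x.1 ∧ (anc u 0).1 ≤ x.1 ∧ x.1 ≤ i := by
  obtain ⟨u, k, rfl⟩ := h.nodes.1 hx
  exact ⟨u, (h.anc_level u k).symm, h.root_le_level u k, h.level_le u k⟩

theorem mem_nodes (h : T.IsAncestry i ι anc) (u : C) (k : ℕ) : anc u k ∈ T.nodes :=
  h.nodes.2 ⟨u, k, rfl⟩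

theorem leaf_injective (h : T.IsAncestry i ι anc) (hι : Function.Injective ι) {u v : C} {k : ℕ}
    (hk : i ≤ k) (huv : anc u k = anc v k) : u = v := by
  rw [h.top u k hk, h.top v k hk] at huv
  simpa [hι.eq_iff] using huv

theorem anc_iff (h : T.IsAncestry i ι anc) {u : C} {n : ℕ} (h1 : (anc u 0).1 ≤ n) (h2 : n ≤ i)
    {x : ℕ × Finset β} :
    T.Anc x (anc u n) ↔ ∃ l, (anc u 0).1 ≤ l ∧ l ≤ n ∧ x = anc u l := by
  constructor
  · intro hx
    induction hx using Relation.ReflTransGen.head_induction_on with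
    | refl => exact ⟨n, h1, le_rfl, rfl⟩
    | head hpc _ ih =>
      obtain ⟨l, hl1, hl2, rfl⟩ := ih
      obtain ⟨v, k, hk1, hk2, rfl, hc⟩ := h.edges.1 hpc
      have h3 := h.root_eq hc
      have h4 : l = k + 1 := by
        rw [← h.level_eq hl1 (hl2.trans h2), hc, h.level_eq (by omega) (by omega)]
      subst h4
      exact ⟨k, by rw [h3]; exact hk1, by omega, (h.coherent hc (by omega)).symm⟩
  · rintro ⟨l, hl1, hl2, rfl⟩
    induction n, hl2 using Nat.le_induction with
    | base => exact Relation.ReflTransGen.refl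
    | succ n hn ih =>
      exact (ih (by omega) (by omega)).tail (h.edges.2 ⟨u, n, by omega, by omega, rfl, rfl⟩)

theorem anc_leaf_iff (h : T.IsAncestry i ι anc) {u : C} {x : ℕ × Finset β} :
    T.Anc x (i, {ι u}) ↔ ∃ l, (anc u 0).1 ≤ l ∧ l ≤ i ∧ x = anc u l := by
  rw [← h.top u i le_rfl]
  exact h.anc_iff (h.root_le u) le_rfl

theorem isRoot_iff (h : T.IsAncestry i ι anc) {x : ℕ × Finset β} :
    T.IsRoot x ↔ ∃ u, x = anc u 0 := by
  constructor
  · rintro ⟨hx, hp⟩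
    obtain ⟨u, hu, h1, h2⟩ := h.exists_of_mem_nodes hx
    refine ⟨u, ?_⟩
    by_contra hne
    have h3 : x.1 ≠ (anc u 0).1 := fun h3 => hne (by rw [hu, h3, h.below le_rfl])
    refine hp (anc u (x.1 - 1)) (h.edges.2 ⟨u, x.1 - 1, by omega, by omega, rfl, ?_⟩)
    rw [Nat.sub_add_cancel (by omega)]
    exact hu
  · rintro ⟨u, rfl⟩
    refine ⟨h.mem_nodes u 0, fun p hp => ?_⟩
    obtain ⟨v, k, h1, h2, -, h3⟩ := h.edges.1 hp
    have h4 := h.root_eq h3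
    rw [h4] at h3
    have h5 := h.level_eq (u := v) (k := k + 1) (by omega) (by omega)
    rw [← h3] at h5
    omega

theorem isSplitting_iff (h : T.IsAncestry i ι anc) {x : ℕ × Finset β} :
    T.IsSplitting x ↔ ∃ u v k, (anc u 0).1 ≤ k ∧ k < i ∧ x = anc u k ∧ x = anc v k ∧
      anc u (k + 1) ≠ anc v (k + 1) := by
  constructor
  · rintro ⟨-, c₁, c₂, hne, h1, h2⟩
    obtain ⟨u, k, hu1, hu2, rfl, rfl⟩ := h.edges.1 h1
    obtain ⟨v, l, hv1, hv2, hx, rfl⟩ := h.edges.1 h2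
    have hkl : k = l := by
      rw [← h.level_eq hu1 hu2.le, hx, h.level_eq hv1 hv2.le]
    subst hkl
    exact ⟨u, v, k, hu1, hu2, rfl, hx, hne⟩
  · rintro ⟨u, v, k, h1, h2, rfl, h4, h5⟩
    have h6 := h.root_eq h4
    exact ⟨h.mem_nodes u k, _, _, h5, h.edges.2 ⟨u, k, h1, h2, rfl, rfl⟩,
      h.edges.2 ⟨v, k, h6 ▸ h1, h2, h4, rfl⟩⟩

theorem sameTree_iff (h : T.IsAncestry i ι anc) {u v : C} :
    T.SameTree (i, {ι u}) (i, {ι v}) ↔ anc u 0 = anc v 0 := by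
  constructor
  · rintro ⟨r, -, hu, hv⟩
    obtain ⟨l, -, -, rfl⟩ := h.anc_leaf_iff.1 hu
    obtain ⟨l', -, -, hl⟩ := h.anc_leaf_iff.1 hv
    exact h.root_eq hl
  · intro huv
    refine ⟨anc u 0, h.isRoot_iff.2 ⟨u, rfl⟩, h.anc_leaf_iff.2 ⟨_, le_rfl, h.root_le u, ?_⟩,
      h.anc_leaf_iff.2 ⟨_, le_rfl, h.root_le v, ?_⟩⟩
    · rw [h.below le_rfl]
    · rw [huv, h.below le_rfl]

theorem rootLevel_eq (h : T.IsAncestry i ι anc) (u : C) :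
    T.rootLevel (i, {ι u}) = (anc u 0).1 := by
  refine topLevel_eq (h.mem_nodes u 0) ⟨h.isRoot_iff.2 ⟨u, rfl⟩,
    h.anc_leaf_iff.2 ⟨_, le_rfl, h.root_le u, (h.below le_rfl).symm⟩⟩ ?_
  rintro y - ⟨hr, hy⟩
  obtain ⟨v, rfl⟩ := h.isRoot_iff.1 hr
  obtain ⟨l, -, -, hl⟩ := h.anc_leaf_iff.1 hy
  exact (congrArg Prod.fst (h.root_eq hl)).le

end IsAncestry

/-! ### Copying a level of the barcode graph -/

/-- `ι` and `ι'` enumerate the nodes on the levels `i` and `i + 1` of the graph `Γ`, and `R`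
describes the edges between them. -/
structure IsLink (Γ : SimpleGraph β) (level : β → ℕ) (i : ℕ) (ι : C → β) (ι' : C' → β)
    (R : C → C' → Prop) : Prop where
  inj : Function.Injective ι
  inj' : Function.Injective ι'
  level_iff : ∀ z, level z = i ↔ ∃ u, ι u = z
  level_iff' : ∀ z, level z = i + 1 ↔ ∃ c, ι' c = z
  adj_iff : ∀ u c, Γ.Adj (ι u) (ι' c) ↔ R u c

section Copy

variable [Fintype β] {Γ : SimpleGraph β} {level : β → ℕ} {i : ℕ} {ι : C → β} {ι' : C' → β}
  {R : C → C' → Prop} {T : BarcodeForest β} {anc : C → ℕ → ℕ × Finset β}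

theorem mem_copyLevel_nodes (hl : IsLink Γ level i ι ι' R) {x : ℕ × Finset β} :
    x ∈ (T.copyLevel Γ level i).nodes ↔ x ∈ T.nodes ∨ ∃ c, x = (i + 1, {ι' c}) := by
  classical
  simp only [copyLevel, Finset.mem_union, Finset.mem_image, Finset.mem_filter, Finset.mem_univ,
    true_and, hl.level_iff']
  refine or_congr_right ⟨?_, ?_⟩
  · rintro ⟨_, ⟨c, rfl⟩, rfl⟩
    exact ⟨c, rfl⟩
  · rintro ⟨c, rfl⟩
    exact ⟨_, ⟨c, rfl⟩, rfl⟩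

theorem mem_copyLevel_edges (hl : IsLink Γ level i ι ι' R) {x y : ℕ × Finset β} :
    (x, y) ∈ (T.copyLevel Γ level i).edges ↔ (x, y) ∈ T.edges ∨
      ∃ u c, R u c ∧ x = (i, {ι u}) ∧ y = (i + 1, {ι' c}) := by
  classical
  simp only [copyLevel, Finset.mem_union, Finset.mem_image, Finset.mem_filter, Finset.mem_univ,
    true_and, hl.level_iff', hl.level_iff]
  refine or_congr_right ⟨?_, ?_⟩
  · rintro ⟨⟨_, _⟩, ⟨⟨u, rfl⟩, ⟨c, rfl⟩, hadj⟩, heq⟩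
    obtain ⟨rfl, rfl⟩ := Prod.mk.inj heq
    exact ⟨u, c, (hl.adj_iff u c).1 hadj, rfl, rfl⟩
  · rintro ⟨u, c, hR, rfl, rfl⟩
    exact ⟨(ι u, ι' c), ⟨⟨u, rfl⟩, ⟨c, rfl⟩, (hl.adj_iff u c).2 hR⟩, rfl⟩

theorem IsAncestry.isDeparting_iff (h : T.IsAncestry i ι anc) (hl : IsLink Γ level i ι ι' R)
    {x : ℕ × Finset β} : (T.copyLevel Γ level i).IsDeparting i x ↔
      ∃ u, x = (i, {ι u}) ∧ ∀ c, ¬ R u c := by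
  constructor
  · rintro ⟨hx, hxi, hc⟩
    rcases (mem_copyLevel_nodes hl).1 hx with hx | ⟨c, rfl⟩
    · obtain ⟨u, hu, -⟩ := h.exists_of_mem_nodes hx
      rw [hxi, h.top u i le_rfl] at hu
      exact ⟨u, hu, fun c hR => hc _ ((mem_copyLevel_edges hl).2 (Or.inr ⟨u, c, hR, hu, rfl⟩))⟩
    · simp at hxi
  · rintro ⟨u, rfl, hu⟩
    refine ⟨(mem_copyLevel_nodes hl).2 (Or.inl (h.nodes.2 ⟨u, i, (h.top u i le_rfl).symm⟩)), rfl,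
      fun c hc => ?_⟩
    rcases (mem_copyLevel_edges hl).1 hc with hc | ⟨v, c', hR, hv, -⟩
    · obtain ⟨v, k, h1, h2, h3, -⟩ := h.edges.1 hc
      have := h.level_eq h1 h2.le
      rw [← h3] at this
      simp at this
      omega
    · obtain rfl : u = v := hl.inj (by simpa using hv)
      exact hu c' hR

theorem IsAncestry.isMerging_iff (h : T.IsAncestry i ι anc) (hl : IsLink Γ level i ι ι' R)
    {x : (ℕ × Finset β) × (ℕ × Finset β)} : (T.copyLevel Γ level i).IsMerging i x ↔
      ∃ u v c, u ≠ v ∧ R u c ∧ R v c ∧ x = ((i, {ι u}), (i, {ι v})) := by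
  constructor
  · obtain ⟨x, y⟩ := x
    rintro ⟨-, -, hne, hx, hy, c, hxc, hyc⟩
    simp only at hx hy hne hxc hyc
    have key : ∀ {x c}, x.1 = i → (x, c) ∈ (T.copyLevel Γ level i).edges →
        ∃ u c', R u c' ∧ x = (i, {ι u}) ∧ c = (i + 1, {ι' c'}) := by
      intro x c hxi hxc
      refine ((mem_copyLevel_edges hl).1 hxc).resolve_left fun hc => ?_
      obtain ⟨v, k, h1, h2, h3, -⟩ := h.edges.1 hc
      have := h.level_eq h1 h2.le
      rw [← h3] at this
      omega
    obtain ⟨u, c₁, hR, rfl, rfl⟩ := key hx hxc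
    obtain ⟨v, c₂, hR', rfl, hc⟩ := key hy hyc
    obtain rfl : c₁ = c₂ := hl.inj' (by simpa using hc)
    exact ⟨u, v, c₁, by rintro rfl; exact hne rfl, hR, hR', rfl⟩
  · rintro ⟨u, v, c, hne, hu, hv, rfl⟩
    have hmem : ∀ u, (i, {ι u}) ∈ (T.copyLevel Γ level i).nodes := fun u =>
      (mem_copyLevel_nodes hl).2 (Or.inl (h.nodes.2 ⟨u, i, (h.top u i le_rfl).symm⟩))
    exact ⟨hmem u, hmem v, by simpa [hl.inj.eq_iff] using hne, rfl, rfl, _,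
      (mem_copyLevel_edges hl).2 (Or.inr ⟨u, c, hu, rfl, rfl⟩),
      (mem_copyLevel_edges hl).2 (Or.inr ⟨v, c, hv, rfl, rfl⟩)⟩

theorem IsAncestry.anc_copyLevel_iff (h : T.IsAncestry i ι anc) (hl : IsLink Γ level i ι ι' R)
    {x y : ℕ × Finset β} (hy : y.1 ≤ i) : (T.copyLevel Γ level i).Anc x y ↔ T.Anc x y := by
  constructor
  · intro hxy
    induction hxy with
    | refl => exact Relation.ReflTransGen.refl
    | tail _ hbc ih =>
      rcases (mem_copyLevel_edges hl).1 hbc with hc | ⟨u, c, -, -, rfl⟩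
      · refine (ih ?_).tail hc
        obtain ⟨v, k, h1, h2, rfl, -⟩ := h.edges.1 hc
        exact h.level_le v k
      · simp at hy
  · intro hxy
    induction hxy with
    | refl => exact Relation.ReflTransGen.refl
    | tail _ hbc ih =>
      refine (ih ?_).tail ((mem_copyLevel_edges hl).2 (Or.inl hbc))
      obtain ⟨v, k, h1, h2, rfl, -⟩ := h.edges.1 hbc
      exact h.level_le v k

theorem IsAncestry.anc_copyLevel_leaf_iff (h : T.IsAncestry i ι anc)
    (hl : IsLink Γ level i ι ι' R) {u : C} {x : ℕ × Finset β} :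
    (T.copyLevel Γ level i).Anc x (i, {ι u}) ↔
      ∃ l, (anc u 0).1 ≤ l ∧ l ≤ i ∧ x = anc u l := by
  rw [h.anc_copyLevel_iff hl le_rfl, h.anc_leaf_iff]

end Copy

end BarcodeForest

namespace BarcodeForest

variable {β C C' : Type*}

/-! ### Entrance, split, departure, and no change -/

/-- The ancestors of the level-`(i + 1)` leaves, if every such leaf `c` continues the level-`i` leaf
`u` with `g c = some u`, or is new if `g c = none`. -/
def extendAnc (i : ℕ) (ι' : C' → β) (anc : C → ℕ → ℕ × Finset β) (g : C' → Option C) (c : C')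
    (k : ℕ) : ℕ × Finset β :=
  match g c with
  | none => (i + 1, {ι' c})
  | some u => if k ≤ i then anc u k else (i + 1, {ι' c})

section Extend

variable {i : ℕ} {ι : C → β} {ι' : C' → β} {anc : C → ℕ → ℕ × Finset β} {g : C' → Option C}

theorem extendAnc_none {c : C'} (hc : g c = none) (k : ℕ) :
    extendAnc i ι' anc g c k = (i + 1, {ι' c}) := by
  simp [extendAnc, hc]

theorem extendAnc_le {c : C'} {u : C} (hc : g c = some u) {k : ℕ} (hk : k ≤ i) :
    extendAnc i ι' anc g c k = anc u k := by
  simp [extendAnc, hc, hk]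

theorem extendAnc_gt (c : C') {k : ℕ} (hk : i < k) :
    extendAnc i ι' anc g c k = (i + 1, {ι' c}) := by
  unfold extendAnc
  split
  · rfl
  · rw [if_neg (by omega)]

/-- A forest that consists of the paths to those leaves of `T` that have a successor, and of the
next level, is described by `extendAnc`. -/
theorem IsAncestry.extend {T T' : BarcodeForest β} (h : T.IsAncestry i ι anc)
    (hι' : Function.Injective ι')
    (hnodes : ∀ x, x ∈ T'.nodes ↔ (∃ u c k, g c = some u ∧ x = anc u k) ∨
      ∃ c, x = (i + 1, {ι' c}))
    (hedges : ∀ x y, (x, y) ∈ T'.edges ↔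
      (∃ u c k, g c = some u ∧ (anc u 0).1 ≤ k ∧ k < i ∧ x = anc u k ∧ y = anc u (k + 1)) ∨
      ∃ u c, g c = some u ∧ x = (i, {ι u}) ∧ y = (i + 1, {ι' c})) :
    T'.IsAncestry (i + 1) ι' (extendAnc i ι' anc g) := by
  -- the two kinds of values of the new ancestor function
  have hcase : ∀ c k, (∃ u, g c = some u ∧ k ≤ i ∧ extendAnc i ι' anc g c k = anc u k) ∨
      ((g c = none ∨ i < k) ∧ extendAnc i ι' anc g c k = (i + 1, {ι' c})) := by
    intro c k
    cases hg : g c with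
    | none => exact Or.inr ⟨Or.inl rfl, extendAnc_none hg k⟩
    | some u =>
      by_cases hk : k ≤ i
      · exact Or.inl ⟨u, rfl, hk, extendAnc_le hg hk⟩
      · exact Or.inr ⟨Or.inr (by omega), extendAnc_gt c (by omega)⟩
  have hroot : ∀ {c u}, g c = some u → extendAnc i ι' anc g c 0 = anc u 0 :=
    fun hc => extendAnc_le hc (Nat.zero_le _)
  have hlt : ∀ u k, (anc u k).1 ≠ i + 1 := fun u k => by
    have := h.level_le u k
    omega
  have hinj : ∀ {c c'}, ((i + 1, {ι' c}) : ℕ × Finset β) = (i + 1, {ι' c'}) → c = c' := by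
    intro c c' hcc
    simpa [hι'.eq_iff] using hcc
  constructor
  · intro c k
    cases hg : g c with
    | none => simp only [extendAnc_none hg]; omega
    | some u =>
      rw [hroot hg]
      have h1 := h.level u k
      have h2 := h.root_le u
      by_cases hk : k ≤ i
      · rw [extendAnc_le hg hk]; omega
      · rw [extendAnc_gt c (by omega)]; simp only; omega
  · intro c
    cases hg : g c with
    | none => simp only [extendAnc_none hg]; omega
    | some u =>
      rw [hroot hg]
      have := h.root_le u
      omega
  · intro c k hk
    exact extendAnc_gt c (by omega)
  · intro c c' k l hcc hl
    rcases hcase c k with ⟨u, hu, hk, hcu⟩ | ⟨-, hcu⟩ <;>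
      rcases hcase c' k with ⟨v, hv, -, hcv⟩ | ⟨-, hcv⟩ <;> rw [hcu, hcv] at hcc
    · rw [extendAnc_le hu (hl.trans hk), extendAnc_le hv (hl.trans hk)]
      exact h.coherent hcc hl
    · exact absurd (congrArg Prod.fst hcc) (hlt _ _)
    · exact absurd (congrArg Prod.fst hcc).symm (hlt _ _)
    · rw [hinj hcc]
  · intro c k hk
    cases hg : g c with
    | none => rw [extendAnc_none hg, extendAnc_none hg]
    | some u =>
      rw [hroot hg] at hk ⊢
      rw [extendAnc_le hg (hk.trans (h.root_le u))]
      exact h.below hk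
  · intro c k
    rcases hcase c k with ⟨u, -, -, hcu⟩ | ⟨-, hcu⟩ <;> rw [hcu]
    · exact h.nonempty u k
    · simp
  · intro c c' k l z
    rcases hcase c k with ⟨u, hu, hk, hcu⟩ | ⟨-, hcu⟩ <;>
      rcases hcase c' l with ⟨v, hv, hl, hcv⟩ | ⟨-, hcv⟩ <;> rw [hcu, hcv]
    · exact h.disjoint
    · exact fun hh => absurd hh (hlt _ _)
    · exact fun hh => absurd hh.symm (hlt _ _)
    · intro _ h1 h2
      simp only [Finset.mem_singleton] at h1 h2
      rw [← h1, ← h2]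
  · intro x
    rw [hnodes]
    constructor
    · rintro (⟨u, c, k, hc, rfl⟩ | ⟨c, rfl⟩)
      · by_cases hk : k ≤ i
        · exact ⟨c, k, (extendAnc_le hc hk).symm⟩
        · refine ⟨c, i, ?_⟩
          rw [extendAnc_le hc le_rfl, h.top u k (by omega), h.top u i le_rfl]
      · exact ⟨c, i + 1, (extendAnc_gt c (by omega)).symm⟩
    · rintro ⟨c, k, rfl⟩
      rcases hcase c k with ⟨u, hu, -, hcu⟩ | ⟨-, hcu⟩
      · exact Or.inl ⟨u, c, k, hu, hcu⟩
      · exact Or.inr ⟨c, hcu⟩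
  · intro x y
    rw [hedges]
    constructor
    · rintro (⟨u, c, k, hc, h1, h2, rfl, rfl⟩ | ⟨u, c, hc, rfl, rfl⟩)
      · refine ⟨c, k, by rwa [hroot hc], by omega, (extendAnc_le hc h2.le).symm,
          (extendAnc_le hc h2).symm⟩
      · refine ⟨c, i, by rw [hroot hc]; exact h.root_le u, by omega, ?_,
          (extendAnc_gt c (by omega)).symm⟩
        rw [extendAnc_le hc le_rfl, h.top u i le_rfl]
    · rintro ⟨c, k, h1, h2, rfl, rfl⟩
      cases hg : g c with
      | none =>
        rw [extendAnc_none hg] at h1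
        simp only at h1
        omega
      | some u =>
        rw [hroot hg] at h1
        rcases Nat.lt_succ_iff_lt_or_eq.1 h2 with h2 | rfl
        · exact Or.inl ⟨u, c, k, hg, h1, h2, extendAnc_le hg h2.le, extendAnc_le hg h2⟩
        · refine Or.inr ⟨u, c, hg, ?_, extendAnc_gt c (by omega)⟩
          rw [extendAnc_le hg le_rfl, h.top u k le_rfl]

theorem forestKey_extendAnc {t : ℤ} (ht : -((i + 1 : ℕ) : ℤ) ≤ t) (p : Option C')
    (hp : ∀ c, p = some c → g c ≠ none) :
    forestKey (extendAnc i ι' anc g) t p = forestKey anc t (p.bind g) := by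
  cases p with
  | none => rfl
  | some c =>
    obtain ⟨u, hu⟩ := Option.ne_none_iff_exists'.1 (hp c rfl)
    rw [Option.bind_some, hu, forestKey_some, forestKey_some, extendAnc_le hu (Nat.zero_le _),
      extendAnc_le hu (by omega)]

end Extend

section Steps

variable [Fintype β] {Γ : SimpleGraph β} {level : β → ℕ} {i : ℕ} {ι : C → β} {ι' : C' → β}
  {T : BarcodeForest β} {anc : C → ℕ → ℕ × Finset β} {g : C' → Option C}

/-- If every leaf is continued and no two of them merge, the new forest is the old one with the new
level copied into it. -/
theorem IsAncestry.step_eq_copyLevel (h : T.IsAncestry i ι anc)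
    (hl : IsLink Γ level i ι ι' fun u c => g c = some u) (hg : ∀ u, ∃ c, g c = some u) :
    step Γ level i T = (T.copyLevel Γ level i, 0) := by
  unfold step
  have h1 : ¬ ∃ u, (T.copyLevel Γ level i).IsDeparting i u := by
    rintro ⟨x, hx⟩
    obtain ⟨u, -, hu⟩ := (h.isDeparting_iff hl).1 hx
    obtain ⟨c, hc⟩ := hg u
    exact hu c hc
  have h2 : ¬ ∃ u, (T.copyLevel Γ level i).IsMerging i u := by
    rintro ⟨x, hx⟩
    obtain ⟨u, v, c, hne, hu, hv, -⟩ := (h.isMerging_iff hl).1 hx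
    exact hne (Option.some_injective _ (hu.symm.trans hv))
  simp only [dif_neg h1, dif_neg h2]

theorem IsAncestry.copyLevel (h : T.IsAncestry i ι anc)
    (hl : IsLink Γ level i ι ι' fun u c => g c = some u) (hg : ∀ u, ∃ c, g c = some u) :
    (T.copyLevel Γ level i).IsAncestry (i + 1) ι' (extendAnc i ι' anc g) := by
  refine h.extend hl.inj' (fun x => ?_) (fun x y => ?_)
  · rw [mem_copyLevel_nodes hl, h.nodes]
    refine or_congr_left ⟨?_, ?_⟩
    · rintro ⟨u, k, rfl⟩
      obtain ⟨c, hc⟩ := hg u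
      exact ⟨u, c, k, hc, rfl⟩
    · rintro ⟨u, c, k, hc, rfl⟩
      exact ⟨u, k, rfl⟩
  · rw [mem_copyLevel_edges hl, h.edges]
    refine or_congr_left ⟨?_, ?_⟩
    · rintro ⟨u, k, hk⟩
      obtain ⟨c, hc⟩ := hg u
      exact ⟨u, c, k, hc, hk⟩
    · rintro ⟨u, c, k, hc, hk⟩
      exact ⟨u, k, hk⟩

/-- Removing the departing leaf `u` with those of its ancestors that are not ancestors of other
leaves. -/
theorem IsAncestry.delete (h : T.IsAncestry i ι anc)
    (hl : IsLink Γ level i ι ι' fun u c => g c = some u) {u : C} (hu : ∀ c, g c ≠ some u)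
    (hg : ∀ v, v ≠ u → ∃ c, g c = some v) {P : ℕ × Finset β → Prop}
    (hP : ∀ l, (anc u 0).1 ≤ l → l ≤ i → (P (anc u l) ↔ ∀ w, w ≠ u → anc w l ≠ anc u l))
    (hP' : ∀ x, P x → (T.copyLevel Γ level i).Anc x (i, {ι u})) :
    ((T.copyLevel Γ level i).delete P).IsAncestry (i + 1) ι' (extendAnc i ι' anc g) := by
  have hne : ∀ {v c}, g c = some v → v ≠ u := fun hc hvu => hu _ (hvu ▸ hc)
  have hP1 : ∀ v k, v ≠ u → ¬ P (anc v k) := by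
    intro v k hv hPv
    obtain ⟨l, hl1, hl2, hvl⟩ := (h.anc_copyLevel_leaf_iff hl).1 (hP' _ hPv)
    rw [hvl, hP l hl1 hl2] at hPv
    have h1 := h.level_eq hl1 hl2
    exact hPv v hv (h.eq_of_le_level hvl (by rw [hvl]; omega))
  have hP2 : ∀ c, ¬ P (i + 1, {ι' c}) := by
    intro c hPc
    obtain ⟨l, hl1, hl2, hvl⟩ := (h.anc_copyLevel_leaf_iff hl).1 (hP' _ hPc)
    have h1 := h.level_eq hl1 hl2
    rw [← hvl] at h1
    simp only at h1
    omega
  have hP3 : ∀ l, (anc u 0).1 ≤ l → l ≤ i → ¬ P (anc u l) → ∃ w, w ≠ u ∧ anc w l = anc u l := by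
    intro l hl1 hl2 hn
    rw [hP l hl1 hl2] at hn
    push Not at hn
    exact hn
  have hmemn : ∀ x, x ∈ ((T.copyLevel Γ level i).delete P).nodes ↔
      x ∈ (T.copyLevel Γ level i).nodes ∧ ¬ P x := fun x => by
    simp [BarcodeForest.delete]
  have hmeme : ∀ x y, (x, y) ∈ ((T.copyLevel Γ level i).delete P).edges ↔
      (x, y) ∈ (T.copyLevel Γ level i).edges ∧ ¬ P x ∧ ¬ P y := fun x y => by
    simp [BarcodeForest.delete]
  refine h.extend hl.inj' (fun x => ?_) (fun x y => ?_)
  · rw [hmemn, mem_copyLevel_nodes hl]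
    constructor
    · rintro ⟨hx | hx, hPx⟩
      · left
        obtain ⟨v, hv, h1, h2⟩ := h.exists_of_mem_nodes hx
        by_cases hvu : v = u
        · subst hvu
          rw [hv] at hPx
          obtain ⟨w, hw, hwl⟩ := hP3 _ h1 h2 hPx
          obtain ⟨c, hc⟩ := hg w hw
          exact ⟨w, c, x.1, hc, hv.trans hwl.symm⟩
        · obtain ⟨c, hc⟩ := hg v hvu
          exact ⟨v, c, x.1, hc, hv⟩
      · exact Or.inr hx
    · rintro (⟨v, c, k, hc, rfl⟩ | ⟨c, rfl⟩)
      · exact ⟨Or.inl (h.mem_nodes v k), hP1 v k (hne hc)⟩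
      · exact ⟨Or.inr ⟨c, rfl⟩, hP2 c⟩
  · rw [hmeme, mem_copyLevel_edges hl]
    constructor
    · rintro ⟨hxy | hxy, hPx, hPy⟩
      · left
        obtain ⟨v, k, h1, h2, rfl, rfl⟩ := h.edges.1 hxy
        by_cases hvu : v = u
        · subst hvu
          obtain ⟨w, hw, hwl⟩ := hP3 (k + 1) (by omega) (by omega) hPy
          obtain ⟨c, hc⟩ := hg w hw
          exact ⟨w, c, k, hc, by rw [h.root_eq hwl]; exact h1, h2,
            (h.coherent hwl (by omega)).symm, hwl.symm⟩
        · obtain ⟨c, hc⟩ := hg v hvu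
          exact ⟨v, c, k, hc, h1, h2, rfl, rfl⟩
      · right
        obtain ⟨v, c, hc, rfl, rfl⟩ := hxy
        exact ⟨v, c, hc, rfl, rfl⟩
    · rintro (⟨v, c, k, hc, h1, h2, rfl, rfl⟩ | ⟨v, c, hc, rfl, rfl⟩)
      · exact ⟨Or.inl (h.edges.2 ⟨v, k, h1, h2, rfl, rfl⟩), hP1 v _ (hne hc), hP1 v _ (hne hc)⟩
      · refine ⟨Or.inr ⟨v, c, hc, rfl, rfl⟩, ?_, hP2 c⟩
        rw [← h.top v i le_rfl]
        exact hP1 v i (hne hc)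

/-- The splitting ancestors of a departing leaf `u` are the nodes at which the paths to `u` and to
another leaf part. -/
theorem IsAncestry.isSplitting_copyLevel_iff (h : T.IsAncestry i ι anc)
    (hl : IsLink Γ level i ι ι' fun u c => g c = some u) {u : C} (hu : ∀ c, g c ≠ some u)
    {x : ℕ × Finset β} :
    ((T.copyLevel Γ level i).IsSplitting x ∧ (T.copyLevel Γ level i).Anc x (i, {ι u})) ↔
      ∃ l w, (anc u 0).1 ≤ l ∧ l < i ∧ x = anc u l ∧ anc w l = anc u l ∧
        anc w (l + 1) ≠ anc u (l + 1) := by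
  constructor
  · rintro ⟨⟨-, c₁, c₂, hne, h1, h2⟩, hanc⟩
    obtain ⟨l, hl1, hl2, rfl⟩ := (h.anc_copyLevel_leaf_iff hl).1 hanc
    have hlev := h.level_eq hl1 hl2
    have hli : l < i := by
      rcases hl2.lt_or_eq with hli | rfl
      · exact hli
      · rw [h.top u l le_rfl] at h1
        rcases (mem_copyLevel_edges hl).1 h1 with h1 | ⟨v, c, hc, hv, -⟩
        · obtain ⟨v, k, hk1, hk2, hk3, -⟩ := h.edges.1 h1
          have := h.level_eq hk1 hk2.le
          rw [← hk3] at this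
          simp only at this
          omega
        · obtain rfl : u = v := hl.inj (by simpa using hv)
          exact absurd hc (hu c)
    have key : ∀ c, (anc u l, c) ∈ (T.copyLevel Γ level i).edges →
        ∃ w, anc w l = anc u l ∧ c = anc w (l + 1) := by
      intro c hc
      rcases (mem_copyLevel_edges hl).1 hc with hc | ⟨v, c, -, hv, -⟩
      · obtain ⟨v, k, hk1, hk2, hk3, rfl⟩ := h.edges.1 hc
        have := h.level_eq hk1 hk2.le
        rw [← hk3, hlev] at this
        subst this
        exact ⟨v, hk3.symm, rfl⟩
      · rw [hv] at hlev
        simp only at hlev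
        omega
    obtain ⟨w₁, hw₁, rfl⟩ := key c₁ h1
    obtain ⟨w₂, hw₂, rfl⟩ := key c₂ h2
    by_cases h3 : anc w₁ (l + 1) = anc u (l + 1)
    · exact ⟨l, w₂, hl1, hli, rfl, hw₂, fun h4 => hne (h3.trans h4.symm)⟩
    · exact ⟨l, w₁, hl1, hli, rfl, hw₁, h3⟩
  · rintro ⟨l, w, hl1, hl2, rfl, hw1, hw2⟩
    refine ⟨⟨(mem_copyLevel_nodes hl).2 (Or.inl (h.mem_nodes u l)), _, _, hw2,
      (mem_copyLevel_edges hl).2 (Or.inl (h.edges.2 ⟨w, l, ?_, hl2, hw1.symm, rfl⟩)),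
      (mem_copyLevel_edges hl).2 (Or.inl (h.edges.2 ⟨u, l, hl1, hl2, rfl, rfl⟩))⟩,
      (h.anc_copyLevel_leaf_iff hl).2 ⟨l, hl1, hl2.le, rfl⟩⟩
    rw [h.root_eq hw1]
    exact hl1

/-- Correctness of the treatment of a departure: the birth `b` in the output is the absolute value
of the first step `T₀` of the filtration at which `u` is equivalent to something else. -/
theorem IsAncestry.step_departure (h : T.IsAncestry i ι anc)
    (hl : IsLink Γ level i ι ι' fun u c => g c = some u) {u : C} (hu : ∀ c, g c ≠ some u)
    (hg : ∀ v, v ≠ u → ∃ c, g c = some v) :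
    (step Γ level i T).1.IsAncestry (i + 1) ι' (extendAnc i ι' anc g) ∧
      ∃ T₀ : ℤ, (step Γ level i T).2 = {(T₀.natAbs, i)} ∧
        ∀ t, T₀ ≤ t ↔ ∃ q, q ≠ some u ∧ forestKey anc t (some u) = forestKey anc t q := by
  classical
  have hdep : ∃ x, (T.copyLevel Γ level i).IsDeparting i x :=
    ⟨_, (h.isDeparting_iff hl).2 ⟨u, rfl, hu⟩⟩
  have hchoose : hdep.choose = (i, {ι u}) := by
    obtain ⟨v, hv, hv'⟩ := (h.isDeparting_iff hl).1 hdep.choose_spec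
    rw [hv]
    by_cases hvu : v = u
    · rw [hvu]
    · obtain ⟨c, hc⟩ := hg v hvu
      exact absurd hc (hv' c)
  have hstep : step Γ level i T = (((T.copyLevel Γ level i).departure i (i, {ι u})).1,
      {((T.copyLevel Γ level i).departure i (i, {ι u})).2}) := by
    unfold step
    simp only [dif_pos hdep, hchoose]
  rw [hstep]
  by_cases hw : ∃ w, w ≠ u ∧ anc w 0 = anc u 0
  · -- `j` is the highest level on which `u` shares its ancestor with another leaf
    set S : ℕ → Prop := fun l => ∃ w, w ≠ u ∧ anc w l = anc u l with hS
    set j := Nat.findGreatest S i with hj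
    have hSj : S j := Nat.findGreatest_spec (P := S) (Nat.zero_le i) hw
    have hji : j < i := by
      refine lt_of_le_of_ne (Nat.findGreatest_le i) fun hji => ?_
      obtain ⟨w, hwu, hwj⟩ := hSj
      exact hwu (h.leaf_injective hl.inj (by omega) hwj)
    have hSle : ∀ l, S l ↔ l ≤ j := by
      intro l
      constructor
      · rintro ⟨w, hwu, hwl⟩
        have hli : l ≤ i := by
          by_contra hli
          exact hwu (h.leaf_injective hl.inj (by omega) hwl)
        exact Nat.le_findGreatest hli ⟨w, hwu, hwl⟩
      · intro hlj
        obtain ⟨w, hwu, hwj⟩ := hSj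
        exact ⟨w, hwu, h.coherent hwj hlj⟩
    obtain ⟨w, hwu, hwj⟩ := hSj
    have hwj' : anc w (j + 1) ≠ anc u (j + 1) := fun hw' => by
      have := (hSle (j + 1)).1 ⟨w, hwu, hw'⟩
      omega
    have hroot := h.root_eq hwj
    have hrj : (anc u 0).1 ≤ j := by
      by_contra hlt
      apply hwj'
      rw [h.below (u := w) (by rw [hroot]; omega), h.below (u := u) (by omega), hroot]
    have hsplit := fun x => h.isSplitting_copyLevel_iff hl hu (x := x)
    have hsplj := (hsplit (anc u j)).2 ⟨j, w, hrj, hji, rfl, hwj, hwj'⟩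
    have htop : (T.copyLevel Γ level i).topLevel
        (fun v => (T.copyLevel Γ level i).IsSplitting v ∧
          (T.copyLevel Γ level i).Anc v (i, {ι u})) = j := by
      rw [topLevel_eq (x := anc u j) hsplj.1.1 hsplj, h.level_eq hrj hji.le]
      intro y _ hy
      obtain ⟨l, w', hl1, hl2, rfl, hw1, hw2⟩ := (hsplit y).1 hy
      rw [h.level_eq hrj hji.le, h.level_eq hl1 hl2.le]
      exact (hSle l).1 ⟨w', by rintro rfl; exact hw2 rfl, hw1⟩
    unfold departure
    rw [if_pos ⟨_, hsplj⟩, htop]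
    refine ⟨h.delete hl hu hg (fun l hl1 hl2 => ?_) (fun x hx => hx.1), -((j + 1 : ℕ) : ℤ),
      by rw [Int.natAbs_neg, Int.natAbs_natCast], fun t => ?_⟩
    · rw [h.level_eq hl1 hl2]
      have h1 := hSle l
      simp only [hS] at h1
      constructor
      · rintro ⟨-, hjl⟩ w' hw' hwl
        have := h1.1 ⟨w', hw', hwl⟩
        omega
      · intro hall
        refine ⟨(h.anc_copyLevel_leaf_iff hl).2 ⟨l, hl1, hl2, rfl⟩, ?_⟩
        by_contra hlj
        obtain ⟨w', hw', hwl⟩ := h1.2 (by omega)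
        exact hall w' hw' hwl
    · constructor
      · intro ht
        refine ⟨some w, by simpa using hwu, ?_⟩
        rw [forestKey_some, forestKey_some, hroot]
        split_ifs with h0
        · rfl
        · rw [h.coherent hwj (show (-t - 1).toNat ≤ j by omega)]
      · rintro ⟨q, hq, hkey⟩
        by_contra ht
        rw [forestKey_some, if_neg (by omega)] at hkey
        cases q with
        | none => cases hkey
        | some w' =>
          rw [forestKey_some, if_neg (by omega)] at hkey
          have := (hSle _).1 ⟨w', by simpa using hq, (Option.some_injective _ hkey).symm⟩
          omega
  · push Not at hw
    have hns : ¬ ∃ v, (T.copyLevel Γ level i).IsSplitting v ∧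
        (T.copyLevel Γ level i).Anc v (i, {ι u}) := by
      rintro ⟨x, hx⟩
      obtain ⟨l, w, -, -, -, hw1, hw2⟩ := (h.isSplitting_copyLevel_iff hl hu).1 hx
      exact hw w (by rintro rfl; exact hw2 rfl) (h.root_eq hw1)
    have hrootlev : (T.copyLevel Γ level i).rootLevel (i, {ι u}) = (anc u 0).1 := by
      refine topLevel_eq ((mem_copyLevel_nodes hl).2 (Or.inl (h.mem_nodes u 0))) ⟨⟨?_, ?_⟩, ?_⟩ ?_
      · exact (mem_copyLevel_nodes hl).2 (Or.inl (h.mem_nodes u 0))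
      · intro p hp
        rcases (mem_copyLevel_edges hl).1 hp with hp | ⟨v, c, -, -, hv⟩
        · exact (h.isRoot_iff.2 ⟨u, rfl⟩).2 p hp
        · have := h.root_le u
          rw [hv] at this
          simp at this
      · exact (h.anc_copyLevel_leaf_iff hl).2 ⟨_, le_rfl, h.root_le u, (h.below le_rfl).symm⟩
      · rintro y - ⟨⟨-, hr⟩, hy⟩
        obtain ⟨l, hl1, hl2, rfl⟩ := (h.anc_copyLevel_leaf_iff hl).1 hy
        by_contra hlt
        rw [h.level_eq hl1 hl2] at hlt
        obtain ⟨l, rfl⟩ : ∃ l', l = l' + 1 := ⟨l - 1, by omega⟩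
        exact hr _ ((mem_copyLevel_edges hl).2
          (Or.inl (h.edges.2 ⟨u, l, by omega, by omega, rfl, rfl⟩)))
    unfold departure
    rw [if_neg hns, hrootlev]
    refine ⟨h.delete hl hu hg (fun l hl1 hl2 => ?_) (fun x hx => hx), ((anc u 0).1 : ℤ),
      by simp, fun t => ?_⟩
    · refine ⟨fun _ w hwu hwl => hw w hwu (h.root_eq hwl), fun _ =>
        (h.anc_copyLevel_leaf_iff hl).2 ⟨l, hl1, hl2, rfl⟩⟩
    · constructor
      · intro ht
        refine ⟨none, by simp, ?_⟩
        rw [forestKey_some, if_pos ht, forestKey_none]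
      · rintro ⟨q, hq, hkey⟩
        by_contra ht
        rw [forestKey_some, if_neg ht] at hkey
        cases q with
        | none => cases hkey
        | some w =>
          rw [forestKey_some] at hkey
          split_ifs at hkey
          exact hw w (by simpa using hq) (h.root_eq (Option.some_injective _ hkey).symm)

end Steps

end BarcodeForest

namespace BarcodeForest

variable {β C C' : Type*}

/-! ### Merge -/

/-- The assumptions on a gluing of the paths from the leaves `lo` and `hi` down to the level `j`,
where `f` maps the leaves to those of the next level: either the paths meet on the level `j`, or
they are in different trees, and that of `hi` has its root on the level `j`. The node map `γ`
identifies the two paths on the levels from `j` on, and nothing else. -/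
structure IsGluing (i : ℕ) (anc : C → ℕ → ℕ × Finset β) (f : C → C') (lo hi : C) (j : ℕ)
    (γ : ℕ × Finset β → ℕ × Finset β) : Prop where
  surj : Function.Surjective f
  merge : f lo = f hi
  collapse : ∀ u v, f u = f v → u = v ∨ (u = lo ∧ v = hi) ∨ (u = hi ∧ v = lo)
  le : j ≤ i
  root_lo : (anc lo 0).1 ≤ j
  root_hi : (anc hi 0).1 ≤ j
  cases : (∀ k ≤ j, anc lo k = anc hi k) ∨ (anc hi 0).1 = j
  lo_eq : ∀ l, j ≤ l → l ≤ i → (γ (anc lo l)).1 = l ∧ ∀ z, z ∈ (γ (anc lo l)).2 ↔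
    z ∈ (anc lo l).2 ∨ z ∈ (anc hi l).2
  hi_eq : ∀ l, j ≤ l → l ≤ i → γ (anc hi l) = γ (anc lo l)
  other : ∀ u k, ¬ (j ≤ (anc u k).1 ∧
    (anc u k = anc lo (anc u k).1 ∨ anc u k = anc hi (anc u k).1)) → γ (anc u k) = anc u k

open Classical in
/-- The leaf whose ancestors below the level `j` are those of `u` after the gluing. -/
noncomputable def glueLeaf (anc : C → ℕ → ℕ × Finset β) (lo hi : C) (j : ℕ) (u : C) : C :=
  if anc u j = anc hi j then lo else u

open Classical in
/-- The ancestors of the leaf on level `i + 1` to which `u` is connected, after the gluing. -/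
noncomputable def glueAnc (i : ℕ) (ι' : C' → β) (anc : C → ℕ → ℕ × Finset β) (f : C → C')
    (lo hi : C) (j : ℕ) (γ : ℕ × Finset β → ℕ × Finset β) (u : C) (k : ℕ) : ℕ × Finset β :=
  if k ≤ i then γ (if k < j then anc (glueLeaf anc lo hi j u) k else anc u k)
  else (i + 1, {ι' (f u)})

namespace IsGluing

variable {T : BarcodeForest β} {i : ℕ} {ι : C → β} {ι' : C' → β} {anc : C → ℕ → ℕ × Finset β}
  {f : C → C'} {lo hi : C} {j : ℕ} {γ : ℕ × Finset β → ℕ × Finset β}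

local notation "σ" => glueLeaf anc lo hi j
local notation "A" => glueAnc i ι' anc f lo hi j γ

theorem glueLeaf_cases (u : C) :
    (anc u j = anc hi j ∧ σ u = lo) ∨ (anc u j ≠ anc hi j ∧ σ u = u) := by
  unfold glueLeaf
  split_ifs with h <;> simp [h]

theorem glueAnc_lt (G : IsGluing i anc f lo hi j γ) {k : ℕ} (hk : k < j) (u : C) :
    A u k = γ (anc (σ u) k) := by
  have := G.le
  simp [glueAnc, hk, show k ≤ i by omega]

theorem glueAnc_ge {k : ℕ} (hk : j ≤ k) (hki : k ≤ i) (u : C) :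
    A u k = γ (anc u k) := by
  simp [glueAnc, hki, show ¬ k < j by omega]

theorem glueAnc_gt {k : ℕ} (hki : i < k) (u : C) : A u k = (i + 1, {ι' (f u)}) := by
  simp [glueAnc, show ¬ k ≤ i by omega]

theorem exists_glueAnc_eq (G : IsGluing i anc f lo hi j γ) (u : C) {k : ℕ} (hk : k ≤ i) :
    ∃ w, A u k = γ (anc w k) ∧ (k < j → w = σ u) ∧ (j ≤ k → w = u) := by
  by_cases hkj : k < j
  · exact ⟨σ u, G.glueAnc_lt hkj u, fun _ => rfl, fun h => absurd hkj (by omega)⟩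
  · exact ⟨u, glueAnc_ge (by omega) hk u, fun h => absurd h hkj, fun _ => rfl⟩

/-- The node `x` lies, on level `j` or higher, on the path to `lo` or on that to `hi`. These are the
nodes that the gluing may change. -/
def OnPath (anc : C → ℕ → ℕ × Finset β) (lo hi : C) (j : ℕ) (x : ℕ × Finset β) : Prop :=
  j ≤ x.1 ∧ (x = anc lo x.1 ∨ x = anc hi x.1)

variable (h : T.IsAncestry i ι anc) (G : IsGluing i anc f lo hi j γ)
include h G

theorem eq_onPath {u : C} {k : ℕ} (hp : OnPath anc lo hi j (anc u k)) :
    γ (anc u k) = γ (anc lo (anc u k).1) := by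
  have hle := h.level_le u k
  obtain ⟨h1, h2 | h2⟩ := hp
  · exact congrArg γ h2
  · rw [← G.hi_eq _ h1 hle]
    exact congrArg γ h2

theorem level_γ (u : C) (k : ℕ) : (γ (anc u k)).1 = (anc u k).1 := by
  by_cases hp : OnPath anc lo hi j (anc u k)
  · rw [G.eq_onPath h hp]
    exact (G.lo_eq _ hp.1 (h.level_le u k)).1
  · rw [G.other u k hp]

theorem mem_γ_of_onPath {u : C} {k : ℕ} (hp : OnPath anc lo hi j (anc u k)) {z : β} :
    z ∈ (γ (anc u k)).2 ↔ z ∈ (anc lo (anc u k).1).2 ∨ z ∈ (anc hi (anc u k).1).2 := by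
  rw [G.eq_onPath h hp]
  exact (G.lo_eq _ hp.1 (h.level_le u k)).2 z

theorem nonempty_γ (u : C) (k : ℕ) : (γ (anc u k)).2.Nonempty := by
  by_cases hp : OnPath anc lo hi j (anc u k)
  · obtain ⟨z, hz⟩ := h.nonempty lo (anc u k).1
    exact ⟨z, (G.mem_γ_of_onPath h hp).2 (Or.inl hz)⟩
  · rw [G.other u k hp]
    exact h.nonempty u k

theorem level_path {u : C} {k : ℕ} (hp : OnPath anc lo hi j (anc u k)) :
    (anc lo (anc u k).1).1 = (anc u k).1 ∧ (anc hi (anc u k).1).1 = (anc u k).1 :=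
  ⟨h.level_eq (G.root_lo.trans hp.1) (h.level_le u k),
    h.level_eq (G.root_hi.trans hp.1) (h.level_le u k)⟩

/-- The glued nodes on one level are disjoint, and a common element of two of them determines
whether they come from the glued paths. -/
theorem disjoint_γ {u v : C} {k l : ℕ} {z : β} (hl : (anc u k).1 = (anc v l).1)
    (hu : z ∈ (γ (anc u k)).2) (hv : z ∈ (γ (anc v l)).2) :
    anc u k = anc v l ∨ (OnPath anc lo hi j (anc u k) ∧ OnPath anc lo hi j (anc v l)) := by
  have key : ∀ {u v k l}, (anc u k).1 = (anc v l).1 → z ∈ (γ (anc u k)).2 →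
      z ∈ (anc v l).2 → OnPath anc lo hi j (anc u k) → OnPath anc lo hi j (anc v l) := by
    intro u v k l hl hu hv hp
    have hlev := G.level_path h hp
    rcases (G.mem_γ_of_onPath h hp).1 hu with hz | hz
    · have := h.disjoint (hlev.1.trans hl) hz hv
      exact ⟨hl ▸ hp.1, Or.inl (by rw [← hl]; exact this.symm)⟩
    · have := h.disjoint (hlev.2.trans hl) hz hv
      exact ⟨hl ▸ hp.1, Or.inr (by rw [← hl]; exact this.symm)⟩
  by_cases hp : OnPath anc lo hi j (anc u k) <;> by_cases hq : OnPath anc lo hi j (anc v l)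
  · exact Or.inr ⟨hp, hq⟩
  · rw [G.other v l hq] at hv
    exact Or.inr ⟨hp, key hl hu hv hp⟩
  · rw [G.other u k hp] at hu
    exact Or.inr ⟨key hl.symm hv hu hq, hq⟩
  · rw [G.other u k hp] at hu
    rw [G.other v l hq] at hv
    exact Or.inl (h.disjoint hl hu hv)

theorem γ_eq_iff {u v : C} {k l : ℕ} : γ (anc u k) = γ (anc v l) ↔ (anc u k).1 = (anc v l).1 ∧
    (anc u k = anc v l ∨ (OnPath anc lo hi j (anc u k) ∧ OnPath anc lo hi j (anc v l))) := by
  constructor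
  · intro heq
    have hl : (anc u k).1 = (anc v l).1 := by
      rw [← G.level_γ h, heq, G.level_γ h]
    obtain ⟨z, hz⟩ := G.nonempty_γ h u k
    exact ⟨hl, G.disjoint_γ h hl hz (heq ▸ hz)⟩
  · rintro ⟨hl, heq | ⟨hp, hq⟩⟩
    · rw [heq]
    · rw [G.eq_onPath h hp, G.eq_onPath h hq, hl]

/-- Leaves that are equivalent below `j` before the gluing are equivalent after it. -/
theorem glueLeaf_eq {u v : C} {k : ℕ} (hk : k ≤ j) (huv : anc u k = anc v k) :
    anc (σ u) k = anc (σ v) k := by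
  have key : ∀ {u v}, anc u k = anc v k → anc u j = anc hi j → anc v j ≠ anc hi j →
      anc lo k = anc v k := by
    intro u v huv hu hv
    have h1 : anc hi k = anc v k := (h.coherent hu hk).symm.trans huv
    rcases G.cases with hc | hc
    · rw [hc k hk, h1]
    · exfalso
      have h2 := h.root_eq h1
      have h3 := h.level_eq (u := v) (k := j) (by rw [← h2]; exact G.root_hi) G.le
      apply hv
      rw [h.below (u := hi) hc.ge, h.below (u := v) (by rw [← h2]; exact hc.ge), h2]
  rcases glueLeaf_cases (anc := anc) (lo := lo) (hi := hi) (j := j) u with ⟨h1, h2⟩ | ⟨h1, h2⟩ <;>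
    rcases glueLeaf_cases (anc := anc) (lo := lo) (hi := hi) (j := j) v with ⟨h3, h4⟩ | ⟨h3, h4⟩ <;>
    rw [h2, h4]
  · exact key huv h1 h3
  · exact (key huv.symm h3 h1).symm
  · exact huv

theorem root_glueLeaf_le (u : C) : (anc (σ u) 0).1 ≤ (anc u 0).1 := by
  rcases glueLeaf_cases (anc := anc) (lo := lo) (hi := hi) (j := j) u with ⟨h1, h2⟩ | ⟨h1, h2⟩ <;>
    rw [h2]
  rw [h.root_eq h1]
  rcases G.cases with hc | hc
  · rw [hc 0 (Nat.zero_le _)]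
  · rw [hc]; exact G.root_lo

theorem glueAnc_zero (u : C) : A u 0 = γ (anc (σ u) 0) := by
  rcases Nat.eq_zero_or_pos j with hj | hj
  · rw [glueAnc_ge hj.le (Nat.zero_le _)]
    rcases glueLeaf_cases (anc := anc) (lo := lo) (hi := hi) (j := j) u with ⟨h1, h2⟩ | ⟨h1, h2⟩ <;>
      rw [h2]
    rw [h.root_eq h1]
    exact G.hi_eq 0 hj.le (Nat.zero_le _)
  · exact G.glueAnc_lt hj u

theorem level_glueAnc_zero (u : C) : (A u 0).1 = (anc (σ u) 0).1 := by
  rw [G.glueAnc_zero h, G.level_γ h]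

theorem root_cases (u : C) : (anc (σ u) 0).1 = (anc u 0).1 ∨
    ((anc (σ u) 0).1 ≤ j ∧ (anc u 0).1 ≤ j) := by
  rcases glueLeaf_cases (anc := anc) (lo := lo) (hi := hi) (j := j) u with ⟨h1, h2⟩ | ⟨h1, h2⟩ <;>
    rw [h2]
  · right
    rw [h.root_eq h1]
    exact ⟨G.root_lo, G.root_hi⟩
  · exact Or.inl rfl

theorem glueAnc_ge_iff {k : ℕ} (hk : j ≤ k) (hki : k ≤ i) {u v : C} :
    A u k = A v k ↔ anc u k = anc v k ∨ ((anc u k = anc lo k ∨ anc u k = anc hi k) ∧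
      (anc v k = anc lo k ∨ anc v k = anc hi k)) := by
  have hlo := h.level_eq (G.root_lo.trans hk) hki
  have hhi := h.level_eq (G.root_hi.trans hk) hki
  have honp : ∀ u, (anc u k).1 = k → (OnPath anc lo hi j (anc u k) ↔
      (anc u k = anc lo k ∨ anc u k = anc hi k)) := by
    intro u hu
    unfold OnPath
    rw [hu]
    exact and_iff_right hk
  rw [glueAnc_ge hk hki, glueAnc_ge hk hki, G.γ_eq_iff h]
  constructor
  · rintro ⟨hl, heq | ⟨hp, hq⟩⟩
    · exact Or.inl heq
    · -- if `anc u k` is not on level `k`, then it is a root on a level above `j`, and there is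
      -- none on the two paths
      by_cases hu : (anc u k).1 = k
      · exact Or.inr ⟨(honp u hu).1 hp, (honp v (hl ▸ hu)).1 hq⟩
      · exfalso
        have h1 := h.level u k
        have h3 : (anc u k).1 = (anc u 0).1 := by omega
        have h4 : ∀ w, (anc w 0).1 ≤ j → anc u k ≠ anc w (anc u k).1 := by
          intro w hw heq
          have := h.root_eq heq
          rw [this] at h3
          omega
        rcases hp.2 with h5 | h5
        · exact h4 lo G.root_lo h5
        · exact h4 hi G.root_hi h5
  · rintro (heq | ⟨hu, hv⟩)
    · exact ⟨by rw [heq], Or.inl heq⟩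
    · have hu' : (anc u k).1 = k := by rcases hu with hu | hu <;> rw [hu] <;> assumption
      have hv' : (anc v k).1 = k := by rcases hv with hv | hv <;> rw [hv] <;> assumption
      exact ⟨hu'.trans hv'.symm, Or.inr ⟨(honp u hu').2 hu, (honp v hv').2 hv⟩⟩

theorem glueAnc_lt_iff {k : ℕ} (hk : k < j) {u v : C} :
    A u k = A v k ↔ anc (σ u) k = anc (σ v) k := by
  rw [G.glueAnc_lt hk, G.glueAnc_lt hk, G.γ_eq_iff h]
  constructor
  · rintro ⟨hl, heq | ⟨hp, hq⟩⟩
    · exact heq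
    · -- as `k < j`, a node `anc w k` on the glued paths is a root on level `j`; if it belongs to
      -- `hi`, then `glueLeaf` has replaced it by the root of `lo`
      have key : ∀ w, OnPath anc lo hi j (anc (σ w) k) → anc (σ w) k = anc lo 0 := by
        intro w hw
        have hle := G.le
        have h1 := h.level (σ w) k
        have h2 := hw.1
        have h3 : (anc (σ w) k).1 = (anc (σ w) 0).1 := by omega
        have h4 : anc (σ w) k = anc (σ w) 0 := h.below (by omega)
        rcases hw.2 with h5 | h5
        · rw [h4, h.root_eq h5]
        · have h6 := h.root_eq h5
          have h7 := G.root_hi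
          have h8 : (anc hi 0).1 = j := by rw [← h6]; rw [← h6] at h7; omega
          rcases glueLeaf_cases (anc := anc) (lo := lo) (hi := hi) (j := j) w with
            ⟨h9, h10⟩ | ⟨h9, h10⟩
          · rw [h4, h10]
          · rw [h10] at h6
            refine absurd ?_ h9
            rw [h.below (u := w) (by rw [h6, h8]), h.below (u := hi) h8.ge, h6]
      rw [key u hp, key v hq]
  · intro heq
    exact ⟨by rw [heq], Or.inl heq⟩

theorem glueAnc_of_eq {u v : C} (k : ℕ) (hι : Function.Injective ι) (huv : anc u k = anc v k) :
    A u k = A v k := by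
  by_cases hki : k ≤ i
  · by_cases hk : k < j
    · exact (G.glueAnc_lt_iff h hk).2 (G.glueLeaf_eq h hk.le huv)
    · exact (G.glueAnc_ge_iff h (by omega) hki).2 (Or.inl huv)
  · rw [h.leaf_injective hι (by omega) huv]

theorem glueAnc_congr {u v : C} (huv : f u = f v) (k : ℕ) : A u k = A v k := by
  have key : A lo k = A hi k := by
    by_cases hki : k ≤ i
    · by_cases hk : k < j
      · rw [G.glueAnc_lt_iff h hk]
        have h1 : σ hi = lo := by simp [glueLeaf]
        have h2 : σ lo = lo := by simp [glueLeaf]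
        rw [h1, h2]
      · exact (G.glueAnc_ge_iff h (by omega) hki).2 (Or.inr ⟨Or.inl rfl, Or.inr rfl⟩)
    · rw [glueAnc_gt (by omega), glueAnc_gt (by omega), G.merge]
  rcases G.collapse u v huv with rfl | ⟨rfl, rfl⟩ | ⟨rfl, rfl⟩
  · rfl
  · exact key
  · exact key.symm

theorem glueAnc_coherent (hι' : Function.Injective ι') {u v : C} {k l : ℕ} (huv : A u k = A v k)
    (hl : l ≤ k) : A u l = A v l := by
  by_cases hki : k ≤ i
  swap
  · rw [glueAnc_gt (by omega), glueAnc_gt (by omega)] at huv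
    exact G.glueAnc_congr h (by simpa [hι'.eq_iff] using huv) l
  by_cases hk : k < j
  · rw [G.glueAnc_lt_iff h hk] at huv
    rw [G.glueAnc_lt_iff h (by omega)]
    exact h.coherent huv hl
  · have hk' : j ≤ k := by omega
    rw [G.glueAnc_ge_iff h hk' hki] at huv
    by_cases hlj : j ≤ l
    · rw [G.glueAnc_ge_iff h hlj (by omega)]
      rcases huv with huv | ⟨hu, hv⟩
      · exact Or.inl (h.coherent huv hl)
      · exact Or.inr ⟨hu.imp (h.coherent · hl) (h.coherent · hl),
          hv.imp (h.coherent · hl) (h.coherent · hl)⟩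
    · have hlj : l < j := by omega
      rw [G.glueAnc_lt_iff h hlj]
      rcases huv with huv | ⟨hu, hv⟩
      · exact G.glueLeaf_eq h hlj.le (h.coherent huv hl)
      · have key : ∀ w, anc w k = anc lo k ∨ anc w k = anc hi k → anc (σ w) l = anc lo l := by
          intro w hw
          rcases glueLeaf_cases (anc := anc) (lo := lo) (hi := hi) (j := j) w with
            ⟨h9, h10⟩ | ⟨h9, h10⟩
          · rw [h10]
          · rw [h10]
            rcases hw with hw | hw
            · exact h.coherent hw hl
            · exact absurd (h.coherent hw hk') h9
        rw [key u hu, key v hv]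

theorem glueAnc_below {u : C} {k : ℕ} (hk : k ≤ (A u 0).1) : A u k = A u 0 := by
  rw [G.level_glueAnc_zero h] at hk
  have hki := hk.trans (h.root_le _)
  rcases glueLeaf_cases (anc := anc) (lo := lo) (hi := hi) (j := j) u with ⟨h1, h2⟩ | ⟨h1, h2⟩
  · by_cases hkj : k < j
    · rw [G.glueAnc_zero h, G.glueAnc_lt hkj, h.below hk]
    · have h3 := G.root_lo
      rw [h2] at hk
      have h4 : k = j := by omega
      subst h4
      rw [G.glueAnc_zero h, glueAnc_ge le_rfl hki, h1, G.hi_eq k le_rfl hki, h2, h.below hk]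
  · rw [h2] at hk
    rw [G.glueAnc_zero h, h2]
    by_cases hkj : k < j
    · rw [G.glueAnc_lt hkj, h2, h.below hk]
    · rw [glueAnc_ge (by omega) hki, h.below hk]

theorem level_glueAnc (u : C) {k : ℕ} (hk : k ≤ i) : (A u k).1 = max (A u 0).1 k := by
  rw [G.level_glueAnc_zero h]
  obtain ⟨w, hw, hw1, hw2⟩ := G.exists_glueAnc_eq (ι' := ι') u hk
  rw [hw, G.level_γ h, h.level]
  by_cases hkj : k < j
  · rw [hw1 hkj]; omega
  · rw [hw2 (by omega)]
    have := G.root_cases h u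
    omega

/-- From the level of its root on, the gluing maps the path to `u` onto the new path. -/
theorem γ_eq_glueAnc (u : C) {k : ℕ} (hk : (anc u 0).1 ≤ k) (hki : k ≤ i) :
    γ (anc u k) = A u k := by
  by_cases hkj : k < j
  · rw [G.glueAnc_lt hkj]
    rcases glueLeaf_cases (anc := anc) (lo := lo) (hi := hi) (j := j) u with ⟨h1, h2⟩ | ⟨h1, h2⟩ <;>
      rw [h2]
    rcases G.cases with hc | hc
    · rw [hc k hkj.le, h.coherent h1 hkj.le]
    · rw [h.root_eq h1] at hk
      omega
  · exact (glueAnc_ge (by omega) hki u).symm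

/-- The glued forest is described by `glueAnc`. -/
theorem isAncestry {T' : BarcodeForest β} (hι' : Function.Injective ι')
    {anc' : C' → ℕ → ℕ × Finset β} (hanc' : ∀ u, anc' (f u) = A u)
    (hnodes : ∀ x, x ∈ T'.nodes ↔ (∃ u k, x = γ (anc u k)) ∨ ∃ c, x = (i + 1, {ι' c}))
    (hedges : ∀ x y, (x, y) ∈ T'.edges ↔ (∃ u k, (anc u 0).1 ≤ k ∧ k < i ∧ x = γ (anc u k) ∧
      y = γ (anc u (k + 1))) ∨ ∃ u, x = γ (i, {ι u}) ∧ y = (i + 1, {ι' (f u)})) :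
    T'.IsAncestry (i + 1) ι' anc' := by
  have hle : ∀ u, (A u 0).1 ≤ i := fun u => by
    rw [G.level_glueAnc_zero h]; exact h.root_le _
  have hlev : ∀ u k, k ≤ i → (A u k).1 ≤ i := fun u k hk => by
    rw [G.level_glueAnc h u hk]
    have := hle u
    omega
  constructor
  · intro c k
    obtain ⟨u, rfl⟩ := G.surj c
    rw [hanc']
    by_cases hk : k ≤ i
    · rw [G.level_glueAnc h u hk, min_eq_left (by omega)]
    · have := hle u
      rw [glueAnc_gt (k := k) (by omega)]
      simp only
      omega
  · intro c
    obtain ⟨u, rfl⟩ := G.surj c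
    rw [hanc']
    exact (hle u).trans (by omega)
  · intro c k hk
    obtain ⟨u, rfl⟩ := G.surj c
    rw [hanc']
    exact glueAnc_gt (by omega) u
  · intro c c' k l hcc hl
    obtain ⟨u, rfl⟩ := G.surj c
    obtain ⟨v, rfl⟩ := G.surj c'
    rw [hanc', hanc'] at *
    exact G.glueAnc_coherent h hι' hcc hl
  · intro c k hk
    obtain ⟨u, rfl⟩ := G.surj c
    rw [hanc'] at *
    exact G.glueAnc_below h hk
  · intro c k
    obtain ⟨u, rfl⟩ := G.surj c
    rw [hanc']
    by_cases hk : k ≤ i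
    · obtain ⟨w, hw, -⟩ := G.exists_glueAnc_eq (ι' := ι') u hk
      rw [hw]
      exact G.nonempty_γ h w k
    · rw [glueAnc_gt (by omega)]
      simp
  · intro c c' k l z
    obtain ⟨u, rfl⟩ := G.surj c
    obtain ⟨v, rfl⟩ := G.surj c'
    rw [hanc', hanc']
    intro hcc hz hz'
    by_cases hk : k ≤ i <;> by_cases hl : l ≤ i
    · obtain ⟨w, hw, -⟩ := G.exists_glueAnc_eq (ι' := ι') u hk
      obtain ⟨w', hw', -⟩ := G.exists_glueAnc_eq (ι' := ι') v hl
      rw [hw] at hcc hz ⊢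
      rw [hw'] at hcc hz' ⊢
      rw [G.level_γ h, G.level_γ h] at hcc
      exact (G.γ_eq_iff h).2 ⟨hcc, G.disjoint_γ h hcc hz hz'⟩
    · have := hlev u k hk
      rw [hcc, glueAnc_gt (by omega)] at this
      simp at this
    · have := hlev v l hl
      rw [← hcc, glueAnc_gt (by omega)] at this
      simp at this
    · rw [glueAnc_gt (by omega)] at hz hz' ⊢
      rw [glueAnc_gt (by omega)]
      simp only [Finset.mem_singleton] at hz hz'
      rw [← hz, ← hz']
  · intro x
    rw [hnodes]
    constructor
    · rintro (⟨u, k, rfl⟩ | ⟨c, rfl⟩)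
      · refine ⟨f u, (anc u k).1, ?_⟩
        rw [hanc', ← G.γ_eq_glueAnc h u (h.root_le_level u _) (h.level_le u _), h.anc_level]
      · obtain ⟨u, rfl⟩ := G.surj c
        exact ⟨f u, i + 1, by rw [hanc', glueAnc_gt (by omega)]⟩
    · rintro ⟨c, k, rfl⟩
      obtain ⟨u, rfl⟩ := G.surj c
      rw [hanc']
      by_cases hk : k ≤ i
      · obtain ⟨w, hw, -⟩ := G.exists_glueAnc_eq (ι' := ι') u hk
        exact Or.inl ⟨w, k, hw⟩
      · exact Or.inr ⟨f u, glueAnc_gt (by omega) u⟩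
  · intro x y
    rw [hedges]
    constructor
    · rintro (⟨u, k, h1, h2, rfl, rfl⟩ | ⟨u, rfl, rfl⟩)
      · refine ⟨f u, k, ?_, by omega, ?_, ?_⟩
        · rw [hanc', G.level_glueAnc_zero h]
          exact (G.root_glueLeaf_le h u).trans h1
        · rw [hanc', G.γ_eq_glueAnc h u h1 h2.le]
        · rw [hanc', G.γ_eq_glueAnc h u (by omega) (by omega)]
      · refine ⟨f u, i, ?_, by omega, ?_, ?_⟩
        · rw [hanc']; exact hle u
        · rw [hanc', ← h.top u i le_rfl, glueAnc_ge G.le le_rfl]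
        · rw [hanc', glueAnc_gt (by omega)]
    · rintro ⟨c, k, h1, h2, rfl, rfl⟩
      obtain ⟨u, rfl⟩ := G.surj c
      rw [hanc', G.level_glueAnc_zero h] at h1
      rw [hanc']
      rcases Nat.lt_succ_iff_lt_or_eq.1 h2 with h2 | rfl
      · left
        by_cases hkj : k < j
        · refine ⟨σ u, k, h1, h2, G.glueAnc_lt hkj u, ?_⟩
          by_cases hkj' : k + 1 < j
          · exact G.glueAnc_lt hkj' u
          · rw [glueAnc_ge (by omega) (by omega)]
            rcases glueLeaf_cases (anc := anc) (lo := lo) (hi := hi) (j := j) u with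
              ⟨h3, h4⟩ | ⟨h3, h4⟩ <;> rw [h4]
            obtain rfl : j = k + 1 := by omega
            rw [h3, G.hi_eq _ le_rfl G.le]
        · have h3 := G.root_cases h u
          exact ⟨u, k, by omega, h2, glueAnc_ge (by omega) h2.le u, glueAnc_ge (by omega) h2 u⟩
      · refine Or.inr ⟨u, ?_, glueAnc_gt (by omega) u⟩
        rw [← h.top u k le_rfl, glueAnc_ge G.le le_rfl]

/-! ### The effect of a merge on the equivalence relations -/

/-- Equivalent leaves stay equivalent under a merge. -/
theorem forestKey_map (hι : Function.Injective ι)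
    {anc' : C' → ℕ → ℕ × Finset β} (hanc' : ∀ u, anc' (f u) = A u) (t : ℤ) (p q : Option C)
    (hpq : forestKey anc t p = forestKey anc t q) :
    forestKey anc' t (p.map f) = forestKey anc' t (q.map f) := by
  have hroot : ∀ u, (anc' (f u) 0).1 ≤ (anc u 0).1 := fun u => by
    rw [hanc', G.level_glueAnc_zero h]
    exact G.root_glueLeaf_le h u
  have hnone : ∀ u, forestKey anc t (some u) = none → forestKey anc' t (some (f u)) = none := by
    intro u hu
    rw [forestKey_some] at hu ⊢
    have := hroot u
    split_ifs at hu
    rw [if_pos (by omega)]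
  rcases p with _ | u <;> rcases q with _ | v
  · rfl
  · exact (hnone v hpq.symm).symm
  · exact hnone u hpq
  · by_cases hu : forestKey anc t (some u) = none
    · exact (hnone u hu).trans (hnone v (hpq.symm.trans hu)).symm
    · have hv : forestKey anc t (some v) ≠ none := hpq ▸ hu
      have h1 : ¬ ((anc u 0).1 : ℤ) ≤ t := fun h1 => hu (by rw [forestKey_some, if_pos h1])
      have h2 : ¬ ((anc v 0).1 : ℤ) ≤ t := fun h2 => hv (by rw [forestKey_some, if_pos h2])
      rw [forestKey_some, forestKey_some, if_neg h1, if_neg h2] at hpq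
      have h3 : anc' (f u) (-t - 1).toNat = anc' (f v) (-t - 1).toNat := by
        rw [hanc', hanc']
        exact G.glueAnc_of_eq h _ hι (Option.some_injective _ hpq)
      have h4 : anc' (f u) 0 = anc' (f v) 0 := by
        rw [hanc', hanc']
        exact G.glueAnc_of_eq h _ hι (h.root_eq (Option.some_injective _ hpq))
      simp only [Option.map_some, forestKey_some, h3, h4]

/-- A merge does not identify more than the equivalence relation that is generated by the images. -/
theorem eqvGen_of_forestKey (hι' : Function.Injective ι')
    {anc' : C' → ℕ → ℕ × Finset β} (hanc' : ∀ u, anc' (f u) = A u) (t : ℤ)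
    (p' q' : Option C') (hpq : forestKey anc' t p' = forestKey anc' t q') :
    Relation.EqvGen (fun p' q' => ∃ p q : Option C, forestKey anc t p = forestKey anc t q ∧
      p.map f = p' ∧ q.map f = q') p' q' := by
  set E := Relation.EqvGen (fun p' q' => ∃ p q : Option C, forestKey anc t p = forestKey anc t q ∧
      p.map f = p' ∧ q.map f = q') with hE
  have hgen : ∀ p q : Option C, forestKey anc t p = forestKey anc t q → E (p.map f) (q.map f) :=
    fun p q hpq => Relation.EqvGen.rel _ _ ⟨p, q, hpq, rfl, rfl⟩
  have hsome : ∀ u v, ¬ ((anc v 0).1 : ℤ) ≤ t → anc u (-t - 1).toNat = anc v (-t - 1).toNat →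
      E (some (f u)) (some (f v)) := by
    intro u v hv huv
    refine hgen (some u) (some v) ?_
    rw [forestKey_some, forestKey_some, h.root_eq huv, if_neg hv, if_neg hv, huv]
  have hlohi : some (f lo) = some (f hi) := by rw [G.merge]
  have hnone : ∀ u, ((anc' (f u) 0).1 : ℤ) ≤ t → E (some (f u)) none := by
    intro u hu
    rw [hanc', G.level_glueAnc_zero h] at hu
    have hof : ∀ w, ((anc w 0).1 : ℤ) ≤ t → E (some (f w)) none := by
      intro w hw
      refine hgen (some w) none ?_
      rw [forestKey_some, if_pos hw, forestKey_none]
    by_cases hu' : ((anc u 0).1 : ℤ) ≤ t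
    · exact hof u hu'
    · rcases glueLeaf_cases (anc := anc) (lo := lo) (hi := hi) (j := j) u with
        ⟨h3, h4⟩ | ⟨h3, h4⟩ <;> rw [h4] at hu
      · have h5 := h.root_eq h3
        refine Relation.EqvGen.trans _ (some (f hi)) _ (hsome u hi ?_ ?_) ?_
        · rw [← h5]; exact hu'
        · rw [show (-t - 1).toNat = 0 by omega]; exact h5
        · rw [← hlohi]; exact hof lo hu
      · exact absurd hu hu'
  have hboth : ∀ u v, ¬ ((anc' (f u) 0).1 : ℤ) ≤ t → ¬ ((anc' (f v) 0).1 : ℤ) ≤ t →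
      anc' (f u) (-t - 1).toNat = anc' (f v) (-t - 1).toNat → E (some (f u)) (some (f v)) := by
    intro u v hu hv huv
    rw [hanc', G.level_glueAnc_zero h] at hu hv
    rw [hanc', hanc'] at huv
    have hru := G.root_glueLeaf_le h u
    have hrv := G.root_glueLeaf_le h v
    generalize hk : (-t - 1).toNat = k at huv hsome
    by_cases hki : k ≤ i
    swap
    · rw [glueAnc_gt (by omega), glueAnc_gt (by omega)] at huv
      have : f u = f v := by simpa [hι'.eq_iff] using huv
      rw [this]
      exact Relation.EqvGen.refl _
    by_cases hkj : k < j
    · have key : ∀ w, ¬ ((anc (σ w) 0).1 : ℤ) ≤ t → E (some (f w)) (some (f (σ w))) := by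
        intro w hw
        have hrw := G.root_glueLeaf_le h w
        rcases glueLeaf_cases (anc := anc) (lo := lo) (hi := hi) (j := j) w with
          ⟨h3, h4⟩ | ⟨h3, h4⟩
        · rw [h4, hlohi]
          refine hsome w hi ?_ (h.coherent h3 hkj.le)
          rw [← h.root_eq h3]
          omega
        · rw [h4]
          exact Relation.EqvGen.refl _
      rw [G.glueAnc_lt_iff h hkj] at huv
      exact ((key u hu).trans _ _ _ (hsome _ _ hv huv)).trans _ _ _ ((key v hv).symm _ _)
    · rw [G.glueAnc_ge_iff h (by omega) hki] at huv
      rcases huv with huv | ⟨hpu, hpv⟩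
      · exact hsome u v (by omega) huv
      · have key : ∀ w, ¬ ((anc w 0).1 : ℤ) ≤ t → (anc w k = anc lo k ∨ anc w k = anc hi k) →
            E (some (f w)) (some (f lo)) := by
          rintro w hw (hw' | hw')
          · exact hsome w lo (by rw [← h.root_eq hw']; exact hw) hw'
          · rw [hlohi]
            exact hsome w hi (by rw [← h.root_eq hw']; exact hw) hw'
        exact (key u (by omega) hpu).trans _ _ _ ((key v (by omega) hpv).symm _ _)
  rcases p' with _ | c <;> rcases q' with _ | c'
  · exact Relation.EqvGen.refl _
  · obtain ⟨v, rfl⟩ := G.surj c'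
    rw [forestKey_none, forestKey_some] at hpq
    split_ifs at hpq with h1
    exact (hnone v h1).symm _ _
  · obtain ⟨u, rfl⟩ := G.surj c
    rw [forestKey_none, forestKey_some] at hpq
    split_ifs at hpq with h1
    exact hnone u h1
  · obtain ⟨u, rfl⟩ := G.surj c
    obtain ⟨v, rfl⟩ := G.surj c'
    rw [forestKey_some, forestKey_some] at hpq
    split_ifs at hpq with h1 h2 h2
    · exact (hnone u h1).trans _ _ _ ((hnone v h2).symm _ _)
    · exact hboth u v h1 h2 (Option.some_injective _ hpq)

end IsGluing

end BarcodeForest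

namespace BarcodeForest

variable {β C C' : Type*} [Fintype β] {Γ : SimpleGraph β} {level : β → ℕ} {i : ℕ} {ι : C → β}
  {ι' : C' → β} {T : BarcodeForest β} {anc : C → ℕ → ℕ × Finset β} {f : C → C'}

/-- The gluing of a merge pushes all the equivalence relations on the leaves forward. The roles of
`lo` and `hi` are fixed by the levels of their roots, while `v` and `w` are in the order in which
the algorithm finds them. -/
theorem IsAncestry.glue (h : T.IsAncestry i ι anc) (hl : IsLink Γ level i ι ι' fun u c => f u = c)
    {v w lo hi : C} {j : ℕ} (hsurj : Function.Surjective f) (hmerge : f lo = f hi)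
    (hcollapse : ∀ a b, f a = f b → a = b ∨ (a = lo ∧ b = hi) ∨ (a = hi ∧ b = lo))
    (hvw : (lo = v ∧ hi = w) ∨ (lo = w ∧ hi = v)) (hj : j ≤ i) (hlo : (anc lo 0).1 ≤ j)
    (hhi : (anc hi 0).1 ≤ j) (hcases : (∀ k ≤ j, anc lo k = anc hi k) ∨ (anc hi 0).1 = j) :
    ∃ anc' : C' → ℕ → ℕ × Finset β,
      ((T.copyLevel Γ level i).glue (i, {ι v}) (i, {ι w}) j).IsAncestry (i + 1) ι' anc' ∧
      (∀ t p q, forestKey anc t p = forestKey anc t q →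
        forestKey anc' t (p.map f) = forestKey anc' t (q.map f)) ∧
      ∀ t p' q', forestKey anc' t p' = forestKey anc' t q' → Relation.EqvGen
        (fun p' q' => ∃ p q : Option C, forestKey anc t p = forestKey anc t q ∧
          p.map f = p' ∧ q.map f = q') p' q' := by
  classical
  set γ := (T.copyLevel Γ level i).glueNode (i, {ι v}) (i, {ι w}) j with hγ
  have hP : ∀ x, ((T.copyLevel Γ level i).Anc x (i, {ι v}) ∨
      (T.copyLevel Γ level i).Anc x (i, {ι w})) ↔
      (∃ l, (anc lo 0).1 ≤ l ∧ l ≤ i ∧ x = anc lo l) ∨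
        ∃ l, (anc hi 0).1 ≤ l ∧ l ≤ i ∧ x = anc hi l := by
    intro x
    rw [h.anc_copyLevel_leaf_iff hl, h.anc_copyLevel_leaf_iff hl]
    rcases hvw with ⟨rfl, rfl⟩ | ⟨rfl, rfl⟩
    · rfl
    · exact or_comm
  have hPn : ∀ {y : ℕ × Finset β} {n}, j ≤ n → n ≤ i →
      ((y.1 = n ∧ ((T.copyLevel Γ level i).Anc y (i, {ι v}) ∨
        (T.copyLevel Γ level i).Anc y (i, {ι w}))) ↔ y = anc lo n ∨ y = anc hi n) := by
    intro y n hn hni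
    rw [hP]
    constructor
    · rintro ⟨hy, ⟨l, h1, h2, rfl⟩ | ⟨l, h1, h2, rfl⟩⟩
      · rw [h.level_eq h1 h2] at hy; rw [hy]; exact Or.inl rfl
      · rw [h.level_eq h1 h2] at hy; rw [hy]; exact Or.inr rfl
    · rintro (rfl | rfl)
      · exact ⟨h.level_eq (by omega) hni, Or.inl ⟨n, by omega, hni, rfl⟩⟩
      · exact ⟨h.level_eq (by omega) hni, Or.inr ⟨n, by omega, hni, rfl⟩⟩
  have hval : ∀ {y : ℕ × Finset β} {n}, j ≤ n → n ≤ i → (y = anc lo n ∨ y = anc hi n) →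
      γ y = (n, ((T.copyLevel Γ level i).nodes.filter fun y => y.1 = n ∧
        ((T.copyLevel Γ level i).Anc y (i, {ι v}) ∨
        (T.copyLevel Γ level i).Anc y (i, {ι w}))).biUnion Prod.snd) := by
    intro y n hn hni hy
    obtain ⟨hy1, hy2⟩ := (hPn hn hni).2 hy
    rw [hγ]
    unfold glueNode
    rw [if_pos ⟨by omega, hy2⟩, hy1]
  have hfix : ∀ x : ℕ × Finset β, ¬ (j ≤ x.1 ∧ (x = anc lo x.1 ∨ x = anc hi x.1)) → γ x = x := by
    intro x hx
    rw [hγ]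
    unfold glueNode
    rw [if_neg]
    rintro ⟨hx1, hx2⟩
    have hxi : x.1 ≤ i := by
      rcases (hP x).1 hx2 with ⟨l, -, -, rfl⟩ | ⟨l, -, -, rfl⟩ <;> exact h.level_le _ _
    exact hx ⟨hx1, (hPn hx1 hxi).1 ⟨rfl, hx2⟩⟩
  have hnew : ∀ c, γ (i + 1, {ι' c}) = (i + 1, {ι' c}) := by
    intro c
    refine hfix _ ?_
    rintro ⟨-, hx | hx⟩
    · have := h.level_le lo (i + 1)
      rw [← hx] at this
      simp at this
    · have := h.level_le hi (i + 1)
      rw [← hx] at this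
      simp at this
  have G : IsGluing i anc f lo hi j γ := by
    refine ⟨hsurj, hmerge, hcollapse, hj, hlo, hhi, hcases, ?_, ?_, fun u k => hfix _⟩
    · intro l hjl hli
      rw [hval hjl hli (Or.inl rfl)]
      refine ⟨rfl, fun z => ?_⟩
      simp only [Finset.mem_biUnion, Finset.mem_filter, hPn hjl hli]
      constructor
      · rintro ⟨y, ⟨-, rfl | rfl⟩, hz⟩
        · exact Or.inl hz
        · exact Or.inr hz
      · rintro (hz | hz)
        · exact ⟨_, ⟨(mem_copyLevel_nodes hl).2 (Or.inl (h.mem_nodes lo l)), Or.inl rfl⟩, hz⟩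
        · exact ⟨_, ⟨(mem_copyLevel_nodes hl).2 (Or.inl (h.mem_nodes hi l)), Or.inr rfl⟩, hz⟩
    · intro l hjl hli
      rw [hval hjl hli (Or.inl rfl), hval hjl hli (Or.inr rfl)]
  have hanc' : ∀ u, glueAnc i ι' anc f lo hi j γ (Function.surjInv hsurj (f u)) =
      glueAnc i ι' anc f lo hi j γ u := fun u =>
    funext fun k => G.glueAnc_congr h (Function.surjInv_eq hsurj _) k
  refine ⟨fun c => glueAnc i ι' anc f lo hi j γ (Function.surjInv hsurj c), ?_,
    G.forestKey_map h hl.inj hanc', G.eqvGen_of_forestKey h hl.inj' hanc'⟩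
  refine G.isAncestry h hl.inj' hanc' (fun x => ?_) (fun x y => ?_)
  · simp only [BarcodeForest.glue, ← hγ, Finset.mem_image, mem_copyLevel_nodes hl, h.nodes]
    constructor
    · rintro ⟨_, ⟨u, k, rfl⟩ | ⟨c, rfl⟩, rfl⟩
      · exact Or.inl ⟨u, k, rfl⟩
      · exact Or.inr ⟨c, hnew c⟩
    · rintro (⟨u, k, rfl⟩ | ⟨c, rfl⟩)
      · exact ⟨_, Or.inl ⟨u, k, rfl⟩, rfl⟩
      · exact ⟨_, Or.inr ⟨c, rfl⟩, hnew c⟩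
  · simp only [BarcodeForest.glue, ← hγ, Finset.mem_image, Prod.exists, Prod.mk.injEq]
    constructor
    · rintro ⟨a, s, b, s', hmem, rfl, rfl⟩
      rcases (mem_copyLevel_edges hl).1 hmem with hmem | ⟨u, c, rfl, hx, hy⟩
      · obtain ⟨u, k, h1, h2, hx, hy⟩ := h.edges.1 hmem
        exact Or.inl ⟨u, k, h1, h2, congrArg γ hx, congrArg γ hy⟩
      · exact Or.inr ⟨u, congrArg γ hx, by rw [hy, hnew]⟩
    · rintro (⟨u, k, h1, h2, rfl, rfl⟩ | ⟨u, rfl, rfl⟩)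
      · exact ⟨_, _, _, _, (mem_copyLevel_edges hl).2
          (Or.inl (h.edges.2 ⟨u, k, h1, h2, rfl, rfl⟩)), rfl, rfl⟩
      · exact ⟨_, _, _, _, (mem_copyLevel_edges hl).2 (Or.inr ⟨u, _, rfl, rfl, rfl⟩), rfl, hnew _⟩

/-- Correctness of the treatment of a merge: the birth in the output is the absolute value of the
first step `T₀` of the filtration at which the two merging leaves are equivalent. -/
theorem IsAncestry.step_merge (h : T.IsAncestry i ι anc)
    (hl : IsLink Γ level i ι ι' fun u c => f u = c) (hsurj : Function.Surjective f) {u₁ u₂ : C}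
    (hne : u₁ ≠ u₂) (hmerge : f u₁ = f u₂)
    (hcollapse : ∀ a b, f a = f b → a = b ∨ (a = u₁ ∧ b = u₂) ∨ (a = u₂ ∧ b = u₁)) :
    ∃ anc' : C' → ℕ → ℕ × Finset β,
      (step Γ level i T).1.IsAncestry (i + 1) ι' anc' ∧
      (∀ t p q, forestKey anc t p = forestKey anc t q →
        forestKey anc' t (p.map f) = forestKey anc' t (q.map f)) ∧
      (∀ t p' q', forestKey anc' t p' = forestKey anc' t q' → Relation.EqvGen
        (fun p' q' => ∃ p q : Option C, forestKey anc t p = forestKey anc t q ∧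
          p.map f = p' ∧ q.map f = q') p' q') ∧
      ∃ T₀ : ℤ, (step Γ level i T).2 = {(T₀.natAbs, i)} ∧
        ∀ t, T₀ ≤ t ↔ forestKey anc t (some u₁) = forestKey anc t (some u₂) := by
  classical
  have hdep : ¬ ∃ x, (T.copyLevel Γ level i).IsDeparting i x := by
    rintro ⟨x, hx⟩
    obtain ⟨u, -, hu⟩ := (h.isDeparting_iff hl).1 hx
    exact hu _ rfl
  have hmer : ∃ x, (T.copyLevel Γ level i).IsMerging i x :=
    ⟨_, (h.isMerging_iff hl).2 ⟨u₁, u₂, _, hne, rfl, hmerge.symm, rfl⟩⟩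
  obtain ⟨v, w, c, hvw, hv, hw, hchoose⟩ := (h.isMerging_iff hl).1 hmer.choose_spec
  have hfvw : f v = f w := hv.trans hw.symm
  have hstep : step Γ level i T =
      ((merge T (T.copyLevel Γ level i) i (i, {ι v}) (i, {ι w})).1,
        {(merge T (T.copyLevel Γ level i) i (i, {ι v}) (i, {ι w})).2}) := by
    unfold step
    simp only [dif_neg hdep, dif_pos hmer, hchoose]
  have hcoll : ∀ a b, f a = f b → a = b ∨ (a = v ∧ b = w) ∨ (a = w ∧ b = v) := by
    rcases hcollapse v w hfvw with h1 | ⟨rfl, rfl⟩ | ⟨rfl, rfl⟩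
    · exact absurd h1 hvw
    · exact hcollapse
    · exact fun a b hab => (hcollapse a b hab).imp_right Or.symm
  have hsymm : ∀ t, forestKey anc t (some u₁) = forestKey anc t (some u₂) ↔
      forestKey anc t (some v) = forestKey anc t (some w) := by
    rcases hcollapse v w hfvw with h1 | ⟨rfl, rfl⟩ | ⟨rfl, rfl⟩
    · exact absurd h1 hvw
    · exact fun t => Iff.rfl
    · exact fun t => eq_comm
  simp only [hsymm]
  rw [hstep]
  by_cases hst : anc v 0 = anc w 0
  · -- `j` is the level of the highest common ancestor
    set S : ℕ → Prop := fun l => anc v l = anc w l with hS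
    set j := Nat.findGreatest S i with hj
    have hSj : S j := Nat.findGreatest_spec (P := S) (Nat.zero_le i) hst
    have hji : j ≤ i := Nat.findGreatest_le i
    have hSle : ∀ l, S l ↔ l ≤ j := by
      intro l
      constructor
      · intro hSl
        have hli : l ≤ i := by
          by_contra hli
          exact hvw (h.leaf_injective hl.inj (by omega) hSl)
        exact Nat.le_findGreatest hli hSl
      · exact fun hlj => h.coherent hSj hlj
    have hrj : (anc v 0).1 ≤ j := by
      refine (hSle _).1 ?_
      simp only [hS]
      rw [h.below le_rfl, h.below (u := w) (by rw [hst]), hst]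
    have hrj' : (anc w 0).1 ≤ j := hst ▸ hrj
    have htop : T.topLevel (fun x => T.Anc x (i, {ι v}) ∧ T.Anc x (i, {ι w})) = j := by
      rw [topLevel_eq (x := anc v j) (h.mem_nodes v j), h.level_eq hrj hji]
      · exact ⟨h.anc_leaf_iff.2 ⟨j, hrj, hji, rfl⟩, h.anc_leaf_iff.2 ⟨j, hrj', hji, hSj⟩⟩
      · rintro y - ⟨hy, hy'⟩
        obtain ⟨l, hl1, hl2, rfl⟩ := h.anc_leaf_iff.1 hy
        obtain ⟨l', hl1', hl2', hll⟩ := h.anc_leaf_iff.1 hy'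
        have hll' : l = l' := by
          rw [← h.level_eq hl1 hl2, hll, h.level_eq hl1' hl2']
        subst hll'
        rw [h.level_eq hrj hji, h.level_eq hl1 hl2]
        exact (hSle l).1 hll
    obtain ⟨anc', h1, h2, h3⟩ := h.glue hl (v := v) (w := w) hsurj hfvw hcoll (Or.inl ⟨rfl, rfl⟩)
      hji hrj hrj' (Or.inl fun k hk => (hSle k).2 hk)
    unfold merge
    rw [if_pos (h.sameTree_iff.2 hst)]
    simp only [htop]
    refine ⟨anc', h1, h2, h3, -((j + 1 : ℕ) : ℤ), by rw [Int.natAbs_neg, Int.natAbs_natCast],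
      fun t => ?_⟩
    rw [forestKey_some, forestKey_some, hst]
    split_ifs with h0
    · simp only [iff_true]; omega
    · rw [Option.some_inj]
      have := hSle (-t - 1).toNat
      simp only [hS] at this
      rw [this]
      omega
  · have hglue : ∃ anc' : C' → ℕ → ℕ × Finset β, ((T.copyLevel Γ level i).glue (i, {ι v}) (i, {ι w})
          (max (anc v 0).1 (anc w 0).1)).IsAncestry (i + 1) ι' anc' ∧
        (∀ t p q, forestKey anc t p = forestKey anc t q →
          forestKey anc' t (p.map f) = forestKey anc' t (q.map f)) ∧
        (∀ t p' q', forestKey anc' t p' = forestKey anc' t q' → Relation.EqvGen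
          (fun p' q' => ∃ p q : Option C, forestKey anc t p = forestKey anc t q ∧
            p.map f = p' ∧ q.map f = q') p' q') := by
      have h1 := h.root_le v
      have h2 := h.root_le w
      rcases le_total (anc v 0).1 (anc w 0).1 with hle | hle
      · exact h.glue hl hsurj hfvw hcoll (Or.inl ⟨rfl, rfl⟩) (by omega) (by omega) (by omega)
          (Or.inr (by omega))
      · exact h.glue hl hsurj hfvw.symm (fun a b hab => (hcoll a b hab).imp_right Or.symm)
          (Or.inr ⟨rfl, rfl⟩) (by omega) (by omega) (by omega) (Or.inr (by omega))
    obtain ⟨anc', h1, h2, h3⟩ := hglue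
    unfold merge
    rw [if_neg (fun hs => hst (h.sameTree_iff.1 hs)), h.rootLevel_eq, h.rootLevel_eq]
    refine ⟨anc', h1, h2, h3, ((max (anc v 0).1 (anc w 0).1 : ℕ) : ℤ),
      by rw [Int.natAbs_natCast], fun t => ?_⟩
    rw [forestKey_some, forestKey_some]
    split_ifs with h4 h5 h5
    · simp only [iff_true]; omega
    · simp only [iff_false]; omega
    · simp only [iff_false]; omega
    · rw [Option.some_inj]
      refine ⟨fun _ => by omega, fun heq => absurd (h.root_eq heq) hst⟩

end BarcodeForest

/-! ### Homology in degree zero has the connected components as a basis -/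

namespace GraphHomology

variable {W W' : Type*}

theorem single_add_single_mem_range_boundary (K : SimpleGraph W) {u v : W} (h : K.Reachable u v) :
    (Finsupp.single u 1 + Finsupp.single v 1 : W →₀ ZMod 2) ∈ LinearMap.range (boundary K) := by
  obtain ⟨p⟩ := h
  induction p with
  | nil =>
    rw [ZModModule.add_self]
    exact Submodule.zero_mem _
  | @cons u v w huv _ ih =>
    have h1 : (Finsupp.single u 1 + Finsupp.single v 1 : W →₀ ZMod 2) ∈
        LinearMap.range (boundary K) := by
      refine ⟨Finsupp.single ⟨s(u, v), huv⟩ 1, ?_⟩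
      rw [boundary, Finsupp.linearCombination_single, one_smul]
      rfl
    have h2 := Submodule.add_mem _ h1 ih
    have h3 : (Finsupp.single u 1 + Finsupp.single w 1 : W →₀ ZMod 2) =
        (Finsupp.single u 1 + Finsupp.single v 1) + (Finsupp.single v 1 + Finsupp.single w 1) -
          (Finsupp.single v 1 + Finsupp.single v 1) := by abel
    rw [h3, ZModModule.add_self, sub_zero]
    exact h2

/-- The linear map from 0-chains that sends a vertex to its connected component. -/
noncomputable def toComponents (K : SimpleGraph W) :
    (W →₀ ZMod 2) →ₗ[ZMod 2] (K.ConnectedComponent →₀ ZMod 2) :=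
  Finsupp.lmapDomain (ZMod 2) (ZMod 2) K.connectedComponentMk

theorem toComponents_single (K : SimpleGraph W) (u : W) (a : ZMod 2) :
    toComponents K (Finsupp.single u a) = Finsupp.single (K.connectedComponentMk u) a := by
  simp [toComponents, Finsupp.mapDomain_single]

theorem toComponents_surjective (K : SimpleGraph W) : Function.Surjective (toComponents K) :=
  Finsupp.mapDomain_surjective Quot.mk_surjective

/-- Two vertices are homologous if and only if they are in the same component. -/
theorem ker_toComponents (K : SimpleGraph W) :
    LinearMap.ker (toComponents K) = LinearMap.range (boundary K) := by
  apply le_antisymm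
  · intro y hy
    set ρ : K.ConnectedComponent → W := fun c => c.out with hρ
    -- moving every vertex to the chosen one in its component changes a chain by a boundary
    have key : ∀ y : W →₀ ZMod 2, y - Finsupp.lmapDomain (ZMod 2) (ZMod 2) ρ (toComponents K y) ∈
        LinearMap.range (boundary K) := by
      intro y
      induction y using Finsupp.induction_linear with
      | zero => simp
      | add y z hy hz =>
        rw [map_add, map_add, add_sub_add_comm]
        exact Submodule.add_mem _ hy hz
      | single u a =>
        rw [toComponents_single, Finsupp.lmapDomain_apply, Finsupp.mapDomain_single,
          ZModModule.sub_eq_add]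
        have h1 : (Finsupp.single u a + Finsupp.single (ρ (K.connectedComponentMk u)) a :
            W →₀ ZMod 2) = a • (Finsupp.single u 1 +
              Finsupp.single (ρ (K.connectedComponentMk u)) 1) := by
          simp
        rw [h1]
        refine Submodule.smul_mem _ _ (single_add_single_mem_range_boundary K ?_)
        exact SimpleGraph.ConnectedComponent.exact (Quot.out_eq (K.connectedComponentMk u)).symm
    have h1 := key y
    rw [LinearMap.mem_ker.1 hy, map_zero, sub_zero] at h1
    exact h1
  · rintro _ ⟨c, rfl⟩
    rw [LinearMap.mem_ker]
    induction c using Finsupp.induction_linear with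
    | zero => simp
    | add y z hy hz => rw [map_add, map_add, hy, hz, add_zero]
    | single e a =>
      rw [boundary, Finsupp.linearCombination_single, map_smul]
      obtain ⟨e, he⟩ := e
      induction e using Sym2.ind with
      | _ u v =>
        have h1 : K.connectedComponentMk u = K.connectedComponentMk v :=
          SimpleGraph.ConnectedComponent.sound (SimpleGraph.Adj.reachable he)
        have h2 : (edgeBoundary s(u, v) : W →₀ ZMod 2) =
          Finsupp.single u 1 + Finsupp.single v 1 := rfl
        rw [h2, map_add, toComponents_single, toComponents_single, h1, ZModModule.add_self,
          smul_zero]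

/-- The basis of the 0-th homology of a graph that consists of its connected components. -/
noncomputable def componentBasis (K : SimpleGraph W) :
    Module.Basis K.ConnectedComponent (ZMod 2) (H0 K) :=
  Module.Basis.ofRepr ((Submodule.quotEquivOfEq _ _ (ker_toComponents K).symm).trans
    ((toComponents K).quotKerEquivOfSurjective (toComponents_surjective K)))

theorem componentBasis_mk (K : SimpleGraph W) (u : W) :
    componentBasis K (K.connectedComponentMk u) = Submodule.Quotient.mk (Finsupp.single u 1) := by
  rw [componentBasis, Module.Basis.coe_ofRepr, LinearEquiv.symm_apply_eq]
  simp only [LinearEquiv.trans_apply, Submodule.quotEquivOfEq_mk]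
  rw [← toComponents_single]
  rfl

theorem H0map_componentBasis {K : SimpleGraph W} {K' : SimpleGraph W'} (f : K →g K')
    (c : K.ConnectedComponent) : H0map f (componentBasis K c) = componentBasis K' (c.map f) := by
  induction c using SimpleGraph.ConnectedComponent.ind with
  | _ u =>
    rw [SimpleGraph.ConnectedComponent.map_mk, componentBasis_mk, componentBasis_mk, H0map,
      Submodule.mapQ_apply, Finsupp.lmapDomain_apply, Finsupp.mapDomain_single]

end GraphHomology

/-! ### Adding a simplex to a graph -/

/-- The maps of sets of components that arise from adding a simplex: one component may be new, or
two components may become one. -/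
def IsElementary {C C' : Type*} (f : C → C') : Prop :=
  (Function.Injective f ∧ ∀ c c', c ∉ Set.range f → c' ∉ Set.range f → c = c') ∨
  (Function.Surjective f ∧ ∃ u₁ u₂, u₁ ≠ u₂ ∧ f u₁ = f u₂ ∧
    ∀ a b, f a = f b → a = b ∨ (a = u₁ ∧ b = u₂) ∨ (a = u₂ ∧ b = u₁))

namespace AddsSimplex

variable {V : Type*} {G : SimpleGraph V} {K K' : G.Subgraph}

theorem not_ge (h : AddsSimplex K K') : ¬ K' ≤ K := by
  intro hle
  rcases h with ⟨v, hv, h1, -⟩ | ⟨e, he, -, h2⟩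
  · exact hv (hle.1 (h1 ▸ Set.mem_insert v _))
  · exact he (SimpleGraph.Subgraph.edgeSet_mono hle (h2 ▸ Set.mem_insert e _))

/-- A new vertex is a new component. A new edge joins two components, unless both of its ends are in
the same one. -/
theorem isElementary (h : AddsSimplex K K') : IsElementary
    (fun c : K.coe.ConnectedComponent => c.map (SimpleGraph.Subgraph.inclusion h.le)) := by
  have hle := h.le
  rcases h with ⟨v, hv, h1, h2⟩ | ⟨e, he, h1, h2⟩
  · left
    have hadj : ∀ {a b}, K'.Adj a b → K.Adj a b := by
      intro a b hab
      rw [← SimpleGraph.Subgraph.mem_edgeSet] at hab ⊢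
      rwa [h2] at hab
    have key : ∀ a b : K'.verts, K'.coe.Reachable a b → a = b ∨
        ∃ (ha : a.1 ∈ K.verts) (hb : b.1 ∈ K.verts), K.coe.Reachable ⟨a, ha⟩ ⟨b, hb⟩ := by
      rintro a b ⟨p⟩
      induction p with
      | nil => exact Or.inl rfl
      | @cons a b c hab _ ih =>
        right
        have hab' : K.Adj a b := hadj hab
        have hr : K.coe.Reachable ⟨a, hab'.fst_mem⟩ ⟨b, hab'.snd_mem⟩ :=
          SimpleGraph.Adj.reachable hab'
        rcases ih with rfl | ⟨hb, hc, hbc⟩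
        · exact ⟨hab'.fst_mem, hab'.snd_mem, hr⟩
        · exact ⟨hab'.fst_mem, hc, hr.trans hbc⟩
    constructor
    · intro c c' hcc
      induction c using SimpleGraph.ConnectedComponent.ind with
      | _ a =>
      induction c' using SimpleGraph.ConnectedComponent.ind with
      | _ b =>
      have hr := SimpleGraph.ConnectedComponent.exact hcc
      rcases key _ _ hr with heq | ⟨_, _, hr'⟩
      · have h3 := congrArg Subtype.val heq
        have : a = b := Subtype.ext h3
        rw [this]
      · exact SimpleGraph.ConnectedComponent.sound hr'
    · have hv' : ∀ c : K'.coe.ConnectedComponent,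
          c ∉ Set.range (fun c : K.coe.ConnectedComponent =>
            c.map (SimpleGraph.Subgraph.inclusion hle)) →
          c = K'.coe.connectedComponentMk ⟨v, h1 ▸ Set.mem_insert v _⟩ := by
        intro c hc
        induction c using SimpleGraph.ConnectedComponent.ind with
        | _ a =>
        obtain ⟨a, ha⟩ := a
        rw [h1] at ha
        rcases ha with rfl | ha
        · rfl
        · exact absurd ⟨K.coe.connectedComponentMk ⟨a, ha⟩, rfl⟩ hc
      exact fun c c' hc hc' => (hv' c hc).trans (hv' c' hc').symm
  · induction e using Sym2.ind with
    | _ x y =>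
    have hxy : K'.Adj x y := by
      rw [← SimpleGraph.Subgraph.mem_edgeSet, h2]; exact Set.mem_insert _ _
    have hx : x ∈ K.verts := h1 ▸ hxy.fst_mem
    have hy : y ∈ K.verts := h1 ▸ hxy.snd_mem
    set u₁ := K.coe.connectedComponentMk ⟨x, hx⟩ with hu₁
    set u₂ := K.coe.connectedComponentMk ⟨y, hy⟩ with hu₂
    have hmem : ∀ a : K'.verts, a.1 ∈ K.verts := fun a => h1 ▸ a.2
    have key : ∀ a b : K'.verts, K'.coe.Reachable a b →
        K.coe.connectedComponentMk ⟨a, hmem a⟩ = K.coe.connectedComponentMk ⟨b, hmem b⟩ ∨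
        (K.coe.connectedComponentMk ⟨a, hmem a⟩ = u₁ ∧
          K.coe.connectedComponentMk ⟨b, hmem b⟩ = u₂) ∨
        (K.coe.connectedComponentMk ⟨a, hmem a⟩ = u₂ ∧
          K.coe.connectedComponentMk ⟨b, hmem b⟩ = u₁) := by
      rintro a b ⟨p⟩
      induction p with
      | nil => exact Or.inl rfl
      | @cons a b c hab _ ih =>
        have hab' : s(a.1, b.1) ∈ K'.edgeSet := hab
        rw [h2] at hab'
        rcases hab' with hab' | hab'
        · rcases Sym2.eq_iff.1 hab' with ⟨hax, hby⟩ | ⟨hay, hbx⟩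
          · have ha : K.coe.connectedComponentMk ⟨a, hmem a⟩ = u₁ := by
              simp only [hu₁, hax]
            have hb : K.coe.connectedComponentMk ⟨b, hmem b⟩ = u₂ := by
              simp only [hu₂, hby]
            rw [ha]
            rw [hb] at ih
            rcases ih with ih | ⟨ih, ih'⟩ | ⟨ih, ih'⟩
            · exact Or.inr (Or.inl ⟨rfl, ih.symm⟩)
            · exact Or.inr (Or.inl ⟨rfl, ih'⟩)
            · exact Or.inl ih'.symm
          · have ha : K.coe.connectedComponentMk ⟨a, hmem a⟩ = u₂ := by
              simp only [hu₂, hay]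
            have hb : K.coe.connectedComponentMk ⟨b, hmem b⟩ = u₁ := by
              simp only [hu₁, hbx]
            rw [ha]
            rw [hb] at ih
            rcases ih with ih | ⟨ih, ih'⟩ | ⟨ih, ih'⟩
            · exact Or.inr (Or.inr ⟨rfl, ih.symm⟩)
            · exact Or.inl ih'.symm
            · exact Or.inr (Or.inr ⟨rfl, ih'⟩)
        · have hr : K.coe.connectedComponentMk ⟨a, hmem a⟩ =
              K.coe.connectedComponentMk ⟨b, hmem b⟩ :=
            SimpleGraph.ConnectedComponent.sound (SimpleGraph.Adj.reachable
              (G := K.coe) (u := ⟨a, hmem a⟩) (v := ⟨b, hmem b⟩) hab')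
          rw [hr]
          exact ih
    have hcoll : ∀ c c' : K.coe.ConnectedComponent,
        c.map (SimpleGraph.Subgraph.inclusion hle) = c'.map (SimpleGraph.Subgraph.inclusion hle) →
        c = c' ∨ (c = u₁ ∧ c' = u₂) ∨ (c = u₂ ∧ c' = u₁) := by
      intro c c' hcc
      induction c using SimpleGraph.ConnectedComponent.ind with
      | _ a =>
      induction c' using SimpleGraph.ConnectedComponent.ind with
      | _ b => exact key _ _ (SimpleGraph.ConnectedComponent.exact hcc)
    have hsurj : Function.Surjective (fun c : K.coe.ConnectedComponent =>
        c.map (SimpleGraph.Subgraph.inclusion hle)) := by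
      intro c
      induction c using SimpleGraph.ConnectedComponent.ind with
      | _ a => exact ⟨K.coe.connectedComponentMk ⟨a, hmem a⟩, rfl⟩
    by_cases hne : u₁ = u₂
    · left
      refine ⟨fun c c' hcc => ?_, fun c _ hc => absurd (hsurj c) hc⟩
      rcases hcoll c c' hcc with h | ⟨h, h'⟩ | ⟨h, h'⟩
      · exact h
      · rw [h, h', hne]
      · rw [h, h', hne]
    · right
      refine ⟨hsurj, u₁, u₂, hne, ?_, hcoll⟩
      exact SimpleGraph.ConnectedComponent.sound (SimpleGraph.Adj.reachable
        (G := K'.coe) (u := ⟨x, hle.1 hx⟩) (v := ⟨y, hle.1 hy⟩) hxy)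

end AddsSimplex

/-! ### Linear maps induced by elementary maps of bases -/

section Elementary

variable {C C' E E' : Type*} [AddCommGroup E] [Module (ZMod 2) E] [AddCommGroup E']
  [Module (ZMod 2) E'] {e : Module.Basis C (ZMod 2) E} {e' : Module.Basis C' (ZMod 2) E'}
  {φ : E →ₗ[ZMod 2] E'} {f : C → C'}

theorem ker_eq_keySpan (hφ : ∀ c, φ (e c) = e' (f c)) :
    LinearMap.ker φ = keySpan e (Option.map f) := by
  rw [keySpan_eq_comap (κ := fun p : Option C' => p) hφ (fun _ _ => Iff.rfl),
    keySpan_eq_bot e' (κ := fun p : Option C' => p) fun _ _ h => h]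
  rfl

theorem injective_of_basis (hφ : ∀ c, φ (e c) = e' (f c)) (hf : Function.Injective f) :
    Function.Injective φ := by
  rw [← LinearMap.ker_eq_bot, ker_eq_keySpan hφ]
  exact keySpan_eq_bot e (Option.map_injective hf)

theorem range_eq_top_of_basis (hφ : ∀ c, φ (e c) = e' (f c)) (hf : Function.Surjective f) :
    LinearMap.range φ = ⊤ := by
  rw [← top_le_iff, ← e'.span_eq, Submodule.span_le]
  rintro _ ⟨c, rfl⟩
  obtain ⟨u, rfl⟩ := hf c
  exact ⟨e u, hφ u⟩

theorem ker_le_of_collapse (hφ : ∀ c, φ (e c) = e' (f c)) {u₁ u₂ : C}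
    (hf : ∀ a b, f a = f b → a = b ∨ (a = u₁ ∧ b = u₂) ∨ (a = u₂ ∧ b = u₁)) :
    LinearMap.ker φ ≤ Submodule.span (ZMod 2) {e u₁ + e u₂} := by
  rw [ker_eq_keySpan hφ]
  refine keySpan_le fun p q hpq => ?_
  rcases p with _ | a <;> rcases q with _ | b
  · simp [pointed]
  · simp at hpq
  · simp at hpq
  · simp only [pointed]
    rcases hf a b (by simpa using hpq) with rfl | ⟨rfl, rfl⟩ | ⟨rfl, rfl⟩
    · rw [ZModModule.add_self]; exact Submodule.zero_mem _
    · exact Submodule.mem_span_singleton_self _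
    · rw [add_comm]; exact Submodule.mem_span_singleton_self _

theorem top_le_of_missing (hφ : ∀ c, φ (e c) = e' (f c)) {v : C'}
    (hf : ∀ c, c ∉ Set.range f → c = v) :
    ⊤ ≤ LinearMap.range φ ⊔ Submodule.span (ZMod 2) {e' v} := by
  rw [← e'.span_eq, Submodule.span_le]
  rintro _ ⟨c, rfl⟩
  by_cases hc : c ∈ Set.range f
  · obtain ⟨u, rfl⟩ := hc
    exact Submodule.mem_sup_left ⟨e u, hφ u⟩
  · rw [hf c hc]
    exact Submodule.mem_sup_right (Submodule.mem_span_singleton_self _)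

theorem basis_notMem_range (hφ : ∀ c, φ (e c) = e' (f c)) {v : C'} (hv : v ∉ Set.range f) :
    e' v ∉ LinearMap.range φ := by
  have hle : LinearMap.range φ ≤ LinearMap.ker (e'.coord v) := by
    rw [LinearMap.range_eq_map, ← e.span_eq, Submodule.map_span, Submodule.span_le]
    rintro _ ⟨_, ⟨c, rfl⟩, rfl⟩
    change e'.coord v (φ (e c)) = 0
    rw [hφ, Module.Basis.coord_apply, Module.Basis.repr_self]
    exact Finsupp.single_eq_of_ne (fun h => hv ⟨c, h.symm⟩)
  intro hmem
  have := hle hmem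
  rw [LinearMap.mem_ker, Module.Basis.coord_apply, Module.Basis.repr_self,
    Finsupp.single_eq_same] at this
  exact one_ne_zero this

theorem IsElementary.exists_ker_le (hf : IsElementary f) (hφ : ∀ c, φ (e c) = e' (f c)) :
    ∃ z, LinearMap.ker φ ≤ Submodule.span (ZMod 2) {z} := by
  rcases hf with ⟨hinj, -⟩ | ⟨-, u₁, u₂, -, -, hcoll⟩
  · refine ⟨0, ?_⟩
    rw [LinearMap.ker_eq_bot.2 (injective_of_basis hφ hinj)]
    exact bot_le
  · exact ⟨_, ker_le_of_collapse hφ hcoll⟩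

theorem IsElementary.exists_top_le (hf : IsElementary f) (hφ : ∀ c, φ (e c) = e' (f c)) :
    ∃ v, ⊤ ≤ LinearMap.range φ ⊔ Submodule.span (ZMod 2) {v} := by
  by_cases hsurj : Function.Surjective f
  · exact ⟨0, by rw [range_eq_top_of_basis hφ hsurj]; exact le_sup_left⟩
  · rcases hf with ⟨-, hmiss⟩ | ⟨hs, -⟩
    · have : ∃ v, v ∉ Set.range f := by
        by_contra hn
        push Not at hn
        exact hsurj hn
      obtain ⟨v, hv⟩ := this
      exact ⟨_, top_le_of_missing hφ fun c hc => hmiss c v hc hv⟩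
    · exact absurd hs hsurj

end Elementary

/-! ### The invariant of the algorithm -/

namespace BarcodeForest

theorem IsAncestry.forestKey_injective {β C : Type*} {T : BarcodeForest β} {i : ℕ} {ι : C → β}
    {anc : C → ℕ → ℕ × Finset β} (h : T.IsAncestry i ι anc) (hι : Function.Injective ι) {t : ℤ}
    (ht : t < -(i : ℤ)) : Function.Injective (forestKey anc t) := by
  intro p q hpq
  have hneg : ∀ u, ¬ ((anc u 0).1 : ℤ) ≤ t := fun u => by omega
  rcases p with _ | u <;> rcases q with _ | v
  · rfl
  · simp [forestKey, hneg] at hpq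
  · simp [forestKey, hneg] at hpq
  · rw [forestKey_some, forestKey_some, if_neg (hneg u), if_neg (hneg v)] at hpq
    rw [h.leaf_injective hι (by omega) (Option.some_injective _ hpq)]

theorem IsAncestry.forestKey_eq_none {β C : Type*} {T : BarcodeForest β} {i : ℕ} {ι : C → β}
    {anc : C → ℕ → ℕ × Finset β} (h : T.IsAncestry i ι anc) {t : ℤ} (ht : (i : ℤ) ≤ t)
    (p : Option C) : forestKey anc t p = none := by
  rcases p with _ | u
  · rfl
  · have := h.root_le u
    rw [forestKey_some, if_pos (by omega)]

end BarcodeForest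

namespace ZigzagModule

open BarcodeForest

variable {m : ℕ} {M : ZigzagModule m} {ι₀ : Type*} {b d : ι₀ → ℕ} {x : ι₀ → ∀ i, M.space i}
  {β : Type*}

namespace BarFamily

/-- The filtration of the `i`-th space by births is the one given by the forest `T`. -/
def IsDescribedBy (h : M.BarFamily m b d x) (i : Fin (m + 1)) {C : Type*}
    (e : Module.Basis C (ZMod 2) (M.space i)) (ι : C → β) (T : BarcodeForest β) : Prop :=
  ∃ anc, T.IsAncestry i.val ι anc ∧ ∀ t, h.filt i t = keySpan e (forestKey anc t)

/-- Only steps between `-i` and `i` have to be checked, as the filtration is trivial outside. -/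
theorem isDescribedBy_of (h : M.BarFamily m b d x) {i : Fin (m + 1)} {C : Type*}
    {e : Module.Basis C (ZMod 2) (M.space i)} {ι : C → β} (hι : Function.Injective ι)
    {T : BarcodeForest β} {anc : C → ℕ → ℕ × Finset β} (hT : T.IsAncestry i.val ι anc)
    (hmid : ∀ t : ℤ, -(i.val : ℤ) ≤ t → t < i.val → h.filt i t = keySpan e (forestKey anc t)) :
    h.IsDescribedBy i e ι T := by
  refine ⟨anc, hT, fun t => ?_⟩
  by_cases h1 : t < -(i.val : ℤ)
  · rw [h.filt_eq_bot i h1, keySpan_eq_bot e (hT.forestKey_injective hι h1)]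
  by_cases h2 : t < i.val
  · exact hmid t (not_lt.1 h1) h2
  · have h3 := not_lt.1 h2
    rw [h.filt_eq_top i h3, keySpan_eq_top e fun p q => by
      rw [hT.forestKey_eq_none h3, hT.forestKey_eq_none h3]]

section Step

variable [Fintype ι₀] {Γ : SimpleGraph β} {level : β → ℕ} {i : Fin m} {C C' : Type*}
  {e : Module.Basis C (ZMod 2) (M.space i.castSucc)}
  {e' : Module.Basis C' (ZMod 2) (M.space i.succ)} {ι : C → β} {ι' : C' → β}
  {T : BarcodeForest β}

open Classical in
theorem map_filter_eq_zero {k : ℕ} (hd : ∀ a, d a ≠ k) :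
    ((Finset.univ.filter fun a => d a = k).val.map fun a => (b a, d a)) = 0 := by
  rw [Finset.filter_false_of_mem fun a _ => hd a]
  rfl

open Classical in
theorem map_filter_eq_singleton {k : ℕ} {a₀ : ι₀} (hd : ∀ a, d a = k ↔ a = a₀) {T₀ : ℤ}
    (hT : ∀ t, M.birthKey (b a₀) ≤ t ↔ T₀ ≤ t) :
    ((Finset.univ.filter fun a => d a = k).val.map fun a => (b a, d a)) = {(T₀.natAbs, k)} := by
  have h1 : M.birthKey (b a₀) = T₀ := le_antisymm ((hT _).2 le_rfl) ((hT _).1 le_rfl)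
  have h2 : (Finset.univ.filter fun a => d a = k) = {a₀} := by
    ext a
    simp [hd]
  rw [h2, ← h1, M.natAbs_birthKey, Finset.singleton_val, Multiset.map_singleton, (hd a₀).2 rfl]

open Classical in
/-- An entrance, or an edge within a component. -/
theorem step_of_injective_forward [Fintype β] (h : M.BarFamily m b d x) {f}
    (hf : M.map i = Sum.inl f)
    {π : C → C'} (hπ : Function.Injective π) (he : ∀ c, f (e c) = e' (π c))
    (hl : IsLink Γ level i.val ι ι' fun u c => π u = c)
    (hT : h.IsDescribedBy i.castSucc e ι T) :
    h.IsDescribedBy i.succ e' ι' (step Γ level i.val T).1 ∧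
      (step Γ level i.val T).2 =
        (Finset.univ.filter fun a => d a = i.val).val.map fun a => (b a, d a) := by
  obtain ⟨anc, hanc, hfilt⟩ := hT
  replace hanc : T.IsAncestry i.val ι anc := hanc
  obtain ⟨g, hg⟩ : ∃ g : C' → Option C, ∀ c u, g c = some u ↔ π u = c :=
    ⟨Function.partialInv π, fun c u => hπ.isPartialInv u c⟩
  have hgπ : ∀ p : Option C, (p.map π).bind g = p := by
    rintro (_ | u)
    · rfl
    · simp [hg]
  have hl' : IsLink Γ level i.val ι ι' fun u c => g c = some u := by
    simpa only [hg] using hl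
  have hg' : ∀ u, ∃ c, g c = some u := fun u => ⟨π u, (hg _ _).2 rfl⟩
  have hanc' := IsAncestry.copyLevel hanc hl' hg'
  rw [IsAncestry.step_eq_copyLevel hanc hl' hg']
  refine ⟨h.isDescribedBy_of hl.inj' hanc' fun t ht1 ht2 => ?_,
    (map_filter_eq_zero (h.ne_of_injective_forward i hf (injective_of_basis he hπ))).symm⟩
  simp only [Fin.val_succ] at ht1 ht2
  rw [h.filt_succ_forward i hf (by omega), hfilt]
  have hkey : ∀ p : Option C,
      forestKey (extendAnc i.val ι' anc g) t (p.map π) = forestKey anc t p := by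
    intro p
    rw [forestKey_extendAnc ht1 _ fun c hc => ?_, hgπ]
    obtain ⟨u, -, hu⟩ := Option.map_eq_some_iff.1 hc
    rw [(hg _ _).2 hu]
    exact Option.some_ne_none _
  -- a new component is equivalent only to itself
  have hnew : ∀ c, g c = none → ∀ q, forestKey (extendAnc i.val ι' anc g) t (some c) =
      forestKey (extendAnc i.val ι' anc g) t q → q = some c := by
    intro c hc q hq
    rw [forestKey_some, extendAnc_none hc, extendAnc_none hc, if_neg (by simp; omega)] at hq
    rcases q with _ | c'
    · simp [forestKey] at hq
    · rw [forestKey_some] at hq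
      split_ifs at hq with h1
      have hq := Option.some_injective _ hq
      rcases hc' : g c' with _ | u
      · rw [extendAnc_none hc'] at hq
        have : ι' c = ι' c' := by simpa using hq
        rw [hl.inj' this]
      · rw [extendAnc_le hc' (by omega)] at hq
        have h2 := hanc.level_le u (-t - 1).toNat
        rw [← hq] at h2
        simp at h2
  refine (keySpan_eq_map he (fun p q hpq => by rw [hkey, hkey, hpq]) fun p' q' hpq => ?_).symm
  have hcases : ∀ p' : Option C', (∃ p : Option C, p.map π = p') ∨
      ∃ c, p' = some c ∧ g c = none := by
    rintro (_ | c)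
    · exact Or.inl ⟨none, rfl⟩
    · rcases hc : g c with _ | u
      · exact Or.inr ⟨c, rfl, hc⟩
      · exact Or.inl ⟨some u, by rw [Option.map_some, (hg _ _).1 hc]⟩
  rcases hcases p' with ⟨p, rfl⟩ | ⟨c, rfl, hc⟩
  · rcases hcases q' with ⟨q, rfl⟩ | ⟨c, rfl, hc⟩
    · rw [hkey, hkey] at hpq
      exact Relation.EqvGen.rel _ _ ⟨p, q, hpq, rfl, rfl⟩
    · rw [hnew c hc _ hpq.symm]
      exact Relation.EqvGen.refl _
  · rw [hnew c hc _ hpq]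
    exact Relation.EqvGen.refl _

open Classical in
/-- A merge: the kernel is spanned by the sum of the two merging components. -/
theorem step_of_collapse_forward [Fintype β] (h : M.BarFamily m b d x) {f}
    (hf : M.map i = Sum.inl f)
    {π : C → C'} (hπ : Function.Surjective π) (he : ∀ c, f (e c) = e' (π c)) {u₁ u₂ : C}
    (hne : u₁ ≠ u₂) (hmerge : π u₁ = π u₂)
    (hcollapse : ∀ a b, π a = π b → a = b ∨ (a = u₁ ∧ b = u₂) ∨ (a = u₂ ∧ b = u₁))
    (hl : IsLink Γ level i.val ι ι' fun u c => π u = c)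
    (hT : h.IsDescribedBy i.castSucc e ι T) :
    h.IsDescribedBy i.succ e' ι' (step Γ level i.val T).1 ∧
      (step Γ level i.val T).2 =
        (Finset.univ.filter fun a => d a = i.val).val.map fun a => (b a, d a) := by
  obtain ⟨anc, hanc, hfilt⟩ := hT
  replace hanc : T.IsAncestry i.val ι anc := hanc
  obtain ⟨anc', hanc', h1, h2, T₀, hout, hT₀⟩ :=
    IsAncestry.step_merge hanc hl hπ hne hmerge hcollapse
  constructor
  · refine h.isDescribedBy_of hl.inj' hanc' fun t ht1 ht2 => ?_
    simp only [Fin.val_succ] at ht1 ht2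
    rw [h.filt_succ_forward i hf (by omega), hfilt]
    exact (keySpan_eq_map he (h1 t) (h2 t)).symm
  · have hz0 : e u₁ + e u₂ ≠ 0 := by
      intro h0
      rw [← ZModModule.sub_eq_add, sub_eq_zero] at h0
      exact hne (e.injective h0)
    obtain ⟨a₀, ha₀, hb⟩ := h.exists_unique_death_forward i hf (z := e u₁ + e u₂)
      (by rw [map_add, he, he, hmerge, ZModModule.add_self]) hz0 (ker_le_of_collapse he hcollapse)
    refine hout.trans (map_filter_eq_singleton (M := M) ha₀ fun t => ?_).symm
    rw [hb, hfilt, hT₀]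
    exact add_mem_keySpan_iff e _ (some u₁) (some u₂)

theorem isDescribedBy_backward (h : M.BarFamily m b d x) {g} (hg : M.map i = Sum.inr g)
    {π : C' → C} (he : ∀ c, g (e' c) = e (π c)) (hι' : Function.Injective ι')
    {T' : BarcodeForest β} {anc : C → ℕ → ℕ × Finset β}
    (hfilt : ∀ t, h.filt i.castSucc t = keySpan e (forestKey anc t))
    (hanc' : T'.IsAncestry (i.val + 1) ι' (extendAnc i.val ι' anc fun c => some (π c))) :
    h.IsDescribedBy i.succ e' ι' T' := by
  refine h.isDescribedBy_of hι' hanc' fun t ht1 _ => ?_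
  simp only [Fin.val_succ] at ht1
  rw [h.filt_succ_backward i hg ht1, hfilt]
  refine (keySpan_eq_comap he fun p q => ?_).symm
  have hkey : ∀ p : Option C', forestKey (extendAnc i.val ι' anc fun c => some (π c)) t p =
      forestKey anc t (p.map π) := by
    intro p
    rw [forestKey_extendAnc ht1 _ fun c _ => Option.some_ne_none _]
    cases p <;> rfl
  rw [hkey, hkey]

open Classical in
/-- A split, or the deletion of an edge without an effect on the components. -/
theorem step_of_surjective_backward [Fintype β] (h : M.BarFamily m b d x) {g}
    (hg : M.map i = Sum.inr g) {π : C' → C} (hπ : Function.Surjective π)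
    (he : ∀ c, g (e' c) = e (π c))
    (hl : IsLink Γ level i.val ι ι' fun u c => π c = u)
    (hT : h.IsDescribedBy i.castSucc e ι T) :
    h.IsDescribedBy i.succ e' ι' (step Γ level i.val T).1 ∧
      (step Γ level i.val T).2 =
        (Finset.univ.filter fun a => d a = i.val).val.map fun a => (b a, d a) := by
  obtain ⟨anc, hanc, hfilt⟩ := hT
  replace hanc : T.IsAncestry i.val ι anc := hanc
  have hl' : IsLink Γ level i.val ι ι' fun u c => (fun c => some (π c)) c = some u := by
    simpa only [Option.some.injEq] using hl
  have hg' : ∀ u, ∃ c, (fun c => some (π c)) c = some u := fun u =>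
    (hπ u).imp fun c hc => congrArg some hc
  have hanc' := IsAncestry.copyLevel hanc hl' hg'
  rw [IsAncestry.step_eq_copyLevel hanc hl' hg']
  exact ⟨h.isDescribedBy_backward hg he hl.inj' hfilt hanc', (map_filter_eq_zero
    (h.ne_of_surjective_backward i hg
      (LinearMap.range_eq_top.1 (range_eq_top_of_basis he hπ)))).symm⟩

open Classical in
/-- A departure: the range is spanned by the components other than the departing one. -/
theorem step_of_missing_backward [Fintype β] (h : M.BarFamily m b d x) {g}
    (hg : M.map i = Sum.inr g) {π : C' → C} {u : C} (hu : u ∉ Set.range π)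
    (hu' : ∀ v, v ∉ Set.range π → v = u)
    (he : ∀ c, g (e' c) = e (π c)) (hl : IsLink Γ level i.val ι ι' fun u c => π c = u)
    (hT : h.IsDescribedBy i.castSucc e ι T) :
    h.IsDescribedBy i.succ e' ι' (step Γ level i.val T).1 ∧
      (step Γ level i.val T).2 =
        (Finset.univ.filter fun a => d a = i.val).val.map fun a => (b a, d a) := by
  obtain ⟨anc, hanc, hfilt⟩ := hT
  replace hanc : T.IsAncestry i.val ι anc := hanc
  have hl' : IsLink Γ level i.val ι ι' fun u c => (fun c => some (π c)) c = some u := by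
    simpa only [Option.some.injEq] using hl
  obtain ⟨hanc', T₀, hout, hT₀⟩ := IsAncestry.step_departure hanc hl' (u := u)
    (fun c hc => hu ⟨c, Option.some_injective _ hc⟩) fun v hv => by
      by_contra hn
      exact hv (hu' v fun ⟨c, hc⟩ => hn ⟨c, congrArg some hc⟩)
  refine ⟨h.isDescribedBy_backward hg he hl.inj' hfilt hanc', ?_⟩
  have hv := basis_notMem_range he hu
  have hrange := top_le_of_missing he hu'
  obtain ⟨a₀, ha₀, hb⟩ := h.exists_unique_death_backward i hg hv hrange
  refine hout.trans (map_filter_eq_singleton (M := M) ha₀ fun t => ?_).symm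
  rw [hb, hfilt, hT₀]
  have hmem : ∀ q, q ≠ some u → pointed e q ∈ LinearMap.range g := by
    rintro (_ | v) hq
    · exact Submodule.zero_mem _
    · have : v ∈ Set.range π := by
        by_contra hn
        exact hq (congrArg some (hu' v hn))
      obtain ⟨c, rfl⟩ := this
      exact ⟨e' c, he c⟩
  constructor
  · intro hle
    by_contra hn
    push Not at hn
    refine hle (keySpan_le fun p q hpq => ?_)
    by_cases hp : p = some u
    · by_cases hq : q = some u
      · rw [hp, hq, ZModModule.add_self]
        exact Submodule.zero_mem _
      · exact absurd (hp ▸ hpq) (hn q hq)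
    · by_cases hq : q = some u
      · exact absurd (hq ▸ hpq.symm) (hn p hp)
      · exact Submodule.add_mem _ (hmem p hp) (hmem q hq)
  · rintro ⟨q, hq, hkey⟩ hle
    refine hv ?_
    have h1 := Submodule.sub_mem _ (hle (add_mem_keySpan e hkey)) (hmem q hq)
    rwa [add_sub_cancel_right] at h1

end Step

end BarFamily
end ZigzagModule

/-! ### The output of the algorithm -/

namespace ZigzagModule

open BarcodeForest

variable {m : ℕ} {M : ZigzagModule m} {ι₀ : Type*} {b d : ι₀ → ℕ} {x : ι₀ → ∀ i, M.space i}
  {β : Type*}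

/-- The zigzag module `M` has a basis in every space, indexed by `C i`, such that its maps are
induced by elementary maps of the bases, and `Γ` is the graph of these maps; `ι i` is the
inclusion of the `i`-th basis into the nodes of `Γ`. -/
structure IsPresentation (M : ZigzagModule m) (Γ : SimpleGraph β) (level : β → ℕ)
    {C : Fin (m + 1) → Type*} (ι : ∀ i, C i → β)
    (e : ∀ i, Module.Basis (C i) (ZMod 2) (M.space i)) : Prop where
  forward : ∀ i f, M.map i = Sum.inl f → ∃ π : C i.castSucc → C i.succ, IsElementary π ∧
    (∀ c, f (e i.castSucc c) = e i.succ (π c)) ∧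
    IsLink Γ level i.val (ι i.castSucc) (ι i.succ) fun u c => π u = c
  backward : ∀ i g, M.map i = Sum.inr g → ∃ π : C i.succ → C i.castSucc, IsElementary π ∧
    (∀ c, g (e i.succ c) = e i.castSucc (π c)) ∧
    IsLink Γ level i.val (ι i.castSucc) (ι i.succ) fun u c => π c = u
  isEmpty : IsEmpty (C 0)

section Presentation

variable {Γ : SimpleGraph β} {level : β → ℕ} {C : Fin (m + 1) → Type*} {ι : ∀ i, C i → β}
  {e : ∀ i, Module.Basis (C i) (ZMod 2) (M.space i)}

theorem IsPresentation.subsingleton (hM : M.IsPresentation Γ level ι e) :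
    Subsingleton (M.space 0) :=
  have := hM.isEmpty
  (e 0).repr.toEquiv.subsingleton

open Classical in
/-- One iteration of the algorithm preserves the description of the filtration, and outputs the
intervals that end. -/
theorem BarFamily.step_spec [Fintype ι₀] [Fintype β] (h : M.BarFamily m b d x)
    (hM : M.IsPresentation Γ level ι e) (i : Fin m) {T : BarcodeForest β}
    (hT : h.IsDescribedBy i.castSucc (e i.castSucc) (ι i.castSucc) T) :
    h.IsDescribedBy i.succ (e i.succ) (ι i.succ) (step Γ level i.val T).1 ∧
      (step Γ level i.val T).2 =
        (Finset.univ.filter fun a => d a = i.val).val.map fun a => (b a, d a) := by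
  rcases hmap : M.map i with f | g
  · obtain ⟨π, hπ, he, hl⟩ := hM.forward i f hmap
    rcases hπ with ⟨hinj, -⟩ | ⟨hsurj, u₁, u₂, hne, hmerge, hcollapse⟩
    · exact h.step_of_injective_forward hmap hinj he hl hT
    · exact h.step_of_collapse_forward hmap hsurj he hne hmerge hcollapse hl hT
  · obtain ⟨π, hπ, he, hl⟩ := hM.backward i g hmap
    by_cases hsurj : Function.Surjective π
    · exact h.step_of_surjective_backward hmap hsurj he hl hT
    · obtain ⟨u, hu⟩ : ∃ u, u ∉ Set.range π := by
        by_contra hn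
        push Not at hn
        exact hsurj hn
      have hmiss := (hπ.resolve_right fun h' => hsurj h'.1).2
      exact h.step_of_missing_backward hmap hu (fun v hv => hmiss v u hv hu) he hl hT

open Classical in
/-- The invariant of the algorithm: for every interval decomposition, the forest describes the
filtrations by births, and the intervals that have been output are those that have ended. -/
theorem BarFamily.run_spec [Fintype ι₀] [Fintype β] (h : M.BarFamily m b d x)
    (hM : M.IsPresentation Γ level ι e) (i : Fin (m + 1)) :
    h.IsDescribedBy i (e i) (ι i) (run Γ level i.val).1 ∧ (run Γ level i.val).2 =
      (Finset.univ.filter fun a => d a < i.val).val.map fun a => (b a, d a) := by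
  induction i using Fin.induction with
  | zero =>
    have := hM.isEmpty
    have := hM.subsingleton
    refine ⟨⟨fun _ _ => (0, ∅), ?_, fun t => Subsingleton.elim _ _⟩, by simp [run]⟩
    constructor <;> simp [run]
  | succ i ih =>
    obtain ⟨h1, h2⟩ := h.step_spec hM i ih.1
    refine ⟨h1, ?_⟩
    have h3 : (run Γ level i.succ.val).2 =
      (run Γ level i.castSucc.val).2 + (step Γ level i.val (run Γ level i.castSucc.val).1).2 := rfl
    rw [h3, ih.2, h2, ← Multiset.map_add]
    congr 1
    have h4 : Disjoint (Finset.univ.filter fun a => d a < i.castSucc.val)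
        (Finset.univ.filter fun a => d a = i.val) := by
      rw [Finset.disjoint_filter]
      intro a _ ha ha'
      simp at ha
      omega
    rw [← Finset.disjUnion_val _ _ h4]
    congr 1
    ext a
    simp
    omega

end Presentation

namespace BarFamily

/-- A step of the filtration by births changes it by the generator of the interval with this birth
(births being distinct), if there is one. -/
theorem filt_step (h : M.BarFamily m b d x) (hb : Function.Injective b) (i : Fin (m + 1)) (t : ℤ) :
    (∃ a, b a ≤ i.val ∧ i.val ≤ d a ∧ M.birthKey (b a) = t ∧
      h.filt i t ≤ h.filt i (t - 1) ⊔ Submodule.span (ZMod 2) {x a i}) ∨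
    h.filt i t ≤ h.filt i (t - 1) := by
  by_cases hex : ∃ a, b a ≤ i.val ∧ i.val ≤ d a ∧ M.birthKey (b a) = t
  · obtain ⟨a, h1, h2, h3⟩ := hex
    refine Or.inl ⟨a, h1, h2, h3, h.filt_le fun a' ha' => ?_⟩
    rcases lt_or_eq_of_le ha' with hlt | heq
    · exact Submodule.mem_sup_left (h.mem_filt (by omega))
    · have : b a' = b a := by
        rw [← M.natAbs_birthKey (b a'), heq, ← h3, M.natAbs_birthKey]
      rw [hb this]
      exact Submodule.mem_sup_right (Submodule.mem_span_singleton_self _)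
  · refine Or.inr (h.filt_le fun a ha => ?_)
    by_cases hal : b a ≤ i.val ∧ i.val ≤ d a
    · have : M.birthKey (b a) ≠ t := fun h3 => hex ⟨a, hal.1, hal.2, h3⟩
      exact h.mem_filt (by omega)
    · rw [h.eq_zero a i hal]
      exact Submodule.zero_mem _

theorem exists_iff_not_filt_le [Fintype ι₀] (h : M.BarFamily m b d x) (hb : Function.Injective b)
    (i : Fin (m + 1)) (t : ℤ) : (∃ a, b a ≤ i.val ∧ i.val ≤ d a ∧ M.birthKey (b a) = t) ↔
      ¬ h.filt i t ≤ h.filt i (t - 1) := by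
  constructor
  · rintro ⟨a, h1, h2, h3⟩ hle
    have h4 := hle ((h.mem_filt_iff h1 h2).2 h3.le)
    rw [h.mem_filt_iff h1 h2] at h4
    omega
  · intro hle
    obtain ⟨a, h1, h2, h3, -⟩ := (h.filt_step hb i t).resolve_right hle
    exact ⟨a, h1, h2, h3⟩

theorem add_mem_filt (h : M.BarFamily m b d x) (hb : Function.Injective b) {i : Fin (m + 1)}
    {t : ℤ} {y y' : M.space i} (hy : y ∈ h.filt i t) (hy' : y' ∈ h.filt i t)
    (hn : y ∉ h.filt i (t - 1)) (hn' : y' ∉ h.filt i (t - 1)) : y + y' ∈ h.filt i (t - 1) := by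
  rcases h.filt_step hb i t with ⟨a, -, -, -, hle⟩ | hle
  · exact add_mem_of_le_sup_span hle hy hy' hn hn'
  · exact absurd (hle hy) hn

section Final

variable {i : Fin (m + 1)} {C : Type*} {e : Module.Basis C (ZMod 2) (M.space i)} {ι : C → β}
  {T : BarcodeForest β} {anc : C → ℕ → ℕ × Finset β}

theorem filt_le_iff (h : M.BarFamily m b d x)
    (hfilt : ∀ t, h.filt i t = keySpan e (forestKey anc t)) (t : ℤ) :
    h.filt i t ≤ h.filt i (t - 1) ↔ ∀ p q, forestKey anc t p = forestKey anc t q →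
      forestKey anc (t - 1) p = forestKey anc (t - 1) q := by
  rw [hfilt, hfilt]
  constructor
  · intro hle p q hpq
    exact (add_mem_keySpan_iff e _ p q).1 (hle (add_mem_keySpan e hpq))
  · exact fun hle => keySpan_le fun p q hpq => add_mem_keySpan e (hle p q hpq)

/-- The equivalence relations of the steps `k - 1` and `k` differ if and only if there is a root on
level `k`. -/
theorem exists_root_iff [Fintype ι₀] (h : M.BarFamily m b d x) (hb : Function.Injective b)
    (hfilt : ∀ t, h.filt i t = keySpan e (forestKey anc t)) (k : ℕ) :
    (∃ u, (anc u 0).1 = k) ↔ ∃ a, b a ≤ i.val ∧ i.val ≤ d a ∧ M.birthKey (b a) = k := by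
  rw [h.exists_iff_not_filt_le hb, h.filt_le_iff hfilt]
  constructor
  · rintro ⟨u, hu⟩ hle
    have h1 := hle (some u) none (by rw [forestKey_some, if_pos (by omega), forestKey_none])
    rw [forestKey_some, if_neg (by omega)] at h1
    cases h1
  · intro hle
    by_contra hn
    push Not at hn
    have hkey : forestKey anc ((k : ℤ) - 1) = forestKey anc k := by
      funext p
      rcases p with _ | u
      · rfl
      · have h1 := hn u
        have h2 : (-((k : ℤ) - 1) - 1).toNat = (-(k : ℤ) - 1).toNat := by omega
        rw [forestKey_some, forestKey_some, h2]
        by_cases h3 : ((anc u 0).1 : ℤ) ≤ k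
        · rw [if_pos h3, if_pos (by omega)]
        · rw [if_neg h3, if_neg (by omega)]
    exact hle fun p q hpq => by rw [hkey, hpq]

/-- Two roots on the same level would contribute two dimensions to one step of the filtration. -/
theorem root_unique (h : M.BarFamily m b d x) (hb : Function.Injective b)
    (hfilt : ∀ t, h.filt i t = keySpan e (forestKey anc t)) {u v : C}
    (huv : (anc u 0).1 = (anc v 0).1) : anc u 0 = anc v 0 := by
  have hmem : ∀ w, (anc w 0).1 = (anc u 0).1 → pointed e (some w) ∈ h.filt i (anc u 0).1 := by
    intro w hw
    rw [hfilt, pointed_mem_keySpan_iff, forestKey_some, if_pos (by omega), forestKey_none]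
  have hnot : ∀ w, (anc w 0).1 = (anc u 0).1 →
      pointed e (some w) ∉ h.filt i (((anc u 0).1 : ℤ) - 1) := by
    intro w hw
    rw [hfilt, pointed_mem_keySpan_iff, forestKey_some, if_neg (by omega), forestKey_none]
    exact Option.some_ne_none _
  have h1 := h.add_mem_filt hb (hmem u rfl) (hmem v huv.symm) (hnot u rfl) (hnot v huv.symm)
  have h2 : (-(((anc u 0).1 : ℤ) - 1) - 1).toNat = 0 := by omega
  rw [hfilt, add_mem_keySpan_iff, forestKey_some, forestKey_some, if_neg (by omega),
    if_neg (by omega), h2] at h1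
  exact Option.some_injective _ h1

theorem forestKey_of_neg (anc : C → ℕ → ℕ × Finset β) (k : ℕ) (u : C) :
    forestKey anc (-((k + 1 : ℕ) : ℤ)) (some u) = some (anc u k) := by
  have h1 : (-(-((k + 1 : ℕ) : ℤ)) - 1).toNat = k := by omega
  rw [forestKey_some, if_neg (by omega), h1]

theorem forestKey_of_neg_sub_one (anc : C → ℕ → ℕ × Finset β) (k : ℕ) (u : C) :
    forestKey anc (-((k + 1 : ℕ) : ℤ) - 1) (some u) = some (anc u (k + 1)) := by
  have h1 : (-(-((k + 1 : ℕ) : ℤ) - 1) - 1).toNat = k + 1 := by omega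
  rw [forestKey_some, if_neg (by omega), h1]

/-- The equivalence relations of the steps `-(k + 1) - 1` and `-(k + 1)` differ if and only if two
paths part at a node on level `k`. -/
theorem exists_split_iff [Fintype ι₀] (h : M.BarFamily m b d x) (hb : Function.Injective b)
    (hfilt : ∀ t, h.filt i t = keySpan e (forestKey anc t)) (k : ℕ) :
    (∃ u v, anc u k = anc v k ∧ anc u (k + 1) ≠ anc v (k + 1)) ↔
      ∃ a, b a ≤ i.val ∧ i.val ≤ d a ∧ M.birthKey (b a) = -((k + 1 : ℕ) : ℤ) := by
  rw [h.exists_iff_not_filt_le hb, h.filt_le_iff hfilt]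
  constructor
  · rintro ⟨u, v, huv, hne⟩ hle
    have h1 := hle (some u) (some v) (by rw [forestKey_of_neg, forestKey_of_neg, huv])
    rw [forestKey_of_neg_sub_one, forestKey_of_neg_sub_one] at h1
    exact hne (Option.some_injective _ h1)
  · intro hle
    by_contra hn
    push Not at hn
    refine hle fun p q hpq => ?_
    rcases p with _ | u <;> rcases q with _ | v
    · rfl
    · rw [forestKey_of_neg, forestKey_none] at hpq
      cases hpq
    · rw [forestKey_of_neg, forestKey_none] at hpq
      cases hpq
    · rw [forestKey_of_neg, forestKey_of_neg] at hpq
      rw [forestKey_of_neg_sub_one, forestKey_of_neg_sub_one, hn u v (Option.some_injective _ hpq)]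

/-- Two splitting nodes on the same level would contribute two dimensions to one step of the
filtration. -/
theorem split_unique (h : M.BarFamily m b d x) (hb : Function.Injective b)
    (hfilt : ∀ t, h.filt i t = keySpan e (forestKey anc t)) (hT : T.IsAncestry i.val ι anc) {k : ℕ}
    {u v u' v' : C} (huv : anc u k = anc v k) (hne : anc u (k + 1) ≠ anc v (k + 1))
    (huv' : anc u' k = anc v' k) (hne' : anc u' (k + 1) ≠ anc v' (k + 1)) :
    anc u k = anc u' k := by
  classical
  by_contra hn
  have hmem : ∀ u v, anc u k = anc v k →
      pointed e (some u) + pointed e (some v) ∈ h.filt i (-((k + 1 : ℕ) : ℤ)) := by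
    intro u v huv
    rw [hfilt, add_mem_keySpan_iff, forestKey_of_neg, forestKey_of_neg, huv]
  have hnot : ∀ u v, anc u (k + 1) ≠ anc v (k + 1) →
      pointed e (some u) + pointed e (some v) ∉ h.filt i (-((k + 1 : ℕ) : ℤ) - 1) := by
    intro u v huv
    rw [hfilt, add_mem_keySpan_iff, forestKey_of_neg_sub_one, forestKey_of_neg_sub_one]
    exact fun h' => huv (Option.some_injective _ h')
  have h1 := h.add_mem_filt hb (hmem u v huv) (hmem u' v' huv') (hnot u v hne) (hnot u' v' hne')
  rw [hfilt] at h1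
  -- the functional that counts the leaves above `anc u (k + 1)` separates the two sums
  have h2 := keyDual_eq_zero (some u) h1
  have h3 : anc u' (k + 1) ≠ anc u (k + 1) := fun h' => hn (hT.coherent h' (Nat.le_succ k)).symm
  have h4 : anc v' (k + 1) ≠ anc u (k + 1) := fun h' =>
    hn ((hT.coherent h' (Nat.le_succ k)).symm.trans huv'.symm)
  simp only [map_add, keyDual_pointed, forestKey_of_neg_sub_one, forestKey_none,
    Option.some.injEq, if_neg hne.symm, if_neg h3, if_neg h4, reduceCtorEq, if_true, if_false,
    add_zero] at h2
  exact one_ne_zero h2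

end Final

open Classical in
/-- The intervals added at the end are those that reach the last index. -/
theorem finalIntervals_eq [Fintype ι₀] (h : M.BarFamily m b d x) (hb : Function.Injective b)
    {C : Type*} {e : Module.Basis C (ZMod 2) (M.space (Fin.last m))} {ι : C → β}
    (hι : Function.Injective ι) {T : BarcodeForest β}
    (hT : h.IsDescribedBy (Fin.last m) e ι T) : T.finalIntervals m =
      (Finset.univ.filter fun a => d a = m).val.map fun a => (b a, d a) := by
  obtain ⟨anc, hanc, hfilt⟩ := hT
  have hle := h.le
  have hlem := h.le_length
  have halive : ∀ t : ℤ, (∃ a, b a ≤ (Fin.last m).val ∧ (Fin.last m).val ≤ d a ∧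
      M.birthKey (b a) = t) ↔ ∃ a, d a = m ∧ M.birthKey (b a) = t := by
    intro t
    refine exists_congr fun a => ?_
    have := hle a
    have := hlem a
    rw [Fin.val_last, ← and_assoc]
    exact and_congr_left fun _ => by omega
  have hroot : ∀ k : ℕ, (∃ y, T.IsRoot y ∧ y.1 = k) ↔ ∃ a, d a = m ∧ M.birthKey (b a) = k := by
    intro k
    rw [← halive, ← h.exists_root_iff hb hfilt]
    constructor
    · rintro ⟨y, hy, hyk⟩
      obtain ⟨u, rfl⟩ := hanc.isRoot_iff.1 hy
      exact ⟨u, hyk⟩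
    · rintro ⟨u, hu⟩
      exact ⟨_, hanc.isRoot_iff.2 ⟨u, rfl⟩, hu⟩
  have hsplit : ∀ k : ℕ, (∃ y, T.IsSplitting y ∧ y.1 = k) ↔
      ∃ a, d a = m ∧ M.birthKey (b a) = -((k + 1 : ℕ) : ℤ) := by
    intro k
    rw [← halive, ← h.exists_split_iff hb hfilt]
    constructor
    · rintro ⟨y, hy, hyk⟩
      obtain ⟨u, v, l, h1, h2, rfl, h4, h5⟩ := hanc.isSplitting_iff.1 hy
      obtain rfl : l = k := by rw [← hyk, hanc.level_eq h1 h2.le]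
      exact ⟨u, v, h4, h5⟩
    · rintro ⟨u, v, h1, h2⟩
      have h3 : k < m := by
        by_contra hk
        have := hanc.leaf_injective hι (by simpa using hk) h1
        exact h2 (by rw [this])
      have h4 : (anc u 0).1 ≤ k := by
        by_contra hk
        have h5 := hanc.root_eq h1
        exact h2 (by
          rw [hanc.below (u := u) (by omega), hanc.below (u := v) (by rw [← h5]; omega), h5])
      exact ⟨_, hanc.isSplitting_iff.2 ⟨u, v, k, h4, h3, rfl, h1, h2⟩, hanc.level_eq h4 h3.le⟩
  have hleft : (T.finalIntervals m).Nodup := by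
    refine Multiset.Nodup.add_iff ?_ ?_ |>.2 ?_
    · refine Multiset.Nodup.map_on (fun y hy z hz hyz => ?_) (Finset.nodup _)
      obtain ⟨u, rfl⟩ := hanc.isRoot_iff.1 (Finset.mem_filter.1 hy).2
      obtain ⟨v, rfl⟩ := hanc.isRoot_iff.1 (Finset.mem_filter.1 hz).2
      have h1 := congrArg Prod.fst hyz
      exact h.root_unique hb hfilt h1
    · refine Multiset.Nodup.map_on (fun y hy z hz hyz => ?_) (Finset.nodup _)
      obtain ⟨u, v, k, h1, h2, rfl, h4, h5⟩ := hanc.isSplitting_iff.1 (Finset.mem_filter.1 hy).2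
      obtain ⟨u', v', k', h1', h2', rfl, h4', h5'⟩ :=
        hanc.isSplitting_iff.1 (Finset.mem_filter.1 hz).2
      have h6 : k = k' := by
        have := congrArg Prod.fst hyz
        simp only [hanc.level_eq h1 h2.le, hanc.level_eq h1' h2'.le] at this
        omega
      subst h6
      exact h.split_unique hb hfilt hanc h4 h5 h4' h5'
    · rw [Multiset.disjoint_left]
      intro w hw hw'
      obtain ⟨y, hy, rfl⟩ := Multiset.mem_map.1 hw
      obtain ⟨z, hz, hzy⟩ := Multiset.mem_map.1 hw'
      obtain ⟨a, -, ha⟩ := (hroot y.1).1 ⟨y, (Finset.mem_filter.1 hy).2, rfl⟩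
      obtain ⟨a', -, ha'⟩ := (hsplit z.1).1 ⟨z, (Finset.mem_filter.1 hz).2, rfl⟩
      have h1 : z.1 + 1 = y.1 := congrArg Prod.fst hzy
      have h2 : b a = b a' := by
        rw [← M.natAbs_birthKey (b a), ← M.natAbs_birthKey (b a'), ha, ha']
        omega
      rw [h2, ha'] at ha
      omega
  have hright : ((Finset.univ.filter fun a => d a = m).val.map fun a => (b a, d a)).Nodup :=
    Multiset.Nodup.map_on (fun a _ a' _ haa => hb (congrArg Prod.fst haa)) (Finset.nodup _)
  refine (Multiset.Nodup.ext hleft hright).2 fun w => ?_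
  rw [finalIntervals, Multiset.mem_add, Multiset.mem_map, Multiset.mem_map, Multiset.mem_map]
  simp only [Finset.mem_val, Finset.mem_filter, Finset.mem_univ, true_and]
  constructor
  · rintro (⟨y, ⟨-, hy⟩, rfl⟩ | ⟨y, ⟨-, hy⟩, rfl⟩)
    · obtain ⟨a, h1, h2⟩ := (hroot y.1).1 ⟨y, hy, rfl⟩
      refine ⟨a, h1, ?_⟩
      rw [h1, ← M.natAbs_birthKey (b a), h2, Int.natAbs_natCast]
    · obtain ⟨a, h1, h2⟩ := (hsplit y.1).1 ⟨y, hy, rfl⟩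
      refine ⟨a, h1, ?_⟩
      rw [h1, ← M.natAbs_birthKey (b a), h2, Int.natAbs_neg, Int.natAbs_natCast]
  · rintro ⟨a, ha, rfl⟩
    have h1 := M.natAbs_birthKey (b a)
    rcases le_or_gt 0 (M.birthKey (b a)) with h0 | h0
    · obtain ⟨y, hy, hyk⟩ := (hroot (b a)).2 ⟨a, ha, by omega⟩
      exact Or.inl ⟨y, ⟨hy.1, hy⟩, by rw [hyk, ha]⟩
    · obtain ⟨y, hy, hyk⟩ := (hsplit (b a - 1)).2 ⟨a, ha, by omega⟩
      exact Or.inr ⟨y, ⟨hy.1, hy⟩, by rw [hyk, ha, Nat.sub_add_cancel (by omega)]⟩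

end BarFamily

section Pairing

variable {Γ : SimpleGraph β} {level : β → ℕ} {C : Fin (m + 1) → Type*} {ι : ∀ i, C i → β}
  {e : ∀ i, Module.Basis (C i) (ZMod 2) (M.space i)}

/-- The output of the algorithm is the multiset of intervals of any decomposition. -/
theorem BarFamily.pairing_eq [Fintype ι₀] [Fintype β] (h : M.BarFamily m b d x)
    (hM : M.IsPresentation Γ level ι e) (hι : ∀ i, Function.Injective (ι i)) :
    pairing Γ level m = Finset.univ.val.map fun a => (b a, d a) := by
  classical
  have := hM.subsingleton
  have hb : Function.Injective b := by
    refine h.injective_birth (fun i f hf => ?_) fun i g hg => ?_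
    · obtain ⟨π, hπ, he, -⟩ := hM.forward i f hf
      exact hπ.exists_top_le he
    · obtain ⟨π, hπ, he, -⟩ := hM.backward i g hg
      exact hπ.exists_ker_le he
  obtain ⟨h1, h2⟩ := h.run_spec hM (Fin.last m)
  have h3 := h.finalIntervals_eq hb (hι _) h1
  rw [Fin.val_last] at h2 h3
  rw [pairing, h2, h3, ← Multiset.map_add]
  congr 1
  have h4 : Disjoint (Finset.univ.filter fun a => d a < m)
      (Finset.univ.filter fun a => d a = m) := by
    rw [Finset.disjoint_filter]
    intro a _ ha ha'
    omega
  rw [← Finset.disjUnion_val _ _ h4]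
  congr 1
  ext a
  have := h.le_length a
  simp
  omega

/-- For a zigzag module with maps induced by elementary maps of finite bases, the pairing algorithm
on the graph of these maps computes the barcode. -/
theorem IsPresentation.isBarcode_pairing [Fintype β] [∀ i, Finite (C i)]
    (hM : M.IsPresentation Γ level ι e) (hι : ∀ i, Function.Injective (ι i)) :
    M.IsBarcode (pairing Γ level m) ∧ ∀ B, M.IsBarcode B → B = pairing Γ level m := by
  constructor
  · have := hM.subsingleton
    have : ∀ i, Module.Finite (ZMod 2) (M.space i) := fun i => Module.Finite.of_basis (e i)
    obtain ⟨ι₀, _, b, d, x, h⟩ := exists_barFamily M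
      (fun i f hf => by
        obtain ⟨π, hπ, he, -⟩ := hM.forward i f hf
        exact hπ.exists_ker_le he)
      fun i g hg => by
        obtain ⟨π, hπ, he, -⟩ := hM.backward i g hg
        exact hπ.exists_top_le he
    have h' := h.reindex (Fintype.equivFin ι₀).symm
    exact isBarcode_iff.2 ⟨_, _, _, _, h', h'.pairing_eq hM hι⟩
  · intro B hB
    obtain ⟨n, b, d, x, h, rfl⟩ := isBarcode_iff.1 hB
    exact (h.pairing_eq hM hι).symm

end Pairing

end ZigzagModule

/-! ### The barcode graph of a zigzag filtration -/

namespace ZigzagFiltration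

open BarcodeForest

variable {V : Type*} {G : SimpleGraph V} {m : ℕ}

theorem isLink_barcodeGraph (F : ZigzagFiltration G m) (i : Fin m) :
    IsLink F.barcodeGraph (fun x => x.1.val) i.val (Sigma.mk i.castSucc) (Sigma.mk i.succ)
      (F.Linked i) where
  inj := sigma_mk_injective
  inj' := sigma_mk_injective
  level_iff := by
    rintro ⟨k, c⟩
    constructor
    · intro hk
      obtain rfl : k = i.castSucc := Fin.ext hk
      exact ⟨c, rfl⟩
    · rintro ⟨u, hu⟩
      rw [← hu]
      rfl
  level_iff' := by
    rintro ⟨k, c⟩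
    constructor
    · intro hk
      obtain rfl : k = i.succ := Fin.ext hk
      exact ⟨c, rfl⟩
    · rintro ⟨u, hu⟩
      rw [← hu]
      rfl
  adj_iff := by
    intro u c
    constructor
    · rintro ⟨j, c₁, c₂, hL, ⟨h1, h2⟩ | ⟨h1, h2⟩⟩
      · obtain rfl : i = j := Fin.castSucc_injective _ (congrArg Sigma.fst h1)
        rw [sigma_mk_injective h1, sigma_mk_injective h2]
        exact hL
      · have h3 := congrArg (fun x => x.1.val) h1
        have h4 := congrArg (fun x => x.1.val) h2
        simp at h3 h4
        omega
    · exact fun hL => ⟨i, u, c, hL, Or.inl ⟨rfl, rfl⟩⟩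

theorem isPresentation_zigzagH0 (F : ZigzagFiltration G m) (hF : F.graph 0 = ⊥) :
    F.zigzagH0.IsPresentation F.barcodeGraph (fun x => x.1.val) (fun i => Sigma.mk i)
      (fun i => GraphHomology.componentBasis (F.graph i).coe) where
  forward := by
    intro i f hf
    by_cases hle : F.graph i.castSucc ≤ F.graph i.succ
    · have hmap : F.zigzagH0.map i =
          Sum.inl (GraphHomology.H0map (SimpleGraph.Subgraph.inclusion hle)) := dif_pos hle
      rw [hmap] at hf
      obtain rfl := Sum.inl_injective hf
      have hadd := (F.step i).resolve_right fun h' => h'.not_ge hle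
      refine ⟨_, hadd.isElementary, fun c => GraphHomology.H0map_componentBasis _ c, ?_⟩
      have hl := F.isLink_barcodeGraph i
      refine ⟨hl.inj, hl.inj', hl.level_iff, hl.level_iff', fun u c => (hl.adj_iff u c).trans ?_⟩
      exact ⟨fun h' => h'.elim (fun ⟨_, h2⟩ => h2) fun ⟨h1, _⟩ => absurd h1 hadd.not_ge,
        fun h' => Or.inl ⟨hle, h'⟩⟩
    · have hmap : F.zigzagH0.map i = Sum.inr (GraphHomology.H0map
          (SimpleGraph.Subgraph.inclusion (F.ge_of_not_le i hle))) := dif_neg hle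
      rw [hmap] at hf
      cases hf
  backward := by
    intro i g hg
    by_cases hle : F.graph i.castSucc ≤ F.graph i.succ
    · have hmap : F.zigzagH0.map i =
          Sum.inl (GraphHomology.H0map (SimpleGraph.Subgraph.inclusion hle)) := dif_pos hle
      rw [hmap] at hg
      cases hg
    · have hmap : F.zigzagH0.map i = Sum.inr (GraphHomology.H0map
          (SimpleGraph.Subgraph.inclusion (F.ge_of_not_le i hle))) := dif_neg hle
      rw [hmap] at hg
      obtain rfl := Sum.inr_injective hg
      have hadd := (F.step i).resolve_left fun h' => hle h'.le
      refine ⟨_, hadd.isElementary, fun c => GraphHomology.H0map_componentBasis _ c, ?_⟩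
      have hl := F.isLink_barcodeGraph i
      refine ⟨hl.inj, hl.inj', hl.level_iff, hl.level_iff', fun u c => (hl.adj_iff u c).trans ?_⟩
      exact ⟨fun h' => h'.elim (fun ⟨h1, _⟩ => absurd h1 hle) fun ⟨_, h2⟩ => h2,
        fun h' => Or.inr ⟨hadd.le, h'⟩⟩
  isEmpty := by
    constructor
    intro c
    obtain ⟨v, hv⟩ := c.out
    rw [hF] at hv
    exact hv

end ZigzagFiltration

theorem mainTheorem1 {V : Type*} [Finite V] (G : SimpleGraph V) (m : ℕ)
    (F : ZigzagFiltration G m) (hF : F.graph 0 = ⊥) :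
    F.zigzagH0.IsBarcode F.zeroZigzagAlgorithm ∧
      ∀ B : Multiset (ℕ × ℕ), F.zigzagH0.IsBarcode B → B = F.zeroZigzagAlgorithm := by
  have : ∀ i, Finite (F.graph i).coe.ConnectedComponent := fun i =>
    Finite.of_surjective (F.graph i).coe.connectedComponentMk Quot.mk_surjective
  exact (F.isPresentation_zigzagH0 hF).isBarcode_pairing fun _ => sigma_mk_injective
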